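/- Let $\mathsf{Sp}(2)\mathsf{S}^1\subset \mathsf{SU}(5)$ be the image of $\mathsf{Sp}(2)\times \mathsf{S}^1$ under $(A,\lambda)\mapsto \lambda A\in \mathsf{U}(4)$, where $\mathsf{Sp}(2)=\mathsf{Sp}(4,\mathbb{C})\cap\mathsf{U}(4)$ and $\mathsf{U}(4)\subset\mathsf{SU}(5)$ via $B\mapsto \mathrm{diag}(B,(\det B)^{-1})$, and let $B^{13}=\mathsf{SU}(5)/\mathsf{Sp}(2)\mathsf{S}^1$ be the Berger space. On $\mathfrak{su}(5)$ put $Q(X,Y)=-\tfrac12\operatorname{Re}\operatorname{tr}(XY)$; let $\mathfrak{p}_1$ be the $Q$-orthogonal complement of $\mathfrak{sp}(2)$ in $\mathfrak{su}(4)$ and $\mathfrak{p}_2$ the $Q$-orthogonal complement of $\mathfrak{su}(4)\oplus\mathbb{R}$ (the block diagonal matrices) in $\mathfrak{su}(5)$, so that $\mathfrak{p}_1\oplus\mathfrak{p}_2$ is the tangent space of $B^{13}$ at the base point. For $x_1,x_2>0$ denote by $\langle\cdot,\cdot\rangle_{x_1,x_2}$ the $\mathsf{SU}(5)$-invariant Riemannian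 metric on $B^{13}$ that equals $x_1Q|_{\mathfrak{p}_1}+x_2Q|_{\mathfrak{p}_2}$ at the base point. **Theorem.** There are $\mathsf{SU}(5)$-invariant metrics on $B^{13}$ that have positive sectional curvature and evolve under the Ricci flow to metrics with non-positively curved planes. More precisely, there is $\varepsilon_0>0$ such that for every $\varepsilon\in(0,\varepsilon_0)$ the metric $\langle\cdot,\cdot\rangle_{2-\varepsilon,1}$ has positive sectional curvature, and there are $0<\tau<T$ and a solution $g(\ell)=\langle\cdot,\cdot\rangle_{x_1(\ell),x_2(\ell)}$, $\ell\in[0,T)$, of the Ricci flow $\frac{\partial}{\partial \ell}g(\ell)=-2\operatorname{Ric}(g(\ell))$ with $g(0)=\langle\cdot,\cdot\rangle_{2-\varepsilon,1}$ such that $x_1<2x_2$ on $[0,\tau)$, $x_1(\tau)=2x_2(\tau)$, $x_1>2x_2$ on $(\tau,T)$, and for every $\ell\in[\tau,T)$ the metric $g(\ell)$ has a tangent plane of sectional curvature $\le 0$. -/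

import Mathlib

open scoped ContDiff Matrix

namespace Berger

noncomputable section

/-! ### Riemannian curvature in coordinates

`V` is a finite-dimensional real vector space (the coordinate domain), and `γ x v w` is the
coefficient function of a Riemannian metric: the inner product at the point `x` of the constant
vector fields `v` and `w`. -/

section Coordinates

variable {V : Type*} [AddCommGroup V] [Module ℝ V]

/-- Christoffel symbols of the first kind, `⟨∇_u v, z⟩` at the point `x` for constant vector
fields `u`, `v`, `z`. -/
def christoffelFst (γ : V → V → V → ℝ) (x u v z : V) : ℝ :=
  (lineDeriv ℝ (fun y => γ y v z) x u + lineDeriv ℝ (fun y => γ y u z) x v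
    - lineDeriv ℝ (fun y => γ y u v) x z) / 2

variable [Module.Finite ℝ V]

/-- The matrix `(g_{ij})` of the metric at `x` in a fixed basis of `V`. -/
def gram (γ : V → V → V → ℝ) (x : V) :
    Matrix (Fin (Module.finrank ℝ V)) (Fin (Module.finrank ℝ V)) ℝ :=
  Matrix.of fun i j => γ x (Module.finBasis ℝ V i) (Module.finBasis ℝ V j)

/-- Christoffel symbols of the second kind, the vector `∇_u v` at the point `x` for constant
vector fields `u`, `v` (the index of `christoffelFst` is raised with `(g^{ij})`). -/
def christoffel (γ : V → V → V → ℝ) (x u v : V) : V :=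
  ∑ i, ∑ j, ((gram γ x)⁻¹ i j * christoffelFst γ x u v (Module.finBasis ℝ V j)) •
    Module.finBasis ℝ V i

/-- The Riemann curvature tensor `⟨R(u, v) w, z⟩` at the point `x`, for
`R(u, v) = ∇_u ∇_v - ∇_v ∇_u` on constant vector fields. -/
def riemann (γ : V → V → V → ℝ) (x u v w z : V) : ℝ :=
  lineDeriv ℝ (fun y => christoffelFst γ y v w z) x u
    - lineDeriv ℝ (fun y => christoffelFst γ y u w z) x v
    - γ x (christoffel γ x v w) (christoffel γ x u z)
    + γ x (christoffel γ x u w) (christoffel γ x v z)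

/-- The sectional curvature at `x` of the plane spanned by `u` and `v`. -/
def sectional (γ : V → V → V → ℝ) (x u v : V) : ℝ :=
  riemann γ x u v v u / (γ x u u * γ x v v - γ x u v ^ 2)

/-- The Ricci tensor at `x`, i.e. `Ric(v, w) = trace (u ↦ R(u, v) w)`. -/
def ricci (γ : V → V → V → ℝ) (x v w : V) : ℝ :=
  ∑ i, ∑ j, (gram γ x)⁻¹ i j *
    riemann γ x (Module.finBasis ℝ V i) v w (Module.finBasis ℝ V j)

end Coordinates

/-! ### The group `SU(5)`, its Lie algebra, and the Berger space -/

/-- Index set with four elements, arranged in two pairs. -/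
abbrev Four : Type := Fin 2 ⊕ Fin 2

/-- Index set with five elements, arranged as four plus one. -/
abbrev Five : Type := Four ⊕ Unit

/-- The group `SU(5)`. -/
abbrev SU5 : Type := Matrix.specialUnitaryGroup Five ℂ

/-- The Lie algebra `su(5)` of traceless skew-Hermitian matrices. -/
def su5 : Submodule ℝ (Matrix Five Five ℂ) where
  carrier := {X | Xᴴ = -X ∧ X.trace = 0}
  add_mem' := by
    rintro X Y ⟨hX, hX'⟩ ⟨hY, hY'⟩
    refine ⟨?_, ?_⟩
    · rw [Matrix.conjTranspose_add, hX, hY, neg_add]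
    · rw [Matrix.trace_add, hX', hY', add_zero]
  zero_mem' := by simp
  smul_mem' := by
    rintro c X ⟨hX, hX'⟩
    refine ⟨?_, ?_⟩
    · rw [Matrix.conjTranspose_smul, hX, smul_neg, star_trivial]
    · rw [Matrix.trace_smul, hX', smul_zero]

/-- The embedding of `U(4)` into `SU(5)`, `B ↦ diag(B, (det B)⁻¹)`. -/
def embedU4 : Matrix.unitaryGroup Four ℂ →* SU5 where
  toFun B := ⟨Matrix.fromBlocks B.1 0 0 ((B.1.det)⁻¹ • 1), by
    have hB := Matrix.mem_unitaryGroup_iff.1 B.2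
    have hd : B.1.det * star B.1.det = 1 := by
      have := congrArg Matrix.det hB
      rwa [Matrix.det_mul, Matrix.star_eq_conjTranspose, Matrix.det_conjTranspose,
        Matrix.det_one] at this
    have h0 : B.1.det ≠ 0 := left_ne_zero_of_mul_eq_one hd
    have hd' : (B.1.det)⁻¹ * star (B.1.det)⁻¹ = 1 := by
      rw [star_inv₀, ← mul_inv, hd, inv_one]
    rw [Matrix.mem_specialUnitaryGroup_iff]
    refine ⟨?_, ?_⟩
    · rw [Matrix.mem_unitaryGroup_iff, Matrix.star_eq_conjTranspose,
        Matrix.fromBlocks_conjTranspose, Matrix.fromBlocks_multiply]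
      rw [Matrix.star_eq_conjTranspose] at hB
      simp only [Matrix.conjTranspose_smul, Matrix.conjTranspose_one, Matrix.conjTranspose_zero,
        hB, smul_mul_smul_comm, hd', mul_one, Matrix.mul_zero, Matrix.zero_mul, add_zero, zero_add,
        one_smul, Matrix.fromBlocks_one]
    · rw [Matrix.det_fromBlocks_zero₂₁]
      simp [h0]⟩
  map_one' := by
    apply Subtype.ext
    simp
  map_mul' A B := by
    apply Subtype.ext
    simp [Matrix.fromBlocks_multiply, mul_comm, smul_smul]

/-- The compact symplectic group `Sp(2) = Sp(4, ℂ) ∩ U(4)`. -/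
def Sp2 : Subgroup (Matrix.unitaryGroup Four ℂ) where
  carrier := {A | A.1 ∈ Matrix.symplecticGroup (Fin 2) ℂ}
  mul_mem' := by
    intro A B hA hB
    exact (Matrix.symplecticGroup (Fin 2) ℂ).mul_mem hA hB
  one_mem' := (Matrix.symplecticGroup (Fin 2) ℂ).one_mem
  inv_mem' := by
    intro A hA
    have h : (A⁻¹).1 = ((⟨A.1, hA⟩ : Matrix.symplecticGroup (Fin 2) ℂ)⁻¹).1 := by
      have h1 : (A⁻¹).1 * A.1 = 1 := congrArg Subtype.val (inv_mul_cancel A)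
      have h2 : A.1 * ((⟨A.1, hA⟩ : Matrix.symplecticGroup (Fin 2) ℂ)⁻¹).1 = 1 :=
        congrArg Subtype.val (mul_inv_cancel (⟨A.1, hA⟩ : Matrix.symplecticGroup (Fin 2) ℂ))
      exact left_inv_eq_right_inv h1 h2
    change (A⁻¹).1 ∈ Matrix.symplecticGroup (Fin 2) ℂ
    rw [h]
    exact Subtype.property _

/-- The homomorphism `Sp(2) × S¹ → U(4)`, `(A, lam) ↦ lam A`. -/
def iota : Sp2 × Circle →* Matrix.unitaryGroup Four ℂ where
  toFun p := ⟨(p.2 : ℂ) • p.1.1.1, by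
    have hA := Matrix.mem_unitaryGroup_iff.1 p.1.1.2
    rw [Matrix.mem_unitaryGroup_iff, star_smul, smul_mul_smul_comm, hA]
    have : (p.2 : ℂ) * star (p.2 : ℂ) = 1 := by
      rw [← starRingEnd_apply, Complex.mul_conj, Circle.normSq_coe, Complex.ofReal_one]
    rw [this, one_smul]⟩
  map_one' := by
    apply Subtype.ext
    simp
  map_mul' p q := by
    apply Subtype.ext
    simp [smul_smul, mul_comm]

/-- The subgroup `Sp(2) S¹` of `SU(5)`. -/
def Sp2S1 : Subgroup SU5 := (embedU4.comp iota).range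

/-- The Berger space `B¹³ = SU(5) / Sp(2) S¹`, on which `SU(5)` acts by left translations. -/
abbrev B13 : Type := SU5 ⧸ Sp2S1

/-- The base point `o = e Sp(2) S¹`. -/
def basePoint : B13 := ((1 : SU5) : B13)

/-- The derivative of the determinant at the identity matrix is the trace. -/
lemma hasDerivAt_det {c : ℝ → Matrix Five Five ℂ} {c' : Matrix Five Five ℂ}
    (h0 : c 0 = 1) (h : ∀ i j, HasDerivAt (fun t => c t i j) (c' i j) 0) :
    HasDerivAt (fun t => (c t).det) c'.trace 0 := by
  have hs : ∀ σ : Equiv.Perm Five, HasDerivAt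
      (fun t => (Equiv.Perm.sign σ : ℤ) • ∏ i, c t (σ i) i)
      ((Equiv.Perm.sign σ : ℤ) • ∑ i, (∏ j ∈ Finset.univ.erase i, c 0 (σ j) j) • c' (σ i) i) 0 :=
    fun σ => (HasDerivAt.fun_finsetProd fun i _ => h (σ i) i).const_smul _
  have hsum := HasDerivAt.fun_sum fun (σ : Equiv.Perm Five) (_ : σ ∈ Finset.univ) => hs σ
  have hdet : (fun t => (c t).det) =
      fun t => ∑ σ : Equiv.Perm Five, (Equiv.Perm.sign σ : ℤ) • ∏ i, c t (σ i) i := by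
    funext t
    rw [Matrix.det_apply]
    rfl
  rw [hdet]
  suffices hkey : c'.trace = ∑ σ : Equiv.Perm Five, (Equiv.Perm.sign σ : ℤ) •
      ∑ i, (∏ j ∈ Finset.univ.erase i, c 0 (σ j) j) • c' (σ i) i by
    rw [hkey]
    exact hsum
  simp only [Finset.smul_sum]
  rw [Finset.sum_comm, Matrix.trace]
  refine Finset.sum_congr rfl fun i _ => ?_
  have h1 : ((1 : Matrix Five Five ℂ).updateCol i (fun k => c' k i)).det = c' i i := by
    rw [← Matrix.cramer_apply, Matrix.cramer_one]
    rfl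
  rw [Matrix.diag_apply, ← h1, Matrix.det_apply]
  refine Finset.sum_congr rfl fun σ _ => ?_
  rw [← Finset.mul_prod_erase _ _ (Finset.mem_univ i), h0, smul_eq_mul, mul_comm]
  congr 1
  rw [Matrix.updateCol_self]
  congr 1
  refine Finset.prod_congr rfl fun j hj => ?_
  rw [Matrix.updateCol_ne (Finset.ne_of_mem_erase hj)]

/-- The velocity at the identity of a curve in `SU(5)` lies in `su(5)`. -/
lemma velocity_mem {c : ℝ → Matrix Five Five ℂ} {c' : Matrix Five Five ℂ}
    (h0 : c 0 = 1) (hc : ∀ t, c t ∈ Matrix.specialUnitaryGroup Five ℂ)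
    (h : ∀ i j, HasDerivAt (fun t => c t i j) (c' i j) 0) : c' ∈ su5 := by
  refine ⟨?_, ?_⟩
  · ext i j
    have h1 : HasDerivAt (fun t => ∑ k, c t i k * star (c t j k))
        (∑ k, (c' i k * star (c 0 j k) + c 0 i k * star (c' j k))) 0 :=
      HasDerivAt.fun_sum fun k _ => (h i k).mul (h j k).star
    have h2 : (fun t => ∑ k, c t i k * star (c t j k)) = fun _ => (1 : Matrix Five Five ℂ) i j := by
      funext t
      have := Matrix.mem_unitaryGroup_iff.1 (Matrix.mem_specialUnitaryGroup_iff.1 (hc t)).1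
      rw [← this, Matrix.mul_apply]
      rfl
    rw [h2] at h1
    have h3 := h1.unique (hasDerivAt_const _ _)
    rw [h0, Finset.sum_add_distrib] at h3
    simp only [Matrix.one_apply, ite_mul, one_mul, zero_mul, Finset.sum_ite_eq, Finset.mem_univ,
      if_true, apply_ite star, star_one, star_zero, mul_ite, mul_one, mul_zero] at h3
    rw [Matrix.conjTranspose_apply, Matrix.neg_apply]
    exact eq_neg_of_add_eq_zero_right h3
  · have h1 := hasDerivAt_det h0 h
    have h2 : (fun t => (c t).det) = fun _ => (1 : ℂ) := by
      funext t
      exact (Matrix.mem_specialUnitaryGroup_iff.1 (hc t)).2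
    rw [h2] at h1
    exact h1.unique (hasDerivAt_const _ _)

section
attribute [local instance] Matrix.linftyOpNormedRing Matrix.linftyOpNormedAlgebra

lemma exp_mem (X : su5) : NormedSpace.exp X.1 ∈ Matrix.specialUnitaryGroup Five ℂ := by
  rw [Matrix.mem_specialUnitaryGroup_iff]
  refine ⟨?_, ?_⟩
  · rw [Matrix.mem_unitaryGroup_iff, Matrix.star_eq_conjTranspose, ← Matrix.exp_conjTranspose,
      X.2.1, ← Matrix.exp_add_of_commute _ _ (Commute.refl X.1).neg_right, add_neg_cancel,
      NormedSpace.exp_zero]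
  have hadd : ∀ s t : ℝ, (NormedSpace.exp ((s + t) • X.1)).det =
      (NormedSpace.exp (s • X.1)).det * (NormedSpace.exp (t • X.1)).det := by
    intro s t
    rw [add_smul, Matrix.exp_add_of_commute _ _
      (((Commute.refl X.1).smul_left s).smul_right t), Matrix.det_mul]
  have hd0 : HasDerivAt (fun t : ℝ => (NormedSpace.exp (t • X.1)).det) 0 0 := by
    have h := hasDerivAt_exp_smul_const (𝕂 := ℝ) X.1 0
    rw [zero_smul, NormedSpace.exp_zero, one_mul] at h
    have h' := hasDerivAt_det (c := fun t : ℝ => NormedSpace.exp (t • X.1)) (c' := X.1)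
      (by simp) (fun i j => by
        have := hasDerivAt_pi.1 (hasDerivAt_pi.1 h i) j
        exact this)
    rwa [X.2.2] at h'
  have hd : ∀ t, HasDerivAt (fun t : ℝ => (NormedSpace.exp (t • X.1)).det) 0 t := by
    intro t
    have h2 : HasDerivAt (fun s : ℝ => (NormedSpace.exp ((s - t) • X.1)).det) 0 t :=
      HasDerivAt.comp_sub_const t t (by rwa [sub_self])
    have h3 := h2.const_mul ((NormedSpace.exp (t • X.1)).det)
    rw [mul_zero] at h3
    refine h3.congr_of_eventuallyEq (Filter.Eventually.of_forall fun s => ?_)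
    change _ = (NormedSpace.exp (t • X.1)).det * (NormedSpace.exp ((s - t) • X.1)).det
    rw [← hadd, add_sub_cancel]
  have hconst := is_const_of_deriv_eq_zero (fun t => (hd t).differentiableAt)
    (fun t => (hd t).deriv) 1 0
  simpa using hconst

lemma differentiableAt_exp_mul (X v : su5) (i j : Five) :
    DifferentiableAt ℝ
      (fun t : ℝ => (NormedSpace.exp (X.1 + t • v.1) * NormedSpace.exp (-X.1)) i j) 0 := by
  have h1 : DifferentiableAt ℝ (fun t : ℝ => X.1 + t • v.1) 0 := by fun_prop
  have h2 : DifferentiableAt ℝ (fun Y : Matrix Five Five ℂ => NormedSpace.exp Y)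
      (X.1 + (0 : ℝ) • v.1) := (NormedSpace.exp_analytic (𝕂 := ℝ) _).differentiableAt
  have h3 : DifferentiableAt ℝ
      (fun t : ℝ => NormedSpace.exp (X.1 + t • v.1) * NormedSpace.exp (-X.1)) 0 :=
    (h2.comp (0 : ℝ) h1).mul_const _
  have h4 := hasDerivAt_pi.1 (hasDerivAt_pi.1 h3.hasDerivAt i) j
  exact h4.differentiableAt

end

/-- The exponential map `su(5) → SU(5)`. -/
def expSU (X : su5) : SU5 := ⟨NormedSpace.exp X.1, exp_mem X⟩

/-- The right logarithmic derivative of the exponential map at `X` in the direction `v`, i.e. the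
derivative at `t = 0` of the matrix curve `exp (X + t v) exp (-X)`. -/
def logDerivExp (X v : su5) : su5 :=
  ⟨Matrix.of fun i j =>
      deriv (fun t : ℝ => (NormedSpace.exp (X.1 + t • v.1) * NormedSpace.exp (-X.1)) i j) 0, by
    refine velocity_mem (c := fun t : ℝ => NormedSpace.exp (X.1 + t • v.1) *
      NormedSpace.exp (-X.1)) ?_ ?_ ?_
    · rw [zero_smul, add_zero, ← Matrix.exp_add_of_commute _ _ (Commute.refl X.1).neg_right,
        add_neg_cancel, NormedSpace.exp_zero]
    · intro t
      exact (Matrix.specialUnitaryGroup Five ℂ).mul_mem (exp_mem (X + t • v)) (exp_mem (-X))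
    · intro i j
      exact (differentiableAt_exp_mul X v i j).hasDerivAt⟩

/-- The adjoint action `X ↦ a X a⁻¹` of `SU(5)` on `su(5)`. -/
def Ad (a : SU5) (X : su5) : su5 :=
  ⟨a.1 * X.1 * star a.1, by
    have ha := Matrix.mem_unitaryGroup_iff'.1 (Matrix.mem_specialUnitaryGroup_iff.1 a.2).1
    rw [Matrix.star_eq_conjTranspose] at ha ⊢
    refine ⟨?_, ?_⟩
    · rw [Matrix.conjTranspose_mul, Matrix.conjTranspose_mul, X.2.1,
        Matrix.conjTranspose_conjTranspose]
      simp [Matrix.mul_assoc]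
    · rw [Matrix.trace_mul_comm, ← Matrix.mul_assoc, ha, Matrix.one_mul, X.2.2]⟩

/-- The bi-invariant inner product `-½ Re tr(XY)` on `su(5)`. -/
def Q (X Y : su5) : ℝ := -(1 / 2) * (X.1 * Y.1).trace.re

/-- The orthogonal complement of a subset of `su(5)` with respect to `Q`. -/
def orth (S : Set su5) : Submodule ℝ su5 where
  carrier := {X | ∀ Y ∈ S, Q X Y = 0}
  add_mem' := by
    intro X X' hX hX' Y hY
    have h1 := hX Y hY
    have h2 := hX' Y hY
    simp only [Q, Submodule.coe_add, Matrix.add_mul, Matrix.trace_add, Complex.add_re] at h1 h2 ⊢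
    linarith
  zero_mem' := by
    intro Y _
    simp [Q]
  smul_mem' := by
    intro c X hX Y hY
    have h1 := hX Y hY
    simp only [Q, Submodule.coe_smul, Matrix.smul_mul, Matrix.trace_smul, Complex.smul_re,
      smul_eq_mul] at h1 ⊢
    linear_combination c * h1

/-- The subalgebra `su(4)` of `su(5)`, embedded as upper left block. -/
def su4 : Set su5 := {X | ∃ B : Matrix Four Four ℂ, X.1 = Matrix.fromBlocks B 0 0 0}

/-- The subalgebra `su(4) ⊕ ℝ` of block diagonal matrices in `su(5)`; the summand `ℝ` is spanned by
`diag(i, i, i, i, -4i)`. -/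
def su4R : Set su5 :=
  {X | ∃ (B : Matrix Four Four ℂ) (C : Matrix Unit Unit ℂ), X.1 = Matrix.fromBlocks B 0 0 C}

/-- The Lie algebra `sp(2)` of `Sp(2)`, as a subalgebra of `su(4) ⊆ su(5)`. -/
def sp2 : Set su5 :=
  {X | ∃ B : Matrix Four Four ℂ, X.1 = Matrix.fromBlocks B 0 0 0 ∧
    B * Matrix.J (Fin 2) ℂ + Matrix.J (Fin 2) ℂ * Bᵀ = 0}

/-- `𝔭₁`, the orthogonal complement of `sp(2)` in `su(4)`. -/
def p1 : Set su5 := {X | X ∈ su4 ∧ X ∈ orth sp2}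

/-- `𝔭₂`, the orthogonal complement of `su(4) ⊕ ℝ` in `su(5)`. -/
def p2 : Set su5 := {X | X ∈ orth su4R}

/-! ### Riemannian metrics on `B¹³`

Every `X` in `su(5)` induces the vector field on `B¹³` whose value at `p` is the velocity of the
curve `exp (t X) • p` at `t = 0`. The action is transitive, so these values exhaust the tangent
space at `p`, which is thereby identified with the quotient of `su(5)` by the isotropy algebra
of `p`. -/

/-- The isotropy algebra of a point `p`: all `X` such that `exp (t X)` fixes `p` for all `t`. -/
def isotropy (p : B13) : Set su5 := {X | ∀ t : ℝ, expSU (t • X) • p = p}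

/-- A smooth Riemannian metric on `B¹³`. The number `form p X Y` is the inner product of the values
at `p` of the vector fields induced by `X` and `Y`. -/
structure RiemMetric where
  form : B13 → LinearMap.BilinForm ℝ su5
  symm : ∀ p X Y, form p X Y = form p Y X
  nonneg : ∀ p X, 0 ≤ form p X X
  null_iff : ∀ p X, form p X X = 0 ↔ X ∈ isotropy p
  smooth : ∀ (p : B13) (X Y : su5) (n : ℕ) (L : (Fin n → ℝ) →ₗ[ℝ] su5),
    ContDiff ℝ ∞ (fun y => form (expSU (L y) • p) X Y)

/-- The tangent space of `B¹³` at `p`, realized as the orthogonal complement of the isotropy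
algebra of `p` in `su(5)`. -/
abbrev Tangent (p : B13) : Type := orth (isotropy p)

namespace RiemMetric

/-- `SU(5)`-invariance: every `a` in `SU(5)` acts by isometries. The differential of the action of
`a` sends the value at `p` of the vector field induced by `X` to the value at `a • p` of the
vector field induced by `Ad a X`. -/
def IsInvariant (g : RiemMetric) : Prop :=
  ∀ (a : SU5) (p : B13) (X Y : su5), g.form (a • p) (Ad a X) (Ad a Y) = g.form p X Y

/-- At the base point, `g` is given by `x₁ Q` on `𝔭₁` and `x₂ Q` on `𝔭₂`, with `𝔭₁ ⟂ 𝔭₂`. -/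
def IsDiagonal (g : RiemMetric) (x₁ x₂ : ℝ) : Prop :=
  ∀ X₁ ∈ p1, ∀ Y₁ ∈ p1, ∀ X₂ ∈ p2, ∀ Y₂ ∈ p2,
    g.form basePoint (X₁ + X₂) (Y₁ + Y₂) = x₁ * Q X₁ Y₁ + x₂ * Q X₂ Y₂

/-- The coefficients of the metric in the exponential coordinates `X ↦ exp X • p` around `p`, for
`X` in `Tangent p`. The coordinate vector `v` at `X` is the velocity at `t = 0` of the curve
`exp (X + t v) • p`, i.e. the value at `exp X • p` of the vector field induced by
`logDerivExp X v`. -/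
def coeff (g : RiemMetric) (p : B13) (X v w : Tangent p) : ℝ :=
  g.form (expSU X • p) (logDerivExp X v) (logDerivExp X w)

/-- Sectional curvature at `p` of the plane spanned by `u` and `v`. -/
def sec (g : RiemMetric) (p : B13) (u v : Tangent p) : ℝ := sectional (g.coeff p) 0 u v

/-- Ricci tensor at `p`. -/
def ric (g : RiemMetric) (p : B13) (u v : Tangent p) : ℝ := ricci (g.coeff p) 0 u v

/-- Positive sectional curvature: every tangent plane is positively curved. -/
def PosSec (g : RiemMetric) : Prop :=
  ∀ (p : B13) (u v : Tangent p), LinearIndependent ℝ ![u, v] → 0 < g.sec p u v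

/-- There is a non-positively curved tangent plane. -/
def HasNonposPlane (g : RiemMetric) : Prop :=
  ∃ (p : B13) (u v : Tangent p), LinearIndependent ℝ ![u, v] ∧ g.sec p u v ≤ 0

end RiemMetric

/-- `g` solves the Ricci flow equation `∂g/∂ℓ = -2 Ric(g)` on the time interval `[0, T)`. -/
def IsRicciFlow (g : ℝ → RiemMetric) (T : ℝ) : Prop :=
  ∀ ℓ ∈ Set.Ico 0 T, ∀ (p : B13) (u v : Tangent p),
    HasDerivWithinAt (fun s => (g s).form p u v) (-2 * (g ℓ).ric p u v) (Set.Ico 0 T) ℓ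

end

end Berger

/-! Everything depends on the ratio `φ = x₁ / x₂`. For horizontal `X`, `Y` with components `Xᵢ`,
`Yᵢ` in `𝔭ᵢ`, put `A = [X₁, Y₁]`, `D = [X₂, Y₂]` and `C = [X₁, Y₂] + [X₂, Y₁]`. Because `[𝔭₁, 𝔭₁] ⊆
sp(2)`, `[𝔭₁, 𝔭₂] ⊆ 𝔭₂` and `[𝔭₂, 𝔭₂] ⊆ su(4) ⊕ ℝ`, the general curvature formula for homogeneous
metrics collapses to the expression `Kf` in `A`, `D`, `C` (`besse_eq_Kf`).

Let `S` be the `sp(2)`-component of `D`. Completing the square in `A` writes `Kf / x₂` as `φ |A + (3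
- φ)/2 S|² + (3φ/4 - 1)(|S|² - |P1 D|²) + (2 - φ)³/4 |S|² + (D, zc)²/10 + φ²/4 |C|²`. The inequality
`|P1 D|² ≤ |S|²` (`Q_P1_br_22`) makes every term non-negative for `4/3 ≤ φ < 2`. If all of them
vanish, then so do `A`, `D` and `C`, which forces `X` and `Y` to be dependent (`dependent_of_br`);
this is `Kf_pos`. The factor `(2 - φ)³` changes sign at `φ = 2`, and `exists_Kf_nonpos` gives a
plane on which the remaining terms are absent, so its curvature is at most zero once `2 ≤ φ ≤ 3`.

Tracing `Kf` over an orthogonal frame gives `Ric = (8 + φ²) Q` on `𝔭₁` and `(10 - 5φ/4) Q` on `𝔭₂`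
(`sum_Kf`, `ric_invMetric`). Under the Ricci flow of diagonal metrics, therefore, `φ' = (-16 + 20 φ
- 9/2 φ²) / x₂`, which equals `6 / x₂ > 0` at `φ = 2`. So `φ` crosses `2` upwards, and a metric with
`φ` slightly below `2` loses positive curvature exactly at the crossing (`exists_flow`).

The rest connects this algebra with the coordinate definitions of curvature. In exponential
coordinates around `a • basePoint` an invariant metric is its base point form evaluated on the left
logarithmic derivative of `exp`, whose expansion is `v - [X, v]/2 + [X, [X, v]]/6 + …`
(`jet_leftLog`). This two-jet determines the Christoffel symbols and the Riemann tensor at the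
origin (`christoffel_coeff`, `riemann_coeff`). -/

namespace Berger

noncomputable section

/-! ### The Lie bracket, the invariant form, and the isotropy summands -/

/-- The commutator of `su(5)`. -/
def br : su5 →ₗ[ℝ] su5 →ₗ[ℝ] su5 :=
  LinearMap.mk₂ ℝ (fun X Y => ⟨X.1 * Y.1 - Y.1 * X.1, by
      refine ⟨?_, ?_⟩
      · rw [Matrix.conjTranspose_sub, Matrix.conjTranspose_mul, Matrix.conjTranspose_mul, X.2.1,
          Y.2.1]
        noncomm_ring
      · rw [Matrix.trace_sub, Matrix.trace_mul_comm, sub_self]⟩)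
    (by intro X X' Y; ext1; simp; noncomm_ring)
    (by intro c X Y; ext1; simp [smul_sub])
    (by intro X Y Y'; ext1; simp; noncomm_ring)
    (by intro c X Y; ext1; simp [smul_sub])

lemma br_val (X Y : su5) : (br X Y).1 = X.1 * Y.1 - Y.1 * X.1 := rfl

lemma br_anti (X Y : su5) : br Y X = -br X Y := by
  ext1; simp [br_val]

lemma br_self (X : su5) : br X X = 0 := by
  ext1; simp [br_val]

lemma jacobi (X Y Z : su5) : br (br X Y) Z = br X (br Y Z) - br Y (br X Z) := by
  ext1; simp [br_val]; noncomm_ring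

/-- The form `Q` as a bilinear form. -/
def Qf : LinearMap.BilinForm ℝ su5 :=
  LinearMap.mk₂ ℝ Q
    (by intro X X' Y; simp [Q, Matrix.add_mul]; ring)
    (by intro c X Y; simp [Q]; ring)
    (by intro X Y Y'; simp [Q, Matrix.mul_add]; ring)
    (by intro c X Y; simp [Q]; ring)

lemma Qf_apply (X Y : su5) : Qf X Y = Q X Y := rfl

lemma Qf_comm (X Y : su5) : Qf X Y = Qf Y X := by
  rw [Qf_apply, Qf_apply, Q, Q, Matrix.trace_mul_comm]

lemma Qf_self_eq (X : su5) : Qf X X = 1 / 2 * ∑ i, ∑ j, Complex.normSq (X.1 i j) := by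
  have h : X.1 * X.1 = - (X.1 * X.1ᴴ) := by rw [X.2.1]; simp
  rw [Qf_apply, Q, h, Matrix.trace_neg, Complex.neg_re, neg_mul_neg]
  congr 1
  simp [Matrix.trace, Matrix.mul_apply, Complex.normSq_apply]

lemma Qf_nonneg (X : su5) : 0 ≤ Qf X X := by
  rw [Qf_self_eq]
  exact mul_nonneg (by norm_num)
    (Finset.sum_nonneg fun i _ => Finset.sum_nonneg fun j _ => Complex.normSq_nonneg _)

lemma Qf_self_eq_zero {X : su5} (h : Qf X X = 0) : X = 0 := by
  rw [Qf_self_eq, mul_eq_zero, or_iff_right (by norm_num)] at h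
  ext i j
  have h1 := (Finset.sum_eq_zero_iff_of_nonneg
    (fun i _ => Finset.sum_nonneg fun j _ => Complex.normSq_nonneg _)).1 h i (Finset.mem_univ _)
  have h2 := (Finset.sum_eq_zero_iff_of_nonneg
    (fun j _ => Complex.normSq_nonneg _)).1 h1 j (Finset.mem_univ _)
  simpa using h2

lemma Qf_pos {X : su5} (h : X ≠ 0) : 0 < Qf X X :=
  lt_of_le_of_ne (Qf_nonneg X) fun h' => h (Qf_self_eq_zero h'.symm)

/-- Invariance of `Q` under the adjoint representation of the Lie algebra. -/
lemma Qf_br (X Y Z : su5) : Qf (br X Y) Z = -Qf Y (br X Z) := by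
  simp only [Qf_apply, Q, br_val, Matrix.sub_mul, Matrix.mul_sub, Matrix.trace_sub, Complex.sub_re]
  rw [Matrix.mul_assoc X.1, Matrix.trace_mul_comm X.1, Matrix.mul_assoc Y.1 X.1,
    Matrix.mul_assoc Y.1 Z.1]
  ring

lemma Qf_br' (X Y Z : su5) : Qf (br X Y) Z = Qf X (br Y Z) := by
  rw [br_anti Y X, map_neg, LinearMap.neg_apply, Qf_br, neg_neg]

/-- Cauchy-Schwarz for `Q`. -/
lemma Qf_cs (X Y : su5) : Qf X Y ^ 2 ≤ Qf X X * Qf Y Y :=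
  LinearMap.BilinForm.apply_sq_le_of_symm Qf Qf_nonneg ⟨Qf_comm⟩ X Y

/-! ### The orthogonal projections to `𝔭₁` and `𝔭₂`. -/

abbrev J4 : Matrix Four Four ℂ := Matrix.J (Fin 2) ℂ

/-- Upper left block. -/
abbrev blk (X : su5) : Matrix Four Four ℂ := X.1.toBlocks₁₁

lemma blk_conjTranspose (X : su5) : (blk X)ᴴ = -blk X := by
  ext i j
  have := congrFun (congrFun X.2.1 (Sum.inl i)) (Sum.inl j)
  exact this

lemma J4_mul_J4 : J4 * J4 = -1 := Matrix.J_squared _ _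

lemma J4_conjTranspose : J4ᴴ = -J4 := by
  simp [Matrix.J, Matrix.fromBlocks_conjTranspose, Matrix.fromBlocks_neg]

lemma J4_transpose : J4ᵀ = -J4 := Matrix.J_transpose _ _

/-- The projection of a `4 × 4` matrix to the trace free part of the space
`{B | B J = J Bᵀ}`. -/
def proj1 : Matrix Four Four ℂ →ₗ[ℝ] Matrix Four Four ℂ where
  toFun B := (1 / 2 : ℂ) • (B - J4 * Bᵀ * J4) - (B.trace / 4) • 1
  map_add' B C := by
    simp only [Matrix.transpose_add, Matrix.trace_add, Matrix.mul_add, Matrix.add_mul, smul_add,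
      smul_sub, add_div, add_smul]
    abel
  map_smul' c B := by
    simp only [Matrix.transpose_smul, Matrix.trace_smul, Matrix.mul_smul, Matrix.smul_mul,
      RingHom.id_apply, smul_sub, smul_comm c (1 / 2 : ℂ), smul_div_assoc,
      smul_assoc]

lemma proj1_apply (B : Matrix Four Four ℂ) :
    proj1 B = (1 / 2 : ℂ) • (B - J4 * Bᵀ * J4) - (B.trace / 4) • 1 := rfl

lemma trace_J4_conj (B : Matrix Four Four ℂ) : (J4 * Bᵀ * J4).trace = -B.trace := by
  rw [Matrix.trace_mul_comm, ← Matrix.mul_assoc, J4_mul_J4]; simp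

lemma proj1_trace (B : Matrix Four Four ℂ) : (proj1 B).trace = 0 := by
  rw [proj1_apply, Matrix.trace_sub, Matrix.trace_smul, Matrix.trace_sub, trace_J4_conj]
  simp; ring

lemma proj1_conjTranspose {B : Matrix Four Four ℂ} (h : Bᴴ = -B) :
    (proj1 B)ᴴ = -proj1 B := by
  have h1 : (Bᵀ)ᴴ = -Bᵀ := by
    rw [← Matrix.transpose_neg, ← h]
    rfl
  have h2 : star B.trace = -B.trace := by
    rw [← Matrix.trace_conjTranspose, h, Matrix.trace_neg]
  rw [proj1_apply, Matrix.conjTranspose_sub, Matrix.conjTranspose_smul, Matrix.conjTranspose_sub,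
    Matrix.conjTranspose_mul, Matrix.conjTranspose_mul, J4_conjTranspose, h, h1,
    Matrix.conjTranspose_smul, Matrix.conjTranspose_one, star_div₀, star_div₀, h2]
  simp only [star_one, star_ofNat, neg_mul, mul_neg, neg_neg, neg_div,
    neg_smul, ← Matrix.mul_assoc]
  rw [neg_sub_neg, neg_sub, ← neg_sub_neg B, smul_sub, smul_sub]
  simp only [smul_neg]
  abel

lemma trace_fromBlocks (B : Matrix Four Four ℂ) (x : Matrix Four Unit ℂ)
    (y : Matrix Unit Four ℂ) (c : Matrix Unit Unit ℂ) :
    (Matrix.fromBlocks B x y c).trace = B.trace + c.trace := by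
  simp [Matrix.trace, Fintype.sum_sum_type]

/-- The projection of `su(5)` to `𝔭₁`. -/
def P1 : su5 →ₗ[ℝ] su5 where
  toFun X := ⟨Matrix.fromBlocks (proj1 (blk X)) 0 0 0, by
    refine ⟨?_, ?_⟩
    · rw [Matrix.fromBlocks_conjTranspose, proj1_conjTranspose (blk_conjTranspose X),
        Matrix.fromBlocks_neg]
      simp
    · rw [trace_fromBlocks, proj1_trace]; simp⟩
  map_add' X Y := by
    ext1
    change Matrix.fromBlocks (proj1 (blk X + blk Y)) 0 0 0 = _
    rw [map_add]
    simp [Matrix.fromBlocks_add]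
  map_smul' c X := by
    ext1
    change Matrix.fromBlocks (proj1 (c • blk X)) 0 0 0 = _
    rw [map_smul]
    simp [Matrix.fromBlocks_smul]

lemma P1_val (X : su5) : (P1 X).1 = Matrix.fromBlocks (proj1 (blk X)) 0 0 0 := rfl

/-- The projection of `su(5)` to `𝔭₂`. -/
def P2 : su5 →ₗ[ℝ] su5 where
  toFun X := ⟨Matrix.fromBlocks 0 X.1.toBlocks₁₂ X.1.toBlocks₂₁ 0, by
    refine ⟨?_, ?_⟩
    · have h := X.2.1
      rw [← Matrix.fromBlocks_toBlocks X.1, Matrix.fromBlocks_conjTranspose,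
        Matrix.fromBlocks_neg, Matrix.fromBlocks_inj] at h
      rw [Matrix.fromBlocks_conjTranspose, Matrix.fromBlocks_neg, h.2.1, h.2.2.1]
      simp
    · simp [trace_fromBlocks]⟩
  map_add' X Y := by
    ext1
    simp only [Submodule.coe_add, Matrix.fromBlocks_add, add_zero]
    rfl
  map_smul' c X := by
    ext1
    simp only [Submodule.coe_smul, Matrix.fromBlocks_smul, smul_zero, RingHom.id_apply]
    rfl

lemma P2_val (X : su5) : (P2 X).1 = Matrix.fromBlocks 0 X.1.toBlocks₁₂ X.1.toBlocks₂₁ 0 := rfl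

lemma trace_mul_fromBlocks (B B' : Matrix Four Four ℂ) (x x' : Matrix Four Unit ℂ)
    (y y' : Matrix Unit Four ℂ) (c c' : Matrix Unit Unit ℂ) :
    (Matrix.fromBlocks B x y c * Matrix.fromBlocks B' x' y' c').trace =
      (B * B').trace + (x * y').trace + ((y * x').trace + (c * c').trace) := by
  rw [Matrix.fromBlocks_multiply, trace_fromBlocks, Matrix.trace_add, Matrix.trace_add]

lemma trace_proj1_mul (B C : Matrix Four Four ℂ) :
    (proj1 B * C).trace = (B * proj1 C).trace := by
  have h : (J4 * Bᵀ * J4 * C).trace = (B * (J4 * Cᵀ * J4)).trace := by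
    rw [← Matrix.trace_transpose (J4 * Bᵀ * J4 * C)]
    simp only [Matrix.transpose_mul, Matrix.transpose_transpose, J4_transpose]
    rw [Matrix.trace_mul_comm B, Matrix.mul_assoc J4 Cᵀ, Matrix.mul_assoc J4, Matrix.trace_mul_comm J4]
    simp only [Matrix.neg_mul, Matrix.mul_neg, neg_neg, Matrix.mul_assoc]
  simp only [proj1_apply, Matrix.sub_mul, Matrix.mul_sub, Matrix.smul_mul, Matrix.mul_smul,
    Matrix.trace_sub, Matrix.trace_smul, h, Matrix.one_mul, Matrix.mul_one, smul_eq_mul]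
  ring

/-- Self-adjointness, together with `P1_P1`, makes `P1` the `Q`-orthogonal projection to its range.
The same holds for `P2`. -/
lemma Qf_P1 (X Y : su5) : Qf (P1 X) Y = Qf X (P1 Y) := by
  simp only [Qf_apply, Q, P1_val]
  rw [← Matrix.fromBlocks_toBlocks X.1, ← Matrix.fromBlocks_toBlocks Y.1, trace_mul_fromBlocks,
    trace_mul_fromBlocks]
  simp only [trace_proj1_mul, Matrix.zero_mul, Matrix.mul_zero]

lemma Qf_P2 (X Y : su5) : Qf (P2 X) Y = Qf X (P2 Y) := by
  simp only [Qf_apply, Q, P2_val]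
  rw [← Matrix.fromBlocks_toBlocks X.1, ← Matrix.fromBlocks_toBlocks Y.1, trace_mul_fromBlocks,
    trace_mul_fromBlocks]
  simp

/-- The map `B ↦ J Bᵀ J` is an involution. Averaging `B` with minus its image gives a vector in the
`-1`-eigenspace, which also contains the scalars, so subtracting the trace part does not leave it.
-/
lemma proj1_J4 (B : Matrix Four Four ℂ) : J4 * (proj1 B)ᵀ * J4 = -proj1 B := by
  have h : J4 * (J4 * B * J4) * J4 = B := by
    simp only [Matrix.mul_assoc, J4_mul_J4]
    rw [← Matrix.mul_assoc, J4_mul_J4]; simp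
  rw [proj1_apply, Matrix.transpose_sub, Matrix.transpose_smul, Matrix.transpose_sub,
    Matrix.transpose_smul, Matrix.transpose_mul, Matrix.transpose_mul, J4_transpose,
    Matrix.transpose_transpose, Matrix.transpose_one]
  simp only [Matrix.neg_mul, Matrix.mul_neg, neg_neg, ← Matrix.mul_assoc, Matrix.mul_sub,
    Matrix.sub_mul, Matrix.mul_smul, Matrix.smul_mul, Matrix.mul_one, J4_mul_J4]
  rw [show 1 * B * J4 * J4 = -B by simp [Matrix.mul_assoc, J4_mul_J4]]
  module

lemma proj1_proj1 (B : Matrix Four Four ℂ) : proj1 (proj1 B) = proj1 B := by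
  rw [proj1_apply (proj1 B), proj1_J4, proj1_trace]
  module

lemma P1_P1 (X : su5) : P1 (P1 X) = P1 X := by
  ext1
  simp only [P1_val, blk, Matrix.toBlocks_fromBlocks₁₁, proj1_proj1]

lemma P2_P2 (X : su5) : P2 (P2 X) = P2 X := by
  ext1
  simp only [P2_val, Matrix.toBlocks_fromBlocks₁₂, Matrix.toBlocks_fromBlocks₂₁]

lemma P1_P2 (X : su5) : P1 (P2 X) = 0 := by
  ext1
  simp only [P1_val, P2_val, blk, Matrix.toBlocks_fromBlocks₁₁, map_zero, Matrix.fromBlocks_zero]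
  rfl

lemma P2_P1 (X : su5) : P2 (P1 X) = 0 := by
  ext1
  simp only [P1_val, P2_val, Matrix.toBlocks_fromBlocks₁₂, Matrix.toBlocks_fromBlocks₂₁,
    Matrix.fromBlocks_zero]
  rfl

/-! ### Explicit form of the isotropy summands -/

lemma fromBlocks_sub (B B' : Matrix Four Four ℂ) (x x' : Matrix Four Unit ℂ)
    (y y' : Matrix Unit Four ℂ) (c c' : Matrix Unit Unit ℂ) :
    Matrix.fromBlocks B x y c - Matrix.fromBlocks B' x' y' c' =
      Matrix.fromBlocks (B - B') (x - x') (y - y') (c - c') := by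
  ext i j
  rcases i with i | i <;> rcases j with j | j <;> rfl

lemma val_of_P1 {X : su5} (h : P1 X = X) : X.1 = Matrix.fromBlocks (blk X) 0 0 0 := by
  have : proj1 (blk X) = blk X := by
    conv_rhs => rw [← h]
    rfl
  conv_lhs => rw [← h, P1_val, this]

lemma proj1_of_P1 {X : su5} (h : P1 X = X) : proj1 (blk X) = blk X := by
  conv_rhs => rw [← h]
  rfl

lemma val_of_P2 {X : su5} (h : P2 X = X) :
    X.1 = Matrix.fromBlocks 0 X.1.toBlocks₁₂ X.1.toBlocks₂₁ 0 := by
  conv_lhs => rw [← h, P2_val]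

/-- This is the relation `[𝔭₁, 𝔭₁] ⊆ sp(2)` of the symmetric pair `(SU(4), Sp(2))`. Transposition
reverses products, so `J Bᵀ J = -B` and `J Cᵀ J = -C` put the commutator of `B` and `C` into the
`+1`-eigenspace of `B ↦ J Bᵀ J`, where `proj1` vanishes on trace free matrices. -/
lemma P1_br_11 {X Y : su5} (hX : P1 X = X) (hY : P1 Y = Y) : P1 (br X Y) = 0 := by
  ext1
  rw [P1_val, blk, br_val, val_of_P1 hX, val_of_P1 hY, Matrix.fromBlocks_multiply,
    Matrix.fromBlocks_multiply, fromBlocks_sub, Matrix.toBlocks_fromBlocks₁₁]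
  have h1 := proj1_J4 (blk X)
  have h2 := proj1_J4 (blk Y)
  rw [proj1_of_P1 hX] at h1
  rw [proj1_of_P1 hY] at h2
  set B := blk X
  set C := blk Y
  have h3 : J4 * (B * C)ᵀ * J4 = -(C * B) := by
    have : C * B = J4 * Cᵀ * (J4 * J4) * Bᵀ * J4 := by
      have : C * B = (J4 * Cᵀ * J4) * (J4 * Bᵀ * J4) := by rw [h1, h2]; simp
      rw [this]; simp only [Matrix.mul_assoc]
    rw [this, J4_mul_J4, Matrix.transpose_mul]; simp [Matrix.mul_assoc]
  have h4 : J4 * (C * B)ᵀ * J4 = -(B * C) := by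
    have : B * C = J4 * Bᵀ * (J4 * J4) * Cᵀ * J4 := by
      have : B * C = (J4 * Bᵀ * J4) * (J4 * Cᵀ * J4) := by rw [h1, h2]; simp
      rw [this]; simp only [Matrix.mul_assoc]
    rw [this, J4_mul_J4, Matrix.transpose_mul]; simp [Matrix.mul_assoc]
  have h5 : proj1 (B * C - C * B) = 0 := by
    rw [proj1_apply, Matrix.transpose_sub, Matrix.mul_sub, Matrix.sub_mul, h3, h4,
      Matrix.trace_sub, Matrix.trace_mul_comm, sub_self, zero_div, zero_smul, sub_zero,
      show B * C - C * B - (-(C * B) - -(B * C)) = 0 by abel, smul_zero]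
  simp [h5]

lemma P2_br_11 {X Y : su5} (hX : P1 X = X) (hY : P1 Y = Y) : P2 (br X Y) = 0 := by
  ext1
  rw [P2_val, br_val, val_of_P1 hX, val_of_P1 hY, Matrix.fromBlocks_multiply,
    Matrix.fromBlocks_multiply, fromBlocks_sub, Matrix.toBlocks_fromBlocks₁₂,
    Matrix.toBlocks_fromBlocks₂₁]
  simp

lemma P2_br_12 {X Y : su5} (hX : P1 X = X) (hY : P2 Y = Y) : P2 (br X Y) = br X Y := by
  ext1
  rw [P2_val, br_val, val_of_P1 hX, val_of_P2 hY, Matrix.fromBlocks_multiply,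
    Matrix.fromBlocks_multiply, fromBlocks_sub, Matrix.toBlocks_fromBlocks₁₂,
    Matrix.toBlocks_fromBlocks₂₁]
  simp

/-- Products of two off-diagonal block matrices are block diagonal: the symmetric pair of `ℂP⁴`. -/
lemma P2_br_22 {X Y : su5} (hX : P2 X = X) (hY : P2 Y = Y) : P2 (br X Y) = 0 := by
  ext1
  rw [P2_val, br_val, val_of_P2 hX, val_of_P2 hY, Matrix.fromBlocks_multiply,
    Matrix.fromBlocks_multiply, fromBlocks_sub, Matrix.toBlocks_fromBlocks₁₂,
    Matrix.toBlocks_fromBlocks₂₁]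
  simp

/-- Coordinates on `𝔭₁`, on which `2 (r² + |z|² + |w|²)` is the quadratic form of `Q`. -/
def mat1 (r : ℝ) (z w : ℂ) : Matrix Four Four ℂ :=
  Matrix.fromBlocks !![r * Complex.I, z; -star z, -(r * Complex.I)] !![0, w; -w, 0]
    !![0, star w; -star w, 0] !![r * Complex.I, -star z; z, -(r * Complex.I)]

/-- Coordinates on `𝔭₂`. -/
def mat2 (x : Four → ℂ) : Matrix Five Five ℂ :=
  Matrix.fromBlocks 0 (Matrix.of fun i _ => x i) (Matrix.of fun _ j => -star (x j)) 0

/-- The relation `J Bᵀ J = -B` makes the lower right block the transpose of the upper left one and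
the off-diagonal blocks skew-symmetric. Skew-Hermitian symmetry and vanishing trace then leave five
real parameters. -/
lemma exists_mat1 {X : su5} (h : P1 X = X) :
    ∃ r z w, X.1 = Matrix.fromBlocks (mat1 r z w) 0 0 0 := by
  have h1 := proj1_J4 (blk X)
  have h2 := proj1_trace (blk X)
  have h3 := blk_conjTranspose X
  rw [proj1_of_P1 h] at h1 h2
  rw [val_of_P1 h]
  set B := blk X
  have e1 : ∀ i j, (J4 * Bᵀ * J4) i j = -B i j := fun i j => by rw [h1]; rfl
  have e3 : ∀ i j, star (B j i) = -B i j := fun i j => by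
    have := congrFun (congrFun h3 i) j
    exact this
  have d : ∀ i j, B (.inr i) (.inr j) = B (.inl j) (.inl i) := fun i j => by
    have := e1 (.inr i) (.inr j)
    simp [Matrix.mul_apply, Matrix.J, Fintype.sum_sum_type, Matrix.one_apply] at this
    exact this.symm
  have b : ∀ i j, B (.inl i) (.inr j) = -B (.inl j) (.inr i) := fun i j => by
    have := e1 (.inl i) (.inr j)
    simp [Matrix.mul_apply, Matrix.J, Fintype.sum_sum_type, Matrix.one_apply] at this
    rw [this, neg_neg]
  have b0 : ∀ i, B (.inl i) (.inr i) = 0 := fun i => self_eq_neg.1 (b i i)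
  have c : ∀ i j, B (.inr i) (.inl j) = -star (B (.inl j) (.inr i)) := fun i j => by
    rw [e3, neg_neg]
  have a0 : ∀ i, B (.inl i) (.inl i) = (B (.inl i) (.inl i)).im * Complex.I := fun i => by
    have := congrArg Complex.re (e3 (.inl i) (.inl i))
    rw [Complex.star_def, Complex.conj_re, Complex.neg_re, self_eq_neg] at this
    apply Complex.ext <;> simp [this]
  have a1 : B (.inl 1) (.inl 1) = -B (.inl 0) (.inl 0) := by
    have : B.trace = 2 * (B (.inl 0) (.inl 0) + B (.inl 1) (.inl 1)) := by
      simp only [Matrix.trace, Fintype.sum_sum_type, Fin.sum_univ_two, Matrix.diag_apply, d]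
      ring
    rw [this] at h2
    linear_combination h2 / 2
  refine ⟨(B (.inl 0) (.inl 0)).im, B (.inl 0) (.inl 1), B (.inl 0) (.inr 1), ?_⟩
  congr 1
  conv_lhs => rw [← Matrix.fromBlocks_toBlocks B]
  rw [mat1, Matrix.fromBlocks_inj]
  have a2 : B (.inl 1) (.inl 0) = -star (B (.inl 0) (.inl 1)) := by rw [e3, neg_neg]
  refine ⟨?_, ?_, ?_, ?_⟩ <;> ext i j <;> fin_cases i <;> fin_cases j <;>
    simp only [Matrix.toBlocks₁₁, Matrix.toBlocks₁₂, Matrix.toBlocks₂₁, Matrix.toBlocks₂₂,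
      Matrix.of_apply, Matrix.cons_val', Matrix.cons_val_zero, Matrix.cons_val_one,
      Matrix.cons_val_fin_one, Fin.zero_eta, Fin.mk_one, Fin.isValue, d, c, b0, a1, a2, b 1 0,
      star_neg, star_zero, neg_zero, ← a0 0, neg_neg]

lemma exists_mat2 {X : su5} (h : P2 X = X) : ∃ x, X.1 = mat2 x := by
  refine ⟨fun i => X.1 (.inl i) (.inr ()), ?_⟩
  have h3 : ∀ i j, star (X.1 j i) = -X.1 i j := fun i j => congrFun (congrFun X.2.1 i) j
  conv_lhs => rw [val_of_P2 h]
  rw [mat2, Matrix.fromBlocks_inj]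
  refine ⟨rfl, rfl, ?_, rfl⟩
  ext i j
  change X.1 (.inr i) (.inl j) = -star (X.1 (.inl j) (.inr ()))
  rw [h3, neg_neg]

/-- The central element of `su(4) ⊕ ℝ`. -/
def zc : su5 := ⟨Matrix.fromBlocks (Complex.I • 1) 0 0 (-(4 * Complex.I) • 1), by
  refine ⟨?_, ?_⟩
  · rw [Matrix.fromBlocks_conjTranspose, Matrix.fromBlocks_neg]
    simp
  · rw [trace_fromBlocks]
    simp [mul_comm]⟩

lemma zc_val : zc.1 = Matrix.fromBlocks (Complex.I • 1) 0 0 (-(4 * Complex.I) • 1) := rfl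

lemma Q_zc : Qf zc zc = 10 := by
  rw [Qf_apply, Q, zc_val]
  simp [Matrix.trace, Matrix.mul_apply, Fintype.sum_sum_type, Fin.sum_univ_two, Matrix.one_apply]
  norm_num

lemma P1_zc : P1 zc = 0 := by
  ext1
  have h : proj1 (Complex.I • 1) = 0 := by
    rw [proj1_apply, Matrix.transpose_smul, Matrix.transpose_one, Matrix.mul_smul,
      Matrix.smul_mul, mul_one, J4_mul_J4, Matrix.trace_smul, Matrix.trace_one]
    simp only [Fintype.card_sum, Fintype.card_fin, smul_eq_mul]
    module
  rw [P1_val, blk, zc_val, Matrix.toBlocks_fromBlocks₁₁, h]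
  simp

/-- On `𝔭₂ ≅ ℂ⁴` the element `zc` acts as multiplication by `i - (-4i) = 5i`, so a fifth of `br zc`
is the complex structure of `𝔭₂`. -/
lemma Q_br_zc {X : su5} (hX : P2 X = X) : Qf (br zc X) (br zc X) = 25 * Qf X X := by
  obtain ⟨x, hX⟩ := exists_mat2 hX
  simp only [Qf_apply, Q, br_val, hX, zc_val]
  simp [Matrix.trace, Matrix.mul_apply, mat2, Fintype.sum_sum_type, Fin.sum_univ_two,
    Matrix.one_apply]
  ring

lemma P2_br_zc {X : su5} (hX : P2 X = X) : P2 (br zc X) = br zc X := by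
  ext1
  rw [P2_val, br_val, val_of_P2 hX, zc_val, Matrix.fromBlocks_multiply,
    Matrix.fromBlocks_multiply, fromBlocks_sub, Matrix.toBlocks_fromBlocks₁₂,
    Matrix.toBlocks_fromBlocks₂₁]
  simp

/-- This is the curvature formula of `ℂP⁴`: the squared area plus three times the square of `Q(X,
iY)`. Since `br zc` is multiplication by `5i`, the factor three becomes `3 / 25`. -/
lemma Q_br_22 {X Y : su5} (hX : P2 X = X) (hY : P2 Y = Y) :
    Qf (br X Y) (br X Y) =
      Qf X X * Qf Y Y - Qf X Y ^ 2 + 3 / 25 * Qf X (br zc Y) ^ 2 := by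
  obtain ⟨x, hX⟩ := exists_mat2 hX
  obtain ⟨y, hY⟩ := exists_mat2 hY
  simp only [Qf_apply, Q, br_val, hX, hY, zc_val]
  simp [Matrix.trace, Matrix.mul_apply, mat2, Fintype.sum_sum_type, Fin.sum_univ_two,
    Matrix.one_apply]
  ring

/-- The `sp(2)`-component of `[X, Y]` is at least as long as the `𝔭₁`-component. The difference of
the squared lengths is explicit: the squared modulus of the complex symplectic product of `x` and
`y`, plus half the squared imaginary part of their Hermitian product. -/
lemma Q_P1_br_22 {X Y : su5} (hX : P2 X = X) (hY : P2 Y = Y) :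
    2 * Qf (P1 (br X Y)) (P1 (br X Y)) ≤ Qf (br X Y) (br X Y) - Qf (br X Y) zc ^ 2 / 10 := by
  rw [Qf_P1, P1_P1]
  obtain ⟨x, hX⟩ := exists_mat2 hX
  obtain ⟨y, hY⟩ := exists_mat2 hY
  have h : Qf (br X Y) (br X Y) - Qf (br X Y) zc ^ 2 / 10 - 2 * Qf (br X Y) (P1 (br X Y)) =
      Complex.normSq (x (.inl 0) * y (.inr 0) - x (.inr 0) * y (.inl 0) +
        x (.inl 1) * y (.inr 1) - x (.inr 1) * y (.inl 1)) +
      (∑ i, (star (x i) * y i)).im ^ 2 / 2 := by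
    simp only [Qf_apply, Q, br_val, hX, hY, zc_val, P1_val, blk, proj1_apply]
    simp [Matrix.trace, Matrix.mul_apply, mat2, Fintype.sum_sum_type, Fin.sum_univ_two,
      Matrix.one_apply, Matrix.toBlocks₁₁, Matrix.J, Complex.normSq_apply]
    ring
  have := Complex.normSq_nonneg (x (.inl 0) * y (.inr 0) - x (.inr 0) * y (.inl 0) +
        x (.inl 1) * y (.inr 1) - x (.inr 1) * y (.inl 1))
  have := sq_nonneg (∑ i, (star (x i) * y i)).im
  linarith

/-- `SU(4)/Sp(2)` is the round sphere `S⁵`, so the squared bracket is a constant multiple of the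
squared area. -/
lemma Q_br_11 {X Y : su5} (hX : P1 X = X) (hY : P1 Y = Y) :
    Qf (br X Y) (br X Y) = 2 * (Qf X X * Qf Y Y - Qf X Y ^ 2) := by
  obtain ⟨r, z, w, hX⟩ := exists_mat1 hX
  obtain ⟨r', z', w', hY⟩ := exists_mat1 hY
  simp only [Qf_apply, Q, br_val, hX, hY]
  simp [Matrix.trace, Matrix.mul_apply, mat1, Fintype.sum_sum_type, Fin.sum_univ_two]
  ring

/-- The matrices `mat1 r z w` act on `ℂ⁴` by Clifford multiplication: their square is `-(r² + |z|² +
|w|²)`, which is `-Q(X, X)/2`. Hence each acts as a multiple of an isometry. -/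
lemma Q_br_12 {X Y : su5} (hX : P1 X = X) (hY : P2 Y = Y) :
    Qf (br X Y) (br X Y) = 1 / 2 * (Qf X X * Qf Y Y) := by
  obtain ⟨r, z, w, hX⟩ := exists_mat1 hX
  obtain ⟨x, hY⟩ := exists_mat2 hY
  simp only [Qf_apply, Q, br_val, hX, hY]
  simp [Matrix.trace, Matrix.mul_apply, mat1, mat2, Fintype.sum_sum_type, Fin.sum_univ_two]
  ring

/-! ### The curvature of a diagonal metric at the base point, algebraically -/

/-- The inner product `x₁ Q` on `𝔭₁` plus `x₂ Q` on `𝔭₂`, extended by zero on the isotropy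
algebra. -/
def Bf (x₁ x₂ : ℝ) : LinearMap.BilinForm ℝ su5 :=
  x₁ • Qf.compl₁₂ P1 P1 + x₂ • Qf.compl₁₂ P2 P2

lemma Bf_apply (x₁ x₂ : ℝ) (X Y : su5) :
    Bf x₁ x₂ X Y = x₁ * Qf (P1 X) (P1 Y) + x₂ * Qf (P2 X) (P2 Y) := rfl

lemma Bf_comm (x₁ x₂ : ℝ) (X Y : su5) : Bf x₁ x₂ X Y = Bf x₁ x₂ Y X := by
  rw [Bf_apply, Bf_apply, Qf_comm, Qf_comm (P2 X)]

lemma Bf_apply' (x₁ x₂ : ℝ) (X Y : su5) :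
    Bf x₁ x₂ X Y = x₁ * Qf X (P1 Y) + x₂ * Qf X (P2 Y) := by
  rw [Bf_apply, Qf_P1, Qf_P2, P1_P1, P2_P2]

lemma Bf_self_nonneg {x₁ x₂ : ℝ} (h₁ : 0 < x₁) (h₂ : 0 < x₂) (X : su5) : 0 ≤ Bf x₁ x₂ X X := by
  rw [Bf_apply]
  exact add_nonneg (mul_nonneg h₁.le (Qf_nonneg _)) (mul_nonneg h₂.le (Qf_nonneg _))

lemma Bf_self_eq_zero {x₁ x₂ : ℝ} (h₁ : 0 < x₁) (h₂ : 0 < x₂) {X : su5} :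
    Bf x₁ x₂ X X = 0 ↔ P1 X = 0 ∧ P2 X = 0 := by
  constructor
  · intro h
    rw [Bf_apply] at h
    have := mul_nonneg h₁.le (Qf_nonneg (P1 X))
    have := mul_nonneg h₂.le (Qf_nonneg (P2 X))
    have e1 : x₁ * Qf (P1 X) (P1 X) = 0 := by linarith
    have e2 : x₂ * Qf (P2 X) (P2 X) = 0 := by linarith
    exact ⟨Qf_self_eq_zero ((mul_eq_zero.1 e1).resolve_left h₁.ne'),
      Qf_self_eq_zero ((mul_eq_zero.1 e2).resolve_left h₂.ne')⟩
  · rintro ⟨e1, e2⟩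
    simp [Bf_apply, e1, e2]

/-- The symmetric part of the Levi-Civita connection of `Bf x₁ x₂`. -/
def Uo (x₁ x₂ : ℝ) (X Y : su5) : su5 :=
  ((x₂ - x₁) / (2 * x₂)) • (br (P1 X) (P2 Y) + br (P1 Y) (P2 X))

/-- The unnormalized sectional curvature of `Bf x₁ x₂` on horizontal vectors. -/
def Kf (x₁ x₂ : ℝ) (X Y : su5) : ℝ :=
  x₁ * Qf (br (P1 X) (P1 Y)) (br (P1 X) (P1 Y)) +
    (3 * x₁ - x₁ ^ 2 / x₂) * Qf (br (P1 X) (P1 Y)) (br (P2 X) (P2 Y)) +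
    x₂ * Qf (br (P2 X) (P2 Y)) (br (P2 X) (P2 Y)) -
    3 / 4 * x₁ * Qf (P1 (br (P2 X) (P2 Y))) (P1 (br (P2 X) (P2 Y))) +
    x₁ ^ 2 / (4 * x₂) * Qf (br (P1 X) (P2 Y) + br (P2 X) (P1 Y))
      (br (P1 X) (P2 Y) + br (P2 X) (P1 Y))

lemma Qf_ortho {Z W : su5} (hZ : P2 Z = 0) (hW : P2 W = W) : Qf Z W = 0 := by
  rw [← hW, ← Qf_P2, hZ, map_zero, LinearMap.zero_apply]

lemma Qf_ortho' {Z W : su5} (hZ : P2 Z = Z) (hW : P2 W = 0) : Qf Z W = 0 := by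
  rw [Qf_comm, Qf_ortho hW hZ]

lemma Qf_ortho₁ {Z W : su5} (hZ : P1 Z = 0) (hW : P1 W = W) : Qf Z W = 0 := by
  rw [← hW, ← Qf_P1, hZ, map_zero, LinearMap.zero_apply]

lemma P2_br_21 {X Y : su5} (hX : P2 X = X) (hY : P1 Y = Y) : P2 (br X Y) = br X Y := by
  rw [br_anti Y X, map_neg, P2_br_12 hY hX]

lemma P1_of_P2 {X : su5} (h : P2 X = X) : P1 X = 0 := by rw [← h, P1_P2]

lemma P2_of_P1 {X : su5} (h : P1 X = X) : P2 X = 0 := by rw [← h, P2_P1]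

/-- The right side vanishes for `Z` in `𝔭₁`, because `ad Z` is skew for `Q` and preserves `𝔭₂`. For
`Z` in `𝔭₂` only mixed brackets survive, with weight `x₁` or `x₂` according to whether the other
argument lies in `𝔭₁` or `𝔭₂`. This accounts for the factor `x₂ - x₁`. -/
lemma Uo_spec {x₁ x₂ : ℝ} (h₂ : 0 < x₂) {X Y Z : su5} (hX : P1 X + P2 X = X)
    (hY : P1 Y + P2 Y = Y) (hZ : P1 Z + P2 Z = Z) :
    Bf x₁ x₂ (Uo x₁ x₂ X Y) Z =
      -(1 / 2) * (Bf x₁ x₂ (br X Z) Y + Bf x₁ x₂ X (br Y Z)) := by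
  rw [Bf_comm _ _ X, Bf_apply', Bf_apply', Bf_apply']
  have a1 := P1_P1 X
  have a2 := P2_P2 X
  have b1 := P1_P1 Y
  have b2 := P2_P2 Y
  have c1 := P1_P1 Z
  have c2 := P2_P2 Z
  rw [← hX, ← hY, ← hZ]
  simp only [Uo, map_add, P1_P1, P1_P2, P2_P1, P2_P2, add_zero, zero_add]
  generalize P1 X = X1 at *
  generalize P2 X = X2 at *
  generalize P1 Y = Y1 at *
  generalize P2 Y = Y2 at *
  generalize P1 Z = Z1 at *
  generalize P2 Z = Z2 at *
  simp only [map_smul, map_add, LinearMap.add_apply, LinearMap.smul_apply, smul_eq_mul]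
  have o1 : ∀ {V W}, P2 V = V → P1 W = W → Qf V W = 0 := fun hV hW =>
    Qf_ortho' hV (P2_of_P1 hW)
  rw [o1 (P2_br_12 a1 b2) c1, o1 (P2_br_12 b1 a2) c1, Qf_ortho₁ (P1_br_11 a1 c1) b1,
    o1 (P2_br_21 a2 c1) b1, o1 (P2_br_12 a1 c2) b1, Qf_ortho₁ (P1_br_11 b1 c1) a1,
    o1 (P2_br_21 b2 c1) a1, o1 (P2_br_12 b1 c2) a1,
    Qf_ortho (P2_br_11 a1 c1) b2, Qf_ortho (P2_br_22 a2 c2) b2,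
    Qf_ortho (P2_br_11 b1 c1) a2, Qf_ortho (P2_br_22 b2 c2) a2]
  have e1 : Qf (br X2 Z2) Y1 = Qf (br Y1 X2) Z2 := by rw [Qf_br' Y1, Qf_comm]
  have e2 : Qf (br Y2 Z2) X1 = Qf (br X1 Y2) Z2 := by rw [Qf_br' X1, Qf_comm]
  have e3 : Qf (br X1 Z2) Y2 = -Qf (br X1 Y2) Z2 := by rw [Qf_br, Qf_comm]
  have e4 : Qf (br Y1 Z2) X2 = -Qf (br Y1 X2) Z2 := by rw [Qf_br, Qf_comm]
  have e5 : Qf (br X2 Z1) Y2 = -Qf (br Y2 Z1) X2 := by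
    rw [Qf_br', br_anti Y2 Z1, map_neg, Qf_comm]
  rw [e1, e2, e3, e4, e5]
  field_simp
  ring

/-- The left side is the standard formula for the unnormalized sectional curvature of an invariant
metric. After expansion into components, the bracket relations remove most terms. -/
lemma besse_eq_Kf {x₁ x₂ : ℝ} (h₂ : 0 < x₂) {X Y : su5} (hX : P1 X + P2 X = X)
    (hY : P1 Y + P2 Y = Y) :
    Bf x₁ x₂ (Uo x₁ x₂ X Y) (Uo x₁ x₂ X Y) - Bf x₁ x₂ (Uo x₁ x₂ X X) (Uo x₁ x₂ Y Y) -
      3 / 4 * Bf x₁ x₂ (br X Y) (br X Y) - 1 / 2 * Bf x₁ x₂ (br X (br X Y)) Y -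
      1 / 2 * Bf x₁ x₂ (br Y (br Y X)) X = Kf x₁ x₂ X Y := by
  rw [Kf, Bf_apply' _ _ (br X (br X Y)), Bf_apply' _ _ (br Y (br Y X)), Qf_br X (br X Y),
    Qf_br X (br X Y), Qf_br Y (br Y X), Qf_br Y (br Y X), br_anti X Y]
  simp only [Bf_apply]
  conv_lhs => rw [← hX, ← hY]
  have a1 := P1_P1 X
  have a2 := P2_P2 X
  have b1 := P1_P1 Y
  have b2 := P2_P2 Y
  simp only [Uo, map_add, P1_P1, P1_P2, P2_P1, P2_P2, add_zero, zero_add]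
  generalize P1 X = X1 at *
  generalize P2 X = X2 at *
  generalize P1 Y = Y1 at *
  generalize P2 Y = Y2 at *
  -- The Jacobi identity expresses the pairing arising from `U(X, X)` and `U(Y, Y)` through the
  -- pairings that already occur.
  have j : Qf (br X1 X2) (br Y1 Y2) = Qf (br X1 Y1) (br X2 Y2) -
      Qf (br X1 Y2) (br X2 Y1) := by
    have h1 := jacobi X1 Y1 Y2
    have h2 : Qf X2 (br (br X1 Y1) Y2) = -Qf (br X1 Y1) (br X2 Y2) := by
      rw [Qf_comm, Qf_br', br_anti X2 Y2, map_neg]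
    have h3 : Qf X2 (br Y1 (br X1 Y2)) = Qf (br X1 Y2) (br X2 Y1) := by
      rw [Qf_comm, Qf_br, br_anti X2 Y1, map_neg, neg_neg]
    rw [Qf_br, sub_eq_iff_eq_add.1 h1.symm, map_add, h2, h3]
    ring
  have u1 : br Y1 X2 = -br X2 Y1 := br_anti _ _
  have u2 : br Y2 X1 = -br X1 Y2 := br_anti _ _
  have u3 : br Y1 X1 = -br X1 Y1 := br_anti _ _
  have u4 : br Y2 X2 = -br X2 Y2 := br_anti _ _
  simp only [map_smul, map_add, map_neg, LinearMap.add_apply, LinearMap.smul_apply,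
    LinearMap.neg_apply, smul_eq_mul, u1, u2, u3, u4, P1_of_P2 (P2_br_12 a1 b2),
    P1_of_P2 (P2_br_12 a1 a2), P1_of_P2 (P2_br_12 b1 b2),
    P1_of_P2 (P2_br_21 a2 b1), P2_br_12 a1 b2, P2_br_12 a1 a2, P2_br_12 b1 b2, P2_br_21 a2 b1,
    P1_br_11 a1 b1, P2_br_11 a1 b1, P2_br_22 a2 b2, LinearMap.zero_apply, map_zero,
    Qf_ortho (P2_br_11 a1 b1) (P2_br_12 a1 b2), Qf_ortho (P2_br_11 a1 b1) (P2_br_21 a2 b1),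
    Qf_ortho' (P2_br_12 a1 b2) (P2_br_11 a1 b1), Qf_ortho' (P2_br_21 a2 b1) (P2_br_11 a1 b1),
    Qf_ortho (P2_br_22 a2 b2) (P2_br_12 a1 b2), Qf_ortho (P2_br_22 a2 b2) (P2_br_21 a2 b1),
    Qf_ortho' (P2_br_12 a1 b2) (P2_br_22 a2 b2), Qf_ortho' (P2_br_21 a2 b1) (P2_br_22 a2 b2),
    Qf_comm (br X2 Y1) (br X1 Y2), Qf_comm (br X2 Y2) (br X1 Y1), j]
  field_simp
  ring

/-! ### Positivity of the curvature below the ratio `2`. -/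

lemma Qf_add_smul_self (X Y : su5) (a b : ℝ) :
    Qf (a • X + b • Y) (a • X + b • Y) =
      a ^ 2 * Qf X X + 2 * (a * b) * Qf X Y + b ^ 2 * Qf Y Y := by
  simp only [map_add, map_smul, LinearMap.add_apply, LinearMap.smul_apply, smul_eq_mul,
    Qf_comm Y X]
  ring

/-- Equality in the Cauchy-Schwarz inequality. -/
lemma eq_smul_of_cs {X Y : su5} (hY : Y ≠ 0) (h : Qf X X * Qf Y Y ≤ Qf X Y ^ 2) :
    X = (Qf X Y / Qf Y Y) • Y := by
  have hp := Qf_pos hY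
  have h1 : Qf (X - (Qf X Y / Qf Y Y) • Y) (X - (Qf X Y / Qf Y Y) • Y) ≤ 0 := by
    have := Qf_add_smul_self X Y 1 (-(Qf X Y / Qf Y Y))
    rw [one_smul, neg_smul (M := su5), ← sub_eq_add_neg] at this
    rw [this]
    have h2 : 1 ^ 2 * Qf X X + 2 * (1 * -(Qf X Y / Qf Y Y)) * Qf X Y +
        (-(Qf X Y / Qf Y Y)) ^ 2 * Qf Y Y = (Qf X X * Qf Y Y - Qf X Y ^ 2) / Qf Y Y := by
      field_simp
      ring
    rw [h2]
    exact div_nonpos_of_nonpos_of_nonneg (by linarith) hp.le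
  exact sub_eq_zero.1 (Qf_self_eq_zero (le_antisymm h1 (Qf_nonneg _)))

lemma eq_zero_of_br_12 {X Y : su5} (hX : P1 X = X) (hY : P2 Y = Y) (h : br X Y = 0) :
    X = 0 ∨ Y = 0 := by
  have h1 := Q_br_12 hX hY
  rw [h, map_zero] at h1
  have h2 : Qf X X * Qf Y Y = 0 := by linarith
  exact (mul_eq_zero.1 h2).imp Qf_self_eq_zero Qf_self_eq_zero

/-- Two horizontal vectors whose brackets all vanish are linearly dependent. -/
lemma dependent_of_br {X Y : su5} (hX : P1 X + P2 X = X) (hY : P1 Y + P2 Y = Y)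
    (hA : br (P1 X) (P1 Y) = 0) (hD : br (P2 X) (P2 Y) = 0)
    (hC : br (P1 X) (P2 Y) + br (P2 X) (P1 Y) = 0) :
    Y = 0 ∨ ∃ c : ℝ, X = c • Y := by
  by_cases h2 : P2 Y = 0
  · by_cases h3 : P2 X = 0
    · rw [h2, add_zero] at hY
      rw [h3, add_zero] at hX
      rw [or_iff_not_imp_left]
      intro h0
      refine ⟨_, eq_smul_of_cs h0 ?_⟩
      have := Q_br_11 (P1_P1 X) (P1_P1 Y)
      rw [hA, map_zero, hX, hY] at this
      linarith
    · left
      rw [h2, map_zero, zero_add, br_anti, neg_eq_zero] at hC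
      rw [← hY, h2, (eq_zero_of_br_12 (P1_P1 Y) (P2_P2 X) hC).resolve_right h3, add_zero]
  · right
    have h4 := Q_br_22 (P2_P2 X) (P2_P2 Y)
    rw [hD, map_zero] at h4
    -- If `D = 0`, both non-negative parts of `Q_br_22` vanish; the first is the defect in the
    -- Cauchy-Schwarz inequality.
    obtain ⟨c, h5⟩ : ∃ c : ℝ, P2 X = c • P2 Y :=
      ⟨_, eq_smul_of_cs h2 (by nlinarith [sq_nonneg (Qf (P2 X) (br zc (P2 Y)))])⟩
    refine ⟨c, ?_⟩
    have h6 : br (P1 X - c • P1 Y) (P2 Y) = 0 := by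
      rw [h5, map_smul, LinearMap.smul_apply, br_anti (P1 Y)] at hC
      rw [map_sub, LinearMap.sub_apply, map_smul, LinearMap.smul_apply, sub_eq_add_neg,
        ← smul_neg (A := su5), hC]
    have h7 := (eq_zero_of_br_12 (by rw [map_sub, map_smul, P1_P1, P1_P1]) (P2_P2 Y)
      h6).resolve_right h2
    rw [← hX, ← hY, h5, sub_eq_zero.1 h7, smul_add]


/-- The diagonal metrics with `4/3 ≤ x₁ / x₂ < 2` have positive curvature. -/
lemma Kf_pos {x₁ x₂ : ℝ} (h₂ : 0 < x₂) (h43 : 4 / 3 * x₂ ≤ x₁) (h12 : x₁ < 2 * x₂) {X Y : su5}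
    (hX : P1 X + P2 X = X) (hY : P1 Y + P2 Y = Y)
    (hXY : ∀ a b : ℝ, a • X + b • Y = 0 → a = 0 ∧ b = 0) : 0 < Kf x₁ x₂ X Y := by
  by_contra hK
  have h₁ : 0 < x₁ := by linarith
  set A := br (P1 X) (P1 Y) with hA
  set D := br (P2 X) (P2 Y) with hD
  set C := br (P1 X) (P2 Y) + br (P2 X) (P1 Y) with hC
  -- `S` is the `sp(2)`-component of `D`; the `10` is `Q(zc, zc)`.
  set S := D - P1 D - (Qf D zc / 10) • zc with hS
  set φ := x₁ / x₂ with hφ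
  have hφ1 : 4 / 3 ≤ φ := (le_div_iff₀ h₂).2 h43
  have hφ2 : φ < 2 := (div_lt_iff₀ h₂).2 h12
  have z1 : Qf (P1 D) zc = 0 := by rw [Qf_P1, P1_zc, map_zero]
  have z2 : Qf A (P1 D) = 0 := Qf_ortho₁ (P1_br_11 (P1_P1 X) (P1_P1 Y)) (P1_P1 D)
  have z3 : Qf A zc = 0 := by
    rw [hA, Qf_br']
    have : br (P1 Y) zc = 0 := by
      ext1
      rw [br_val, val_of_P1 (P1_P1 Y), zc_val, Matrix.fromBlocks_multiply,
        Matrix.fromBlocks_multiply, fromBlocks_sub]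
      simp
    rw [this, map_zero]
  have z4 : Qf D (P1 D) = Qf (P1 D) (P1 D) := by rw [Qf_P1 D, P1_P1]
  have hAS : Qf A S = Qf A D := by
    simp only [hS, map_sub, map_smul, z2, z3]
    simp
  have hSS : Qf S S = Qf D D - Qf (P1 D) (P1 D) - Qf D zc ^ 2 / 10 := by
    simp only [hS, map_sub, map_smul, LinearMap.sub_apply, LinearMap.smul_apply, smul_eq_mul, z1,
      Q_zc, Qf_comm zc, Qf_comm (P1 D) D, z4]
    ring
  have hSD := Q_P1_br_22 (P2_P2 X) (P2_P2 Y)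
  rw [← hD] at hSD
  have hAA := Qf_add_smul_self A S 1 ((3 - φ) / 2)
  rw [one_smul, hAS] at hAA
  -- This completes the square in `A`. The coefficient of `|S|²` is right because `φ (3 - φ)²/4 +
  -- (3φ/4 - 1) + (2 - φ)³/4 = 1`.
  have key : Kf x₁ x₂ X Y / x₂ =
      φ * Qf (A + ((3 - φ) / 2) • S) (A + ((3 - φ) / 2) • S) +
      (3 / 4 * φ - 1) * (Qf S S - Qf (P1 D) (P1 D)) + (2 - φ) ^ 3 / 4 * Qf S S +
      Qf D zc ^ 2 / 10 + φ ^ 2 / 4 * Qf C C := by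
    rw [hAA, hSS, Kf, hφ]
    field_simp
    ring
  have hKle : Kf x₁ x₂ X Y / x₂ ≤ 0 := div_nonpos_of_nonpos_of_nonneg (not_lt.1 hK) h₂.le
  have p1 := mul_nonneg (by linarith : 0 ≤ φ) (Qf_nonneg (A + ((3 - φ) / 2) • S))
  have p2 : 0 ≤ (3 / 4 * φ - 1) * (Qf S S - Qf (P1 D) (P1 D)) :=
    mul_nonneg (by linarith) (by linarith)
  have c3 : 0 < (2 - φ) ^ 3 / 4 := by have := pow_pos (sub_pos.2 hφ2) 3; linarith
  have p3 := mul_nonneg c3.le (Qf_nonneg S)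
  have p4 := sq_nonneg (Qf D zc)
  have c5 : 0 < φ ^ 2 / 4 := by positivity
  have p5 := mul_nonneg c5.le (Qf_nonneg C)
  have eS : S = 0 := Qf_self_eq_zero
    ((mul_eq_zero.1 (by linarith : (2 - φ) ^ 3 / 4 * Qf S S = 0)).resolve_left c3.ne')
  have eC : C = 0 := Qf_self_eq_zero
    ((mul_eq_zero.1 (by linarith : φ ^ 2 / 4 * Qf C C = 0)).resolve_left c5.ne')
  have eA : A = 0 := by
    have := Qf_self_eq_zero ((mul_eq_zero.1 (by linarith :
      φ * Qf (A + ((3 - φ) / 2) • S) (A + ((3 - φ) / 2) • S) = 0)).resolve_left (by linarith))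
    rwa [eS, smul_zero, add_zero] at this
  -- The coefficient `3φ/4 - 1` may vanish, so `P1 D = 0` is drawn from `|P1 D|² ≤ |S|² = 0`; the
  -- `zc`-component vanishes because its square is one of the summands.
  have eD : D = 0 := by
    have e0 : Qf S S = 0 := by rw [eS, map_zero]
    have := Qf_nonneg (P1 D)
    exact Qf_self_eq_zero (by linarith)
  rcases dependent_of_br hX hY eA eD eC with h | ⟨c, h⟩
  · have := hXY 0 1 (by rw [h]; simp)
    simp at this
  · have := hXY 1 (-c) (by rw [h, one_smul, neg_smul (M := su5), add_neg_cancel])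
    simp at this

/-! ### Explicit vectors -/

/-- The vector of `𝔭₁` with given coordinates. -/
def m1 (r : ℝ) (z w : ℂ) : su5 := ⟨Matrix.fromBlocks (mat1 r z w) 0 0 0, by
  refine ⟨?_, ?_⟩
  · ext i j
    rcases i with (i | i) | i <;> rcases j with (j | j) | j <;> fin_cases i <;> fin_cases j <;>
      simp [mat1]
  · simp [Matrix.trace, mat1, Fintype.sum_sum_type, Fin.sum_univ_two]⟩

/-- The vector of `𝔭₂` with given coordinates. -/
def m2 (x : Four → ℂ) : su5 := ⟨mat2 x, by
  refine ⟨?_, ?_⟩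
  · rw [mat2, Matrix.fromBlocks_conjTranspose, Matrix.fromBlocks_neg]
    congr 1
    · simp
    · ext i j; simp
    · ext i j; simp
    · simp
  · rw [mat2, trace_fromBlocks]; simp⟩

lemma P1_m1 (r : ℝ) (z w : ℂ) : P1 (m1 r z w) = m1 r z w := by
  ext1
  have : proj1 (mat1 r z w) = mat1 r z w := by
    rw [proj1_apply]
    ext i j
    rcases i with i | i <;> rcases j with j | j <;> fin_cases i <;> fin_cases j <;>
      simp [mat1, Matrix.trace, Fintype.sum_sum_type, Matrix.mul_apply, Matrix.J,
        Matrix.one_apply] <;> ring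
  rw [P1_val, m1, blk, Matrix.toBlocks_fromBlocks₁₁, this]

lemma P2_m2 (x : Four → ℂ) : P2 (m2 x) = m2 x := by
  ext1
  simp [P2_val, m2, mat2]

lemma Q_m1 (r r' : ℝ) (z w z' w' : ℂ) : Qf (m1 r z w) (m1 r' z' w') =
    2 * (r * r' + (z.re * z'.re + z.im * z'.im) + (w.re * w'.re + w.im * w'.im)) := by
  rw [Qf_apply, Q]
  simp [m1, mat1, Matrix.trace, Matrix.mul_apply, Fintype.sum_sum_type, Fin.sum_univ_two]
  ring

lemma Q_m2 (x y : Four → ℂ) : Qf (m2 x) (m2 y) =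
    ∑ i, ((x i).re * (y i).re + (x i).im * (y i).im) := by
  rw [Qf_apply, Q]
  simp [m2, mat2, Matrix.trace, Matrix.mul_apply, Fintype.sum_sum_type, Fin.sum_univ_two]
  ring

/-- A basis of `𝔭₁`, orthogonal with squared lengths `2`. -/
def fr1 : Fin 5 → su5 :=
  ![m1 1 0 0, m1 0 1 0, m1 0 Complex.I 0, m1 0 0 1, m1 0 0 Complex.I]

/-- An orthonormal basis of `𝔭₂`. -/
def fr2 (k : Four × Fin 2) : su5 := m2 (Pi.single k.1 (![1, Complex.I] k.2))

lemma P1_fr1 (k : Fin 5) : P1 (fr1 k) = fr1 k := by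
  fin_cases k <;> exact P1_m1 _ _ _

lemma P2_fr2 (k : Four × Fin 2) : P2 (fr2 k) = fr2 k := P2_m2 _

lemma Q_fr1 (k : Fin 5) : Qf (fr1 k) (fr1 k) = 2 := by
  fin_cases k <;> simp [fr1, Q_m1]

lemma Q_fr2 (k : Four × Fin 2) : Qf (fr2 k) (fr2 k) = 1 := by
  obtain ⟨i, j⟩ := k
  rcases i with i | i <;> fin_cases i <;> fin_cases j <;> simp [fr2, Q_m2]

lemma fr1_expand {X : su5} (hX : P1 X = X) : X = ∑ k, (Qf X (fr1 k) / 2) • fr1 k := by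
  obtain ⟨r, z, w, h⟩ := exists_mat1 hX
  obtain rfl : X = m1 r z w := Subtype.ext h
  have h1 : m1 r z w = r • m1 1 0 0 + z.re • m1 0 1 0 + z.im • m1 0 Complex.I 0 +
      w.re • m1 0 0 1 + w.im • m1 0 0 Complex.I := by
    ext i j
    rcases i with (i | i) | i <;> rcases j with (j | j) | j <;> fin_cases i <;> fin_cases j <;>
      simp [m1, mat1, Complex.ext_iff]
  simpa [Fin.sum_univ_five, fr1, Q_m1] using h1

lemma fr2_expand {X : su5} (hX : P2 X = X) : X = ∑ k, Qf X (fr2 k) • fr2 k := by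
  obtain ⟨x, h⟩ := exists_mat2 hX
  obtain rfl : X = m2 x := Subtype.ext h
  have h1 : m2 x = ∑ i, ((x i).re • m2 (Pi.single i 1) + (x i).im • m2 (Pi.single i Complex.I)) := by
    ext i j
    rcases i with (i | i) | i <;> rcases j with (j | j) | j <;> fin_cases i <;> fin_cases j <;>
      simp [m2, mat2, Complex.ext_iff, Fintype.sum_sum_type]
  have h2 : ∀ k, Qf (m2 x) (fr2 k) = ![(x k.1).re, (x k.1).im] k.2 := by
    rintro ⟨i, j⟩
    rcases i with i | i <;> fin_cases i <;> fin_cases j <;>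
      simp [fr2, Q_m2, Fintype.sum_sum_type, Fin.sum_univ_two]
  rw [Fintype.sum_prod_type]
  simp only [h2, Fin.sum_univ_two]
  simpa [fr2] using h1

/-- A plane of non-positive curvature for `2 ≤ x₁ / x₂ ≤ 3`. -/
lemma exists_Kf_nonpos {x₁ x₂ : ℝ} (h₂ : 0 < x₂) (h12 : 2 * x₂ ≤ x₁) (h13 : x₁ ≤ 3 * x₂) :
    ∃ X Y : su5, P1 X + P2 X = X ∧ P1 Y + P2 Y = Y ∧
      (∀ a b : ℝ, a • X + b • Y = 0 → a = 0 ∧ b = 0) ∧ Kf x₁ x₂ X Y ≤ 0 := by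
  -- The value `a² = (3 - φ)/8` minimizes the quadratic polynomial in `a²` that gives the curvature,
  -- which amounts to `A + (3 - φ)/2 S = 0`. The assumption `φ ≤ 3` is what allows the square root.
  set a := √((3 - x₁ / x₂) / 8) with ha
  have hφ : x₁ / x₂ ≤ 3 := (div_le_iff₀ h₂).2 h13
  have ha2 : a ^ 2 = (3 - x₁ / x₂) / 8 := Real.sq_sqrt (by linarith)
  have eP1 : ∀ (X1 X2 : su5), P1 X1 = X1 → P2 X2 = X2 → P1 (a • X1 + X2) = a • X1 := by
    intro X1 X2 h1 h2
    rw [map_add, map_smul, h1, P1_of_P2 h2, add_zero]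
  have eP2 : ∀ (X1 X2 : su5), P1 X1 = X1 → P2 X2 = X2 → P2 (a • X1 + X2) = X2 := by
    intro X1 X2 h1 h2
    rw [map_add, map_smul, h2, P2_of_P1 h1, smul_zero, zero_add]
  have hx1 := P1_m1 1 0 0
  have hy1 := P1_m1 0 (-Complex.I) 0
  have hx2 := P2_m2 (Pi.single (.inl 0) 1)
  have hy2 := P2_m2 (Pi.single (.inl 1) 1)
  refine ⟨a • m1 1 0 0 + m2 (Pi.single (.inl 0) 1), a • m1 0 (-Complex.I) 0 +
    m2 (Pi.single (.inl 1) 1), ?_, ?_, ?_, ?_⟩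
  · rw [eP1 _ _ hx1 hx2, eP2 _ _ hx1 hx2]
  · rw [eP1 _ _ hy1 hy2, eP2 _ _ hy1 hy2]
  · intro s t h
    have h1 := congrArg (fun Z : su5 => Qf (P2 Z) (m2 (Pi.single (.inl 0) 1))) h
    have h2 := congrArg (fun Z : su5 => Qf (P2 Z) (m2 (Pi.single (.inl 1) 1))) h
    simp only [map_add P2 (s • _), map_smul, eP2 _ _ hx1 hx2, eP2 _ _ hy1 hy2, map_zero] at h1 h2
    simp [Q_m2] at h1 h2
    exact ⟨h1, h2⟩
  · rw [Kf]
    simp only [eP1 _ _ hx1 hx2, eP2 _ _ hx1 hx2, eP1 _ _ hy1 hy2, eP2 _ _ hy1 hy2, map_smul,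
      LinearMap.smul_apply, smul_eq_mul]
    have q1 := Q_br_11 hx1 hy1
    -- The `𝔭₁`-components are chosen so that the mixed term `C` vanishes.
    have hC : br (m1 1 0 0) (m2 (Pi.single (.inl 1) 1)) +
        br (m2 (Pi.single (.inl 0) 1)) (m1 0 (-Complex.I) 0) = 0 := by
      ext i j
      rcases i with (i | i) | i <;> rcases j with (j | j) | j <;> fin_cases i <;> fin_cases j <;>
        simp [m1, mat1, m2, mat2, br_val, Matrix.mul_apply, Fintype.sum_sum_type]
    rw [← smul_add, hC, smul_zero, map_zero]
    have q2 : Qf (br (m1 1 0 0) (m1 0 (-Complex.I) 0))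
        (br (m2 (Pi.single (.inl 0) 1)) (m2 (Pi.single (.inl 1) 1))) = -2 := by
      simp [Qf_apply, Q, m1, mat1, m2, mat2, br_val, Matrix.mul_apply, Fintype.sum_sum_type,
        Matrix.trace, Fin.sum_univ_two]
      norm_num
    have q3 : Qf (br (m2 (Pi.single (.inl 0) 1)) (m2 (Pi.single (.inl 1) 1)))
        (br (m2 (Pi.single (.inl 0) 1)) (m2 (Pi.single (.inl 1) 1))) = 1 := by
      simp [Qf_apply, Q, m2, mat2, br_val, Matrix.mul_apply, Fintype.sum_sum_type,
        Matrix.trace, Fin.sum_univ_two]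
      norm_num
    -- Only a lower bound for `|P1 D|²` is needed, since it enters with a negative sign. Testing
    -- against one vector of squared length `2`, whose product with `D` is `1`, gives `1/2`.
    have q4 := Qf_cs (P1 (br (m2 (Pi.single (.inl 0) 1)) (m2 (Pi.single (.inl 1) 1)))) (m1 0 (-1) 0)
    rw [Qf_P1 _ (m1 0 (-1) 0), P1_m1, Q_m1] at q4
    have q5 : Qf (br (m2 (Pi.single (.inl 0) 1)) (m2 (Pi.single (.inl 1) 1))) (m1 0 (-1) 0) =
        1 := by
      simp [Qf_apply, Q, m1, mat1, m2, mat2, br_val, Matrix.mul_apply, Fintype.sum_sum_type,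
        Matrix.trace, Fin.sum_univ_two]
      norm_num
    rw [q5] at q4
    rw [q1, q2, q3, Q_m1, Q_m1, Q_m1]
    simp only [Complex.neg_re, Complex.neg_im, Complex.I_re, Complex.I_im, Complex.zero_re,
      Complex.zero_im, Complex.one_re, Complex.one_im] at q4 ⊢
    set p := Qf (P1 (br (m2 (Pi.single (.inl 0) 1)) (m2 (Pi.single (.inl 1) 1))))
      (P1 (br (m2 (Pi.single (.inl 0) 1)) (m2 (Pi.single (.inl 1) 1))))
    have hp : 1 / 2 ≤ p := by linarith
    have h4 : x₁ / x₂ * x₂ = x₁ := div_mul_cancel₀ _ h₂.ne'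
    have h5 : 2 ≤ x₁ / x₂ := (le_div_iff₀ h₂).2 h12
    set φ := x₁ / x₂
    have h6 : x₁ ^ 2 / x₂ = φ ^ 2 * x₂ := by rw [← h4]; field_simp
    have h7 : x₁ * p ≥ x₁ * (1 / 2) := mul_le_mul_of_nonneg_left hp (by linarith)
    have h8 : 0 ≤ x₂ * (φ - 2) ^ 3 := mul_nonneg h₂.le (pow_nonneg (by linarith) 3)
    calc _ = 8 * x₁ * (a ^ 2) ^ 2 - 2 * (3 * x₁ - x₁ ^ 2 / x₂) * a ^ 2 + x₂ -
          3 / 4 * (x₁ * p) := by ring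
      _ ≤ 8 * x₁ * (a ^ 2) ^ 2 - 2 * (3 * x₁ - x₁ ^ 2 / x₂) * a ^ 2 + x₂ -
          3 / 4 * (x₁ * (1 / 2)) := by linarith
      _ = -(x₂ * (φ - 2) ^ 3) / 8 := by rw [ha2, h6, ← h4]; ring
      _ ≤ 0 := by linarith

/-! ### The Ricci sum -/

lemma sum_fr1_sq {X : su5} (hX : P1 X = X) : ∑ k, Qf X (fr1 k) ^ 2 = 2 * Qf X X := by
  have h := congrArg (Qf X) (fr1_expand hX)
  rw [map_sum] at h
  rw [h, Finset.mul_sum]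
  refine Finset.sum_congr rfl fun k _ => ?_
  rw [map_smul, smul_eq_mul]
  ring

lemma sum_fr2_sq {X : su5} (hX : P2 X = X) : ∑ k, Qf X (fr2 k) ^ 2 = Qf X X := by
  have h := congrArg (Qf X) (fr2_expand hX)
  rw [map_sum] at h
  rw [h]
  refine Finset.sum_congr rfl fun k _ => ?_
  rw [map_smul, smul_eq_mul, sq]

/-- Invariance of `Q` moves the bracket: the sum equals half the sum of `|[Y, f]|²` over the five
frame vectors `f` of `𝔭₁`, and each such term is `|Y|²` by `Q_br_12`. -/
lemma sum_P1_br_fr2 {Y : su5} (hY : P2 Y = Y) :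
    ∑ k, Qf (P1 (br (fr2 k) Y)) (P1 (br (fr2 k) Y)) = 5 / 2 * Qf Y Y := by
  have h1 : ∀ k, Qf (P1 (br (fr2 k) Y)) (P1 (br (fr2 k) Y)) =
      1 / 2 * ∑ l, Qf (br Y (fr1 l)) (fr2 k) ^ 2 := by
    intro k
    have := sum_fr1_sq (P1_P1 (br (fr2 k) Y))
    rw [← mul_right_inj' (two_ne_zero' ℝ), ← this, ← mul_assoc]
    norm_num
    refine Finset.sum_congr rfl fun l _ => ?_
    rw [Qf_P1, P1_fr1, Qf_br', Qf_comm]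
  simp only [h1]
  rw [← Finset.mul_sum, Finset.sum_comm]
  have h2 : ∀ l, ∑ k, Qf (br Y (fr1 l)) (fr2 k) ^ 2 = Qf Y Y := by
    intro l
    rw [sum_fr2_sq (P2_br_21 hY (P1_fr1 l)), br_anti (fr1 l), map_neg, map_neg,
      LinearMap.neg_apply, neg_neg, Q_br_12 (P1_fr1 l) hY, Q_fr1]
    ring
  simp only [h2]
  simp
  ring

/-- The trace of the curvature over an orthogonal frame. -/
lemma sum_Kf {x₁ x₂ : ℝ} (h₁ : 0 < x₁) (h₂ : 0 < x₂) (Y : su5) :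
    ∑ k, 1 / (2 * x₁) * Kf x₁ x₂ (fr1 k) Y + ∑ k, 1 / x₂ * Kf x₁ x₂ (fr2 k) Y =
      (8 + (x₁ / x₂) ^ 2) * Qf (P1 Y) (P1 Y) + (10 - 5 / 4 * (x₁ / x₂)) * Qf (P2 Y) (P2 Y) := by
  have e1 : ∀ k, Kf x₁ x₂ (fr1 k) Y = x₁ * (2 * (2 * Qf (P1 Y) (P1 Y) - Qf (P1 Y) (fr1 k) ^ 2)) +
      x₁ ^ 2 / (4 * x₂) * Qf (P2 Y) (P2 Y) := by
    intro k
    rw [Kf, P1_fr1, P2_of_P1 (P1_fr1 k)]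
    simp only [map_zero, LinearMap.zero_apply, add_zero]
    rw [Q_br_11 (P1_fr1 k) (P1_P1 Y), Q_br_12 (P1_fr1 k) (P2_P2 Y), Q_fr1, Qf_comm (fr1 k)]
    ring
  have e2 : ∀ k, Kf x₁ x₂ (fr2 k) Y = x₂ * (Qf (P2 Y) (P2 Y) - Qf (P2 Y) (fr2 k) ^ 2 +
        3 / 25 * Qf (br zc (P2 Y)) (fr2 k) ^ 2) -
      3 / 4 * x₁ * Qf (P1 (br (fr2 k) (P2 Y))) (P1 (br (fr2 k) (P2 Y))) +
      x₁ ^ 2 / (4 * x₂) * (1 / 2 * Qf (P1 Y) (P1 Y)) := by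
    intro k
    rw [Kf, P2_fr2, P1_of_P2 (P2_fr2 k)]
    simp only [map_zero, LinearMap.zero_apply, zero_add, mul_zero]
    rw [br_anti (P1 Y), map_neg, map_neg, LinearMap.neg_apply, neg_neg,
      Q_br_22 (P2_fr2 k) (P2_P2 Y), Q_br_12 (P1_P1 Y) (P2_fr2 k), Q_fr2, Qf_comm (fr2 k),
      Qf_comm (fr2 k)]
    ring
  have s1 := sum_fr1_sq (P1_P1 Y)
  have s2 := sum_fr2_sq (P2_P2 Y)
  have s3 := sum_fr2_sq (P2_br_zc (P2_P2 Y))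
  have s4 := sum_P1_br_fr2 (P2_P2 Y)
  rw [Q_br_zc (P2_P2 Y)] at s3
  -- On `𝔭₁`: `8 = 10 - 2` comes from the five vectors of `fr1` and `φ²` from the eight of `fr2`. On
  -- `𝔭₂`: `10 = 8 - 1 + 3`, and `-5/4 = 5/8 - 15/8` is the coefficient of `φ`.
  simp only [e1, e2]
  rw [← Finset.mul_sum, ← Finset.mul_sum]
  simp only [Finset.sum_add_distrib, Finset.sum_sub_distrib, ← Finset.mul_sum, s1, s2, s3, s4]
  simp
  field_simp
  ring

/-! ### The isotropy representation -/

lemma Ad_val (a : SU5) (X : su5) : (Ad a X).1 = a.1 * X.1 * star a.1 := rfl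

lemma star_mul_self (a : SU5) : star a.1 * a.1 = 1 :=
  Matrix.mem_unitaryGroup_iff'.1 (Matrix.mem_specialUnitaryGroup_iff.1 a.2).1

lemma mul_star_self' (a : SU5) : a.1 * star a.1 = 1 :=
  Matrix.mem_unitaryGroup_iff.1 (Matrix.mem_specialUnitaryGroup_iff.1 a.2).1

/-- The adjoint action as a linear map. -/
def AdL (a : SU5) : su5 →ₗ[ℝ] su5 where
  toFun := Ad a
  map_add' X Y := by ext1; simp [Ad_val, Matrix.mul_add, Matrix.add_mul]
  map_smul' c X := by ext1; simp [Ad_val]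

lemma AdL_apply (a : SU5) (X : su5) : AdL a X = Ad a X := rfl

lemma Ad_mul (a b : SU5) (X : su5) : Ad (a * b) X = Ad a (Ad b X) := by
  ext1
  simp [Ad_val, Matrix.mul_assoc]

lemma Ad_one (X : su5) : Ad 1 X = X := by
  ext1
  simp [Ad_val]

lemma Ad_inv_Ad (a : SU5) (X : su5) : Ad a⁻¹ (Ad a X) = X := by
  rw [← Ad_mul, inv_mul_cancel, Ad_one]

lemma Ad_Ad_inv (a : SU5) (X : su5) : Ad a (Ad a⁻¹ X) = X := by
  rw [← Ad_mul, mul_inv_cancel, Ad_one]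

lemma Ad_br (a : SU5) (X Y : su5) : Ad a (br X Y) = br (Ad a X) (Ad a Y) := by
  ext1
  have h : ∀ M N : Matrix Five Five ℂ, a.1 * M * star a.1 * (a.1 * N * star a.1) =
      a.1 * (M * N) * star a.1 := by
    intro M N
    calc _ = a.1 * M * (star a.1 * a.1) * N * star a.1 := by simp only [Matrix.mul_assoc]
      _ = _ := by rw [star_mul_self]; simp only [Matrix.mul_assoc, Matrix.mul_one]
  rw [Ad_val, br_val, br_val, Ad_val, Ad_val, h, h, Matrix.mul_sub, Matrix.sub_mul]

lemma Qf_Ad (a : SU5) (X Y : su5) : Qf (Ad a X) (Ad a Y) = Qf X Y := by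
  rw [Qf_apply, Qf_apply, Q, Q, Ad_val, Ad_val]
  have : a.1 * X.1 * star a.1 * (a.1 * Y.1 * star a.1) = a.1 * (X.1 * Y.1) * star a.1 := by
    calc _ = a.1 * X.1 * (star a.1 * a.1) * Y.1 * star a.1 := by simp only [Matrix.mul_assoc]
      _ = _ := by rw [star_mul_self]; simp only [Matrix.mul_assoc, Matrix.mul_one]
  rw [this, Matrix.trace_mul_comm, ← Matrix.mul_assoc, star_mul_self, Matrix.one_mul]

lemma exp_Ad (a : SU5) (X : su5) : expSU (Ad a X) = a * expSU X * a⁻¹ := by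
  apply Subtype.ext
  have hu : IsUnit a.1 := ⟨⟨a.1, star a.1, mul_star_self' a, star_mul_self a⟩, rfl⟩
  have hi : a.1⁻¹ = star a.1 := Matrix.inv_eq_right_inv (mul_star_self' a)
  have := Matrix.exp_conj a.1 X.1 hu
  rw [hi] at this
  exact this

/-- Elements of `Sp(2) S¹` are block diagonal with first block a multiple of a unitary symplectic
matrix. -/
lemma exists_of_mem_Sp2S1 {h : SU5} (hh : h ∈ Sp2S1) :
    ∃ (B : Matrix Four Four ℂ) (c : Matrix Unit Unit ℂ) (μ : ℂ),
      h.1 = Matrix.fromBlocks B 0 0 c ∧ Bᴴ * B = 1 ∧ B * Bᴴ = 1 ∧ μ ≠ 0 ∧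
        B * J4 * Bᵀ = μ • J4 := by
  obtain ⟨⟨A, l⟩, rfl⟩ := hh
  have hB := (iota (A, l)).2
  refine ⟨(iota (A, l)).1, _, (l : ℂ) ^ 2, rfl, Matrix.mem_unitaryGroup_iff'.1 hB,
    Matrix.mem_unitaryGroup_iff.1 hB, pow_ne_zero 2 (Circle.coe_ne_zero l), ?_⟩
  have h1 : A.1.1 * J4 * A.1.1ᵀ = J4 := SymplecticGroup.mem_iff.1 A.2
  change ((l : ℂ) • A.1.1) * J4 * ((l : ℂ) • A.1.1)ᵀ = _
  rw [Matrix.transpose_smul, Matrix.smul_mul, Matrix.smul_mul, Matrix.mul_smul, h1, smul_smul, sq]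

/-- If `B` is unitary with `B J Bᵀ = μ J`, the factors `μ` cancel when `B` is moved past `J`, so
conjugation by `B` commutes with `M ↦ J Mᵀ J` and hence with `proj1`. -/
lemma P1_Ad {h : SU5} (hh : h ∈ Sp2S1) (X : su5) : P1 (Ad h X) = Ad h (P1 X) := by
  obtain ⟨B, c, μ, hB, hB1, hB2, hμ, hJ⟩ := exists_of_mem_Sp2S1 hh
  ext1
  have hblk : blk (Ad h X) = B * blk X * Bᴴ := by
    rw [blk, Ad_val, hB, ← Matrix.fromBlocks_toBlocks X.1, Matrix.star_eq_conjTranspose,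
      Matrix.fromBlocks_conjTranspose, Matrix.fromBlocks_multiply, Matrix.fromBlocks_multiply,
      Matrix.toBlocks_fromBlocks₁₁]
    simp
  have h1 : B * J4 = μ • (J4 * Bᴴᵀ) := by
    calc B * J4 = B * J4 * (Bᴴ * B)ᵀ := by rw [hB1]; simp
      _ = B * J4 * Bᵀ * Bᴴᵀ := by rw [Matrix.transpose_mul]; simp only [Matrix.mul_assoc]
      _ = _ := by rw [hJ, Matrix.smul_mul]
  have h2 : Bᵀ * J4 = μ • (J4 * Bᴴ) := by
    have h3 : J4 * Bᵀ = μ • (Bᴴ * J4) := by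
      calc J4 * Bᵀ = Bᴴ * B * J4 * Bᵀ := by rw [hB1]; simp
        _ = Bᴴ * (B * J4 * Bᵀ) := by simp only [Matrix.mul_assoc]
        _ = _ := by rw [hJ, Matrix.mul_smul]
    calc Bᵀ * J4 = -(J4 * (J4 * Bᵀ) * J4) := by rw [← Matrix.mul_assoc, J4_mul_J4]; simp
      _ = -(μ • (J4 * Bᴴ * (J4 * J4))) := by
        rw [h3, Matrix.mul_smul, Matrix.smul_mul]; simp only [Matrix.mul_assoc]
      _ = _ := by rw [J4_mul_J4]; simp
  have hp : proj1 (B * blk X * Bᴴ) = B * proj1 (blk X) * Bᴴ := by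
    have h4 : μ • (J4 * (B * blk X * Bᴴ)ᵀ * J4) = μ • (B * (J4 * (blk X)ᵀ * J4) * Bᴴ) := by
      calc _ = μ • (J4 * Bᴴᵀ) * (blk X)ᵀ * (Bᵀ * J4) := by
            simp only [Matrix.transpose_mul, Matrix.mul_assoc, Matrix.smul_mul]
        _ = _ := by
            rw [← h1, h2]
            simp only [Matrix.mul_assoc, Matrix.mul_smul]
    have h5 : (B * blk X * Bᴴ).trace = (blk X).trace := by
      rw [Matrix.trace_mul_comm, ← Matrix.mul_assoc, hB1, Matrix.one_mul]
    rw [proj1_apply, proj1_apply, smul_right_injective _ hμ h4, h5]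
    simp only [Matrix.mul_sub, Matrix.sub_mul, Matrix.mul_smul, Matrix.smul_mul, Matrix.mul_one,
      hB2]
  rw [P1_val, hblk, hp, Ad_val, P1_val, hB, Matrix.star_eq_conjTranspose,
      Matrix.fromBlocks_conjTranspose, Matrix.fromBlocks_multiply, Matrix.fromBlocks_multiply]
  simp

lemma P2_Ad {h : SU5} (hh : h ∈ Sp2S1) (X : su5) : P2 (Ad h X) = Ad h (P2 X) := by
  obtain ⟨B, c, μ, hB, hB1, hB2, hμ, hJ⟩ := exists_of_mem_Sp2S1 hh
  ext1
  rw [P2_val, Ad_val, Ad_val, P2_val, hB]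
  conv_lhs => rw [← Matrix.fromBlocks_toBlocks X.1]
  rw [Matrix.star_eq_conjTranspose,
      Matrix.fromBlocks_conjTranspose, Matrix.fromBlocks_multiply, Matrix.fromBlocks_multiply,
      Matrix.fromBlocks_multiply, Matrix.fromBlocks_multiply, Matrix.toBlocks_fromBlocks₁₂,
      Matrix.toBlocks_fromBlocks₂₁]
  simp

/-- Invariance under the isotropy group is what makes `Bf` extend to a well-defined metric on the
quotient. -/
lemma Bf_Ad {h : SU5} (hh : h ∈ Sp2S1) (x₁ x₂ : ℝ) (X Y : su5) :
    Bf x₁ x₂ (Ad h X) (Ad h Y) = Bf x₁ x₂ X Y := by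
  simp only [Bf_apply, P1_Ad hh, P2_Ad hh, Qf_Ad]

/-! ### The isotropy algebra and the invariant metrics -/

lemma smul_basePoint_eq_iff (a b : SU5) : a • basePoint = b • basePoint ↔ a⁻¹ * b ∈ Sp2S1 := by
  rw [basePoint, MulAction.Quotient.smul_coe, MulAction.Quotient.smul_coe, QuotientGroup.eq]
  simp

lemma exists_smul_basePoint (p : B13) : ∃ a : SU5, p = a • basePoint := by
  refine ⟨p.out, ?_⟩
  rw [basePoint, MulAction.Quotient.smul_coe, smul_eq_mul, mul_one]
  exact (QuotientGroup.out_eq' p).symm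

lemma Ad_smul (a : SU5) (t : ℝ) (X : su5) : Ad a (t • X) = t • Ad a X :=
  map_smul (AdL a) t X

lemma mem_isotropy_smul (a : SU5) (p : B13) (X : su5) :
    X ∈ isotropy (a • p) ↔ Ad a⁻¹ X ∈ isotropy p := by
  refine forall_congr' fun t => ?_
  rw [← Ad_smul, exp_Ad, inv_inv, mul_smul, mul_smul, inv_smul_eq_iff]

section
attribute [local instance] Matrix.linftyOpNormedRing Matrix.linftyOpNormedAlgebra

lemma hasDerivAt_exp_entry (X : su5) (i j : Five) :
    HasDerivAt (fun t : ℝ => (expSU (t • X)).1 i j) (X.1 i j) 0 := by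
  have h := hasDerivAt_exp_smul_const (𝕂 := ℝ) X.1 0
  rw [zero_smul, NormedSpace.exp_zero, one_mul] at h
  exact hasDerivAt_pi.1 (hasDerivAt_pi.1 h i) j

/-- Differentiating `E J Eᵀ = μ J` shows that `B J + J Bᵀ` is a multiple of `J`. After
multiplication by `J` it is scalar, so its trace free part, extracted by `Λ`, vanishes; up to a
factor this is `proj1 B`. No differentiability of `μ` is needed. -/
lemma proj1_eq_zero_of_hasDerivAt {E : ℝ → Matrix Four Four ℂ} {B : Matrix Four Four ℂ}
    (h0 : E 0 = 1) (hE : ∀ i j, HasDerivAt (fun t => E t i j) (B i j) 0)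
    (hJ : ∀ t, ∃ μ : ℂ, E t * J4 * (E t)ᵀ = μ • J4) : proj1 B = 0 := by
  have h1 : HasDerivAt E B 0 := hasDerivAt_pi.2 fun i => hasDerivAt_pi.2 fun j => hE i j
  have h2 : HasDerivAt (fun t => (E t)ᵀ) Bᵀ 0 :=
    hasDerivAt_pi.2 fun i => hasDerivAt_pi.2 fun j => hE j i
  have h3 := ((h1.mul_const J4).mul h2).mul_const J4
  rw [h0] at h3
  set C' := (B * J4 * (1 : Matrix Four Four ℂ)ᵀ + 1 * J4 * Bᵀ) * J4 with hC'
  let Λ : Matrix Four Four ℂ →ₗ[ℝ] Matrix Four Four ℂ :=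
    LinearMap.id - ((4⁻¹ : ℝ) • (Matrix.traceLinearMap Four ℝ ℂ)).smulRight
      (1 : Matrix Four Four ℂ)
  have hΛ : ∀ M, Λ M = M - (M.trace / 4) • 1 := by
    intro M
    change M - ((4⁻¹ : ℝ) • M.trace) • (1 : Matrix Four Four ℂ) = _
    rw [Complex.real_smul, div_eq_inv_mul]
    norm_num
  have h4 := (LinearMap.toContinuousLinearMap Λ).hasFDerivAt.comp_hasDerivAt (0 : ℝ) h3
  have h5 : (LinearMap.toContinuousLinearMap Λ) ∘ (fun t => E t * J4 * (E t)ᵀ * J4) =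
      fun _ => 0 := by
    funext t
    obtain ⟨μ, hμ⟩ := hJ t
    change Λ (E t * J4 * (E t)ᵀ * J4) = 0
    rw [hΛ, hμ, Matrix.smul_mul, J4_mul_J4, Matrix.trace_smul, Matrix.trace_neg,
      Matrix.trace_one]
    simp only [Fintype.card_sum, Fintype.card_fin, smul_eq_mul]
    module
  have h6 : Λ C' = 0 := h4.unique (by
    change HasDerivAt ((LinearMap.toContinuousLinearMap Λ) ∘ (fun t => E t * J4 * (E t)ᵀ * J4)) 0 0
    rw [h5]
    exact hasDerivAt_const _ _)
  have h7 : C' = -(B - J4 * Bᵀ * J4) := by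
    rw [hC', Matrix.transpose_one, Matrix.mul_one, Matrix.one_mul, Matrix.add_mul,
      Matrix.mul_assoc B, J4_mul_J4]
    simp [neg_add_eq_sub]
  have h8 : C'.trace = -(2 * B.trace) := by
    rw [h7, Matrix.trace_neg, Matrix.trace_sub, trace_J4_conj]
    ring
  rw [hΛ, h8, h7] at h6
  rw [proj1_apply]
  calc _ = (-(1 / 2) : ℂ) • (-(B - J4 * Bᵀ * J4) - (-(2 * B.trace) / 4) • (1 : Matrix Four Four ℂ)) := by
        module
    _ = 0 := by rw [h6, smul_zero]

/-- The block diagonal embedding. -/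
def blockHom : Matrix Four Four ℂ × Matrix Unit Unit ℂ →+* Matrix Five Five ℂ where
  toFun p := Matrix.fromBlocks p.1 0 0 p.2
  map_one' := by simp
  map_mul' p q := by simp [Matrix.fromBlocks_multiply]
  map_zero' := by simp
  map_add' p q := by simp [Matrix.fromBlocks_add]

lemma map_exp_prod {R S T : Type*} [NormedRing R] [NormedAlgebra ℚ R] [CompleteSpace R]
    [NormedRing S] [NormedAlgebra ℚ S] [CompleteSpace S] [NormedRing T] [NormedAlgebra ℚ T]
    (f : R × S →+* T) (hf : Continuous f) (x : R) (y : S) :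
    f (NormedSpace.exp x, NormedSpace.exp y) = NormedSpace.exp (f (x, y)) := by
  rw [← NormedSpace.map_exp f hf (x, y)]
  congr 1
  exact Prod.ext (Prod.fst_exp (x, y)).symm (Prod.snd_exp (x, y)).symm

lemma exp_fromBlocks (B : Matrix Four Four ℂ) (c : Matrix Unit Unit ℂ) :
    NormedSpace.exp (Matrix.fromBlocks B 0 0 c) =
      Matrix.fromBlocks (NormedSpace.exp B) 0 0 (NormedSpace.exp c) := by
  have h : Continuous blockHom :=
    Continuous.matrix_fromBlocks continuous_fst continuous_const continuous_const continuous_snd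
  exact (map_exp_prod blockHom h B c).symm

lemma exp_scalar_add (s : ℂ) (B : Matrix Four Four ℂ) :
    NormedSpace.exp (s • (1 : Matrix Four Four ℂ) + B) = Complex.exp s • NormedSpace.exp B := by
  rw [Matrix.exp_add_of_commute _ _ ((Commute.one_left B).smul_left s),
    ← Algebra.algebraMap_eq_smul_one]
  have : algebraMap ℂ (Matrix Four Four ℂ) (NormedSpace.exp s) =
      NormedSpace.exp (algebraMap ℂ (Matrix Four Four ℂ) s) := NormedSpace.algebraMap_exp_comm s
  rw [← this, Algebra.algebraMap_eq_smul_one, Matrix.smul_mul, Matrix.one_mul,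
    Complex.exp_eq_exp_ℂ]

end

/-- Such an `X` is block diagonal, and its upper block is an imaginary scalar `s` plus an element
`B0` of `sp(2)`. The exponential is `exp s` times `exp B0`, which is unitary and symplectic; the
last entry is then fixed by the determinant. -/
lemma expSU_mem_of_P {X : su5} (h1 : P1 X = 0) (h2 : P2 X = 0) : expSU X ∈ Sp2S1 := by
  set B := blk X with hB
  have e1 : proj1 B = 0 := by
    have := congrArg (fun Z : su5 => Z.1.toBlocks₁₁) h1
    exact this
  have e2 : X.1.toBlocks₁₂ = 0 := by
    have := congrArg (fun Z : su5 => Z.1.toBlocks₁₂) h2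
    exact this
  have e3 : X.1.toBlocks₂₁ = 0 := by
    have := congrArg (fun Z : su5 => Z.1.toBlocks₂₁) h2
    exact this
  have hX : X.1 = Matrix.fromBlocks B 0 0 X.1.toBlocks₂₂ := by
    conv_lhs => rw [← Matrix.fromBlocks_toBlocks X.1, e2, e3]
  set s := B.trace / 4 with hs
  set B0 := B - s • (1 : Matrix Four Four ℂ) with hB0
  have hBs : B = s • 1 + B0 := by rw [hB0]; abel
  have hBH : Bᴴ = -B := blk_conjTranspose X
  have hsH : star s = -s := by
    rw [hs, star_div₀, ← Matrix.trace_conjTranspose, hBH, Matrix.trace_neg, star_ofNat, neg_div]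
  have hB0H : B0ᴴ = -B0 := by
    rw [hB0, Matrix.conjTranspose_sub, hBH, Matrix.conjTranspose_smul, hsH,
      Matrix.conjTranspose_one]
    module
  have hB0J : B0ᵀ = J4 * B0 * J4 := by
    have f1 : J4 * Bᵀ * J4 = B - (2 * s) • 1 := by
      rw [proj1_apply, ← hs] at e1
      calc _ = B - (2 * s) • (1 : Matrix Four Four ℂ) -
            (2 : ℂ) • ((1 / 2 : ℂ) • (B - J4 * Bᵀ * J4) - s • 1) := by module
        _ = _ := by rw [e1, smul_zero, sub_zero]
    have f2 : J4 * B0ᵀ * J4 = B0 := by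
      rw [hB0, Matrix.transpose_sub, Matrix.transpose_smul, Matrix.transpose_one, Matrix.mul_sub,
        Matrix.sub_mul, f1, Matrix.mul_smul, Matrix.smul_mul, Matrix.mul_one, J4_mul_J4]
      module
    calc B0ᵀ = (J4 * J4) * B0ᵀ * (J4 * J4) := by rw [J4_mul_J4]; simp
      _ = J4 * (J4 * B0ᵀ * J4) * J4 := by simp only [Matrix.mul_assoc]
      _ = _ := by rw [f2]
  have hU : NormedSpace.exp B0 ∈ Matrix.unitaryGroup Four ℂ := by
    rw [Matrix.mem_unitaryGroup_iff, Matrix.star_eq_conjTranspose, ← Matrix.exp_conjTranspose,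
      hB0H, ← Matrix.exp_add_of_commute _ _ (Commute.refl B0).neg_right, add_neg_cancel,
      NormedSpace.exp_zero]
  have hS : NormedSpace.exp B0 ∈ Matrix.symplecticGroup (Fin 2) ℂ := by
    rw [SymplecticGroup.mem_iff, ← Matrix.exp_transpose, hB0J]
    have hJ : J4⁻¹ = -J4 := Matrix.inv_eq_right_inv (by rw [Matrix.mul_neg, J4_mul_J4, neg_neg])
    have hJu : IsUnit J4 := ⟨⟨J4, -J4, by rw [Matrix.mul_neg, J4_mul_J4, neg_neg],
      by rw [Matrix.neg_mul, J4_mul_J4, neg_neg]⟩, rfl⟩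
    -- Since `J⁻¹ = -J`, the transpose of `B0` is conjugate to `-B0`, so `exp` turns the
    -- infinitesimal symplectic condition into the group condition.
    have f3 : J4 * B0 * J4 = J4⁻¹ * (-B0) * J4 := by rw [hJ]; simp
    rw [f3, Matrix.exp_conj' _ _ hJu, hJ]
    have f4 : NormedSpace.exp B0 * NormedSpace.exp (-B0) = 1 := by
      rw [← Matrix.exp_add_of_commute _ _ (Commute.refl B0).neg_right, add_neg_cancel,
        NormedSpace.exp_zero]
    calc _ = -(NormedSpace.exp B0 * (J4 * J4) * NormedSpace.exp (-B0) * J4) := by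
          simp only [Matrix.mul_assoc, Matrix.neg_mul, Matrix.mul_neg]
      _ = NormedSpace.exp B0 * NormedSpace.exp (-B0) * J4 := by rw [J4_mul_J4]; simp
      _ = J4 := by rw [f4, Matrix.one_mul]
  have hsI : s = s.im * Complex.I := by
    have := congrArg Complex.re hsH
    rw [Complex.star_def, Complex.conj_re, Complex.neg_re, self_eq_neg] at this
    apply Complex.ext <;> simp [this]
  have hexp : (expSU X).1 = Matrix.fromBlocks (Complex.exp s • NormedSpace.exp B0) 0 0
      (NormedSpace.exp X.1.toBlocks₂₂) := by
    change NormedSpace.exp X.1 = _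
    conv_lhs => rw [hX, exp_fromBlocks, hBs, exp_scalar_add]
  have hdet := (Matrix.mem_specialUnitaryGroup_iff.1 (expSU X).2).2
  rw [hexp, Matrix.det_fromBlocks_zero₂₁] at hdet
  refine ⟨(⟨⟨_, hU⟩, hS⟩, Circle.exp s.im), Subtype.ext ?_⟩
  have hi : (iota (⟨⟨_, hU⟩, hS⟩, Circle.exp s.im)).1 =
      Complex.exp s • NormedSpace.exp B0 := by
    have : Complex.exp s = (Circle.exp s.im : ℂ) := by rw [Circle.coe_exp, ← hsI]
    rw [this]
    rfl
  change Matrix.fromBlocks _ 0 0 _ = _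
  rw [hexp, hi, Matrix.fromBlocks_inj]
  refine ⟨rfl, rfl, rfl, ?_⟩
  rw [← eq_inv_of_mul_eq_one_right hdet]
  ext i j
  simp

/-- The isotropy algebra of the base point is `sp(2) ⊕ ℝ`, the common kernel of the two projections.
One direction differentiates the one-parameter group at zero, the other exponentiates. -/
lemma mem_isotropy_basePoint (X : su5) : X ∈ isotropy basePoint ↔ P1 X = 0 ∧ P2 X = 0 := by
  have hiff : X ∈ isotropy basePoint ↔ ∀ t : ℝ, expSU (t • X) ∈ Sp2S1 := by
    refine forall_congr' fun t => ?_
    have := smul_basePoint_eq_iff 1 (expSU (t • X))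
    rw [one_smul, inv_one, one_mul] at this
    rw [← this, eq_comm]
  rw [hiff]
  constructor
  · intro h
    have hb : ∀ t : ℝ, _ := fun t => exists_of_mem_Sp2S1 (h t)
    have he0 : (expSU ((0 : ℝ) • X)).1 = 1 := by simp [expSU]
    constructor
    · ext1
      rw [P1_val, proj1_eq_zero_of_hasDerivAt (E := fun t => (expSU (t • X)).1.toBlocks₁₁)]
      · simp
      · rw [he0]; ext i j; simp [Matrix.toBlocks₁₁, Matrix.one_apply]
      · exact fun i j => hasDerivAt_exp_entry X _ _
      · intro t
        obtain ⟨B, c, μ, hB, -, -, -, hJ⟩ := hb t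
        exact ⟨μ, by rw [hB, Matrix.toBlocks_fromBlocks₁₁, hJ]⟩
    · have key : ∀ i j, (∀ t : ℝ, (expSU (t • X)).1 i j = 0) → X.1 i j = 0 := by
        intro i j h0
        refine (hasDerivAt_exp_entry X i j).unique ?_
        simp only [h0]
        exact hasDerivAt_const _ _
      ext1
      rw [P2_val]
      have e1 : X.1.toBlocks₁₂ = 0 := by
        ext i j
        refine key _ _ fun t => ?_
        obtain ⟨B, c, μ, hB, -⟩ := hb t
        rw [hB]; rfl
      have e2 : X.1.toBlocks₂₁ = 0 := by
        ext i j
        refine key _ _ fun t => ?_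
        obtain ⟨B, c, μ, hB, -⟩ := hb t
        rw [hB]; rfl
      rw [e1, e2]
      simp
  · rintro ⟨h1, h2⟩ t
    exact expSU_mem_of_P (by rw [map_smul, h1, smul_zero]) (by rw [map_smul, h2, smul_zero])

section
attribute [local instance] Matrix.linftyOpNormedRing Matrix.linftyOpNormedAlgebra

/-- A linear retraction of all matrices to `su(5)`. -/
lemma exists_retraction : ∃ π : Matrix Five Five ℂ →ₗ[ℝ] su5, ∀ X : su5, π X.1 = X := by
  obtain ⟨π, hπ⟩ := LinearMap.exists_leftInverse_of_injective su5.subtype (by simp)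
  exact ⟨π, fun X => LinearMap.congr_fun hπ X⟩

/-- Smoothness of `su5`-valued maps is expressed in the surrounding matrix algebra, and the bilinear
form is extended there through a retraction. -/
lemma contDiff_bilin (B : LinearMap.BilinForm ℝ su5) {E : Type*} [NormedAddCommGroup E]
    [NormedSpace ℝ E] {n : ℕ∞ω} {f h : E → su5} (hf : ContDiff ℝ n fun y => (f y).1)
    (hh : ContDiff ℝ n fun y => (h y).1) : ContDiff ℝ n fun y => B (f y) (h y) := by
  obtain ⟨π, hπ⟩ := exists_retraction
  let B' : Matrix Five Five ℂ →ₗ[ℝ] Matrix Five Five ℂ →ₗ[ℝ] ℝ := B.compl₁₂ π π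
  have h1 : (fun y => B (f y) (h y)) =
      fun y => B'.toContinuousBilinearMap (f y).1 (h y).1 := by
    funext y
    change _ = B (π (f y).1) (π (h y).1)
    rw [hπ, hπ]
  rw [h1]
  exact (B'.toContinuousBilinearMap.contDiff.comp hf).clm_apply hh

lemma contDiff_exp {𝔸 : Type*} [NormedRing 𝔸] [NormedAlgebra ℝ 𝔸] [CompleteSpace 𝔸] {n : ℕ∞ω} :
    ContDiff ℝ n (NormedSpace.exp : 𝔸 → 𝔸) :=
  contDiff_iff_contDiffAt.2 fun x => (NormedSpace.exp_analytic (𝕂 := ℝ) x).contDiffAt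

lemma contDiff_val_comp {E : Type*} [NormedAddCommGroup E] [NormedSpace ℝ E]
    [FiniteDimensional ℝ E] {n : ℕ∞ω} (L : E →ₗ[ℝ] su5) : ContDiff ℝ n fun y => (L y).1 :=
  (LinearMap.toContinuousLinearMap (su5.subtype ∘ₗ L)).contDiff

lemma contDiff_Ad_expSU {E : Type*} [NormedAddCommGroup E] [NormedSpace ℝ E]
    [FiniteDimensional ℝ E] {n : ℕ∞ω} (L : E →ₗ[ℝ] su5) (a : SU5) (X : su5) :
    ContDiff ℝ n fun y => (Ad (expSU (L y) * a)⁻¹ X).1 := by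
  have h1 : ∀ y, (Ad (expSU (L y) * a)⁻¹ X).1 = star a.1 * (NormedSpace.exp (-(L y).1) * X.1 *
      NormedSpace.exp (L y).1) * a.1 := by
    intro y
    have e1 : ((expSU (L y) * a)⁻¹).1 = star a.1 * star (expSU (L y)).1 := by
      change star ((expSU (L y)).1 * a.1) = _
      rw [star_mul]
    have e2 : star (expSU (L y)).1 = NormedSpace.exp (-(L y).1) := by
      rw [← (L y).2.1, Matrix.exp_conjTranspose]
      rfl
    rw [Ad_val, e1, star_mul, star_star, star_star, e2]
    simp only [Matrix.mul_assoc]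
    rfl
  simp only [h1]
  have hL : ContDiff ℝ n fun y => (L y).1 := contDiff_val_comp L
  exact (contDiff_const.mul (((contDiff_exp.comp hL.neg).mul contDiff_const).mul
    (contDiff_exp.comp hL))).mul contDiff_const

end

/-- The form of the invariant metric with parameters `x₁`, `x₂`. -/
def invForm (x₁ x₂ : ℝ) (p : B13) : LinearMap.BilinForm ℝ su5 :=
  (Bf x₁ x₂).compl₁₂ (AdL (Quotient.out p)⁻¹) (AdL (Quotient.out p)⁻¹)

/-- Two representatives of a point differ by an element of `Sp2S1`, so the choice made by
`Quotient.out` does not matter. -/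
lemma invForm_smul (x₁ x₂ : ℝ) (a : SU5) (X Y : su5) :
    invForm x₁ x₂ (a • basePoint) X Y = Bf x₁ x₂ (Ad a⁻¹ X) (Ad a⁻¹ Y) := by
  obtain ⟨b, hb⟩ : ∃ b : SU5, Quotient.out (a • basePoint) = b := ⟨_, rfl⟩
  change Bf x₁ x₂ (Ad (Quotient.out (a • basePoint))⁻¹ X)
    (Ad (Quotient.out (a • basePoint))⁻¹ Y) = _
  rw [hb]
  have h1 : b • basePoint = a • basePoint := by
    rw [← hb]
    conv_rhs => rw [← QuotientGroup.out_eq' (a • basePoint)]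
    rw [basePoint, MulAction.Quotient.smul_coe, smul_eq_mul, mul_one]
  have h2 := (smul_basePoint_eq_iff b a).1 h1
  have h3 : ∀ Z, Ad b⁻¹ Z = Ad (b⁻¹ * a) (Ad a⁻¹ Z) := fun Z => by
    rw [← Ad_mul, mul_assoc, mul_inv_cancel, mul_one]
  rw [h3, h3 Y, Bf_Ad h2]

/-- The invariant metric with parameters `x₁`, `x₂`. -/
def invMetric (x₁ x₂ : ℝ) (h₁ : 0 < x₁) (h₂ : 0 < x₂) : RiemMetric where
  form := invForm x₁ x₂
  symm p X Y := by
    obtain ⟨a, rfl⟩ := exists_smul_basePoint p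
    rw [invForm_smul, invForm_smul, Bf_comm]
  nonneg p X := by
    obtain ⟨a, rfl⟩ := exists_smul_basePoint p
    rw [invForm_smul]
    exact Bf_self_nonneg h₁ h₂ _
  null_iff p X := by
    obtain ⟨a, rfl⟩ := exists_smul_basePoint p
    rw [invForm_smul, Bf_self_eq_zero h₁ h₂, mem_isotropy_smul, mem_isotropy_basePoint]
  smooth p X Y n L := by
    obtain ⟨a, rfl⟩ := exists_smul_basePoint p
    simp only [← mul_smul, invForm_smul]
    exact contDiff_bilin _ (contDiff_Ad_expSU L a X) (contDiff_Ad_expSU L a Y)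

lemma invMetric_isInvariant (x₁ x₂ : ℝ) (h₁ : 0 < x₁) (h₂ : 0 < x₂) :
    (invMetric x₁ x₂ h₁ h₂).IsInvariant := by
  intro a p X Y
  obtain ⟨b, rfl⟩ := exists_smul_basePoint p
  change invForm x₁ x₂ _ _ _ = invForm x₁ x₂ _ _ _
  rw [← mul_smul, invForm_smul, invForm_smul, ← Ad_mul, ← Ad_mul]
  simp

/-- The difference `X - P1 X` lies in `sp(2)`, hence is orthogonal to `X`, and it is orthogonal to
the range of `P1`; so it is orthogonal to itself. -/
lemma P1_of_mem_p1 {X : su5} (h : X ∈ p1) : P1 X = X := by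
  obtain ⟨⟨B, hB⟩, h2⟩ := h
  have hblk : blk X = B := by rw [blk, hB, Matrix.toBlocks_fromBlocks₁₁]
  have htr : B.trace = 0 := by
    have := X.2.2
    rwa [hB, trace_fromBlocks, Matrix.trace_zero, add_zero] at this
  have hmem : X - P1 X ∈ sp2 := by
    refine ⟨B - proj1 B, ?_, ?_⟩
    · rw [Submodule.coe_sub, P1_val, hblk]
      conv_lhs => rw [hB]
      rw [fromBlocks_sub]; simp
    · have h3 : B - proj1 B = (1 / 2 : ℂ) • (B + J4 * Bᵀ * J4) := by
        rw [proj1_apply, htr]; module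
      rw [h3, Matrix.transpose_smul, Matrix.transpose_add, Matrix.transpose_mul,
        Matrix.transpose_mul, J4_transpose, Matrix.transpose_transpose, Matrix.smul_mul,
        Matrix.mul_smul, ← smul_add]
      have h4 : (B + J4 * Bᵀ * J4) * J4 + J4 * (Bᵀ + -J4 * (B * -J4)) = 0 := by
        simp only [Matrix.add_mul, Matrix.mul_add, Matrix.neg_mul, Matrix.mul_neg, neg_neg]
        rw [Matrix.mul_assoc (J4 * Bᵀ), ← Matrix.mul_assoc J4 J4, J4_mul_J4]
        simp
      rw [h4, smul_zero]
  have h5 : Qf X (X - P1 X) = 0 := h2 _ hmem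
  have h6 : Qf (P1 X) (X - P1 X) = 0 := by
    rw [Qf_P1, map_sub, P1_P1, sub_self, map_zero]
  refine (sub_eq_zero.1 (Qf_self_eq_zero ?_)).symm
  rw [map_sub Qf, LinearMap.sub_apply, h5, h6, sub_zero]

lemma P2_of_mem_p2 {X : su5} (h : X ∈ p2) : P2 X = X := by
  have hmem : X - P2 X ∈ su4R := by
    refine ⟨X.1.toBlocks₁₁, X.1.toBlocks₂₂, ?_⟩
    rw [Submodule.coe_sub, P2_val]
    conv_lhs => enter [1]; rw [← Matrix.fromBlocks_toBlocks X.1]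
    rw [fromBlocks_sub]
    simp
  have h5 : Qf X (X - P2 X) = 0 := h _ hmem
  have h6 : Qf (P2 X) (X - P2 X) = 0 := by
    rw [Qf_P2, map_sub, P2_P2, sub_self, map_zero]
  refine (sub_eq_zero.1 (Qf_self_eq_zero ?_)).symm
  rw [map_sub Qf, LinearMap.sub_apply, h5, h6, sub_zero]

lemma invMetric_isDiagonal (x₁ x₂ : ℝ) (h₁ : 0 < x₁) (h₂ : 0 < x₂) :
    (invMetric x₁ x₂ h₁ h₂).IsDiagonal x₁ x₂ := by
  intro X₁ hX₁ Y₁ hY₁ X₂ hX₂ Y₂ hY₂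
  have := invForm_smul x₁ x₂ 1 (X₁ + X₂) (Y₁ + Y₂)
  rw [one_smul, inv_one, Ad_one, Ad_one] at this
  change invForm x₁ x₂ _ _ _ = _
  have a1 := P1_of_mem_p1 hX₁
  have a2 := P2_of_mem_p2 hX₂
  have b1 := P1_of_mem_p1 hY₁
  have b2 := P2_of_mem_p2 hY₂
  rw [this, Bf_apply]
  simp only [map_add, a1, a2, b1, b2, P1_of_P2 a2, P1_of_P2 b2, P2_of_P1 a1, P2_of_P1 b1,
    add_zero, zero_add]
  rfl

/-! ### Curvature in coordinates at the origin -/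

section Coordinates

variable {V : Type*} [AddCommGroup V] [Module ℝ V]

/-- Second derivatives along lines determine the iterated directional derivatives. -/
lemma hasDerivAt_lineDeriv {f : V → ℝ} {c : V → ℝ}
    (hf : ∀ u v : V, ContDiff ℝ 2 fun y : ℝ × ℝ => f (y.1 • u + y.2 • v))
    (hc : ∀ X, deriv (deriv fun r : ℝ => f (r • X)) 0 = c X) (u v : V) :
    HasDerivAt (fun s : ℝ => lineDeriv ℝ f ((0 : V) + s • u) v) ((c (u + v) - c u - c v) / 2) 0 := by
  set h : ℝ × ℝ → ℝ := fun y => f (y.1 • u + y.2 • v) with hh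
  have hC : ContDiff ℝ 2 h := hf u v
  have hC1 : ContDiff ℝ 1 (fderiv ℝ h) := hC.fderiv_right (by norm_num)
  have hd : Differentiable ℝ h := hC.differentiable (by norm_num)
  have hd1 : Differentiable ℝ (fderiv ℝ h) := hC1.differentiable (by norm_num)
  set M := fderiv ℝ (fderiv ℝ h) 0 with hM
  have hsymm : M (1, 0) (0, 1) = M (0, 1) (1, 0) :=
    (hC.contDiffAt.isSymmSndFDerivAt (by simp)) (1, 0) (0, 1)
  have hline : ∀ ξ : ℝ × ℝ, ∀ r : ℝ, HasDerivAt (fun r : ℝ => h (r • ξ)) (fderiv ℝ h (r • ξ) ξ) r := by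
    intro ξ r
    have h1 : HasDerivAt (fun r : ℝ => r • ξ) ξ r := by
      simpa using (hasDerivAt_id r).smul_const ξ
    exact (hd (r • ξ)).hasFDerivAt.comp_hasDerivAt r h1
  have hline2 : ∀ ξ η : ℝ × ℝ, HasDerivAt (fun r : ℝ => fderiv ℝ h (r • ξ) η) (M ξ η) 0 := by
    intro ξ η
    have h1 : HasDerivAt (fun r : ℝ => r • ξ) ξ 0 := by
      simpa using (hasDerivAt_id (0 : ℝ)).smul_const ξ
    have h3 : HasFDerivAt (fderiv ℝ h) M ((0 : ℝ) • ξ) := by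
      rw [zero_smul]; exact (hd1 0).hasFDerivAt
    have h2 := h3.comp_hasDerivAt (0 : ℝ) h1
    exact (ContinuousLinearMap.apply ℝ ℝ η).hasFDerivAt.comp_hasDerivAt (0 : ℝ) h2
  -- The function `c` records the Hessian `M` on the diagonal. Evaluating at `(1, 0)`, `(0, 1)` and
  -- `(1, 1)` recovers the mixed entry by polarization, as `M` is symmetric.
  have hq : ∀ ξ : ℝ × ℝ, M ξ ξ = c (ξ.1 • u + ξ.2 • v) := by
    intro ξ
    have h1 : (fun r : ℝ => f (r • (ξ.1 • u + ξ.2 • v))) = fun r => h (r • ξ) := by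
      funext r
      simp [hh, smul_smul]
    rw [← hc, h1, funext fun r => (hline ξ r).deriv, (hline2 ξ ξ).deriv]
  have e1 := hq (1, 0)
  have e2 := hq (0, 1)
  have e3 := hq (1, 1)
  simp only [one_smul, zero_smul, add_zero, zero_add] at e1 e2 e3
  have e4 : M (1, 1) (1, 1) = M (1, 0) (1, 0) + M (1, 0) (0, 1) + (M (0, 1) (1, 0) +
      M (0, 1) (0, 1)) := by
    have : ((1, 1) : ℝ × ℝ) = (1, 0) + (0, 1) := by simp
    rw [this, map_add M, _root_.add_apply, map_add, map_add]
  have e5 : (c (u + v) - c u - c v) / 2 = M (1, 0) (0, 1) := by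
    rw [← e1, ← e2, ← e3, e4, hsymm]
    ring
  rw [e5]
  have h6 : (fun s : ℝ => lineDeriv ℝ f ((0 : V) + s • u) v) =
      fun s : ℝ => fderiv ℝ h (s • (1, 0)) (0, 1) := by
    funext s
    have h7 : HasDerivAt (fun t : ℝ => s • ((1, 0) : ℝ × ℝ) + t • (0, 1)) (0, 1) 0 := by
      simpa using ((hasDerivAt_id (0 : ℝ)).smul_const ((0, 1) : ℝ × ℝ)).const_add
        (s • ((1, 0) : ℝ × ℝ))
    have h8 : HasFDerivAt h (fderiv ℝ h (s • (1, 0)))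
        (s • ((1, 0) : ℝ × ℝ) + (0 : ℝ) • (0, 1)) := by
      rw [zero_smul, add_zero]; exact (hd _).hasFDerivAt
    have h9 := h8.comp_hasDerivAt (0 : ℝ) h7
    rw [← h9.deriv]
    simp [lineDeriv, hh, Function.comp_def]
  rw [h6]
  exact hline2 _ _

variable [Module.Finite ℝ V]

/-- Raising an index recovers a vector from its inner products with a basis. -/
lemma sum_gram_inv_smul {γ : V → V → V → ℝ} {x : V} (B : LinearMap.BilinForm ℝ V)
    (hγ : ∀ v w, γ x v w = B v w) (hs : ∀ v w, B v w = B w v) (hp : ∀ v, v ≠ 0 → 0 < B v v)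
    (y : V) :
    ∑ i, ∑ j, ((gram γ x)⁻¹ i j * B y (Module.finBasis ℝ V j)) • Module.finBasis ℝ V i = y := by
  set b := Module.finBasis ℝ V
  set G := gram γ x with hG
  have hGe : ∀ i j, G i j = B (b i) (b j) := fun i j => hγ _ _
  have hmul : ∀ z : Fin (Module.finrank ℝ V) → ℝ, ∀ i, (G *ᵥ z) i = B (b i) (∑ j, z j • b j) := by
    intro z i
    rw [map_sum, Matrix.mulVec, dotProduct]
    exact Finset.sum_congr rfl fun j _ => by rw [hGe, map_smul, smul_eq_mul, mul_comm]
  -- A kernel vector of the Gram matrix would be the coordinate vector of some `v` with `B v v = 0`.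
  have hdet : IsUnit G.det := by
    rw [isUnit_iff_ne_zero]
    intro h0
    obtain ⟨z, hz, hz0⟩ := Matrix.exists_mulVec_eq_zero_iff.2 h0
    have h1 : B (∑ j, z j • b j) (∑ j, z j • b j) = 0 := by
      have h2 : ∀ i, B (b i) (∑ j, z j • b j) = 0 := fun i => by rw [← hmul, hz0]; rfl
      conv_lhs => rw [map_sum B, LinearMap.sum_apply]
      exact Finset.sum_eq_zero fun i _ => by
        rw [map_smul, LinearMap.smul_apply, h2, smul_zero]
    have h3 : ∑ j, z j • b j = 0 := by
      by_contra h4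
      exact (hp _ h4).ne' h1
    exact hz (funext fun i => (Fintype.linearIndependent_iff.1 b.linearIndependent) z h3 i)
  have h5 : (fun j => B y (b j)) = G *ᵥ (b.repr y) := by
    funext j
    rw [hmul, b.sum_repr, hs]
  have h6 : ∀ i, ∑ j, G⁻¹ i j * B y (b j) = b.repr y i := by
    intro i
    have h7 : (G⁻¹ *ᵥ (fun j => B y (b j))) i = b.repr y i := by
      rw [h5, Matrix.mulVec_mulVec, Matrix.nonsing_inv_mul _ hdet, Matrix.one_mulVec]
    exact h7
  simp only [← Finset.sum_smul, h6]
  exact b.sum_repr y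

lemma christoffel_eq {γ : V → V → V → ℝ} {x : V} (B : LinearMap.BilinForm ℝ V)
    (hγ : ∀ v w, γ x v w = B v w) (hs : ∀ v w, B v w = B w v) (hp : ∀ v, v ≠ 0 → 0 < B v v)
    {u v y : V} (hy : ∀ z, christoffelFst γ x u v z = B y z) : christoffel γ x u v = y := by
  rw [christoffel]
  simp only [hy]
  exact sum_gram_inv_smul B hγ hs hp y

/-- The Ricci tensor in terms of a (tight) frame. -/
lemma ricci_eq_sum {γ : V → V → V → ℝ} {x : V} (B : LinearMap.BilinForm ℝ V)
    (hγ : ∀ v w, γ x v w = B v w) (hs : ∀ v w, B v w = B w v) (hp : ∀ v, v ≠ 0 → 0 < B v v)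
    {ι : Type*} [Fintype ι] (e : ι → V) (c : ι → ℝ) (he : ∀ y, y = ∑ k, (c k * B (e k) y) • e k)
    (v w : V) (R : LinearMap.BilinForm ℝ V) (hR : ∀ y z, riemann γ x y v w z = R y z) :
    ricci γ x v w = ∑ k, c k * R (e k) (e k) := by
  rw [ricci]
  simp only [hR]
  set b := Module.finBasis ℝ V
  have h1 : ∀ i j, R (b i) (b j) = ∑ k, c k * B (e k) (b j) * R (b i) (e k) := by
    intro i j
    conv_lhs => rw [he (b j), map_sum]
    exact Finset.sum_congr rfl fun k _ => by rw [map_smul, smul_eq_mul]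
  have h2 : ∀ k, R (e k) (e k) = ∑ i, ∑ j, (gram γ x)⁻¹ i j * B (e k) (b j) * R (b i) (e k) := by
    intro k
    have h3 := congrArg (fun y => R y (e k)) (sum_gram_inv_smul B hγ hs hp (e k))
    simp only [map_sum, LinearMap.sum_apply, map_smul, LinearMap.smul_apply, smul_eq_mul] at h3
    exact h3.symm
  simp only [h1, h2, Finset.mul_sum]
  conv_rhs => rw [Finset.sum_comm]
  refine Finset.sum_congr rfl fun i _ => ?_
  conv_rhs => rw [Finset.sum_comm]
  exact Finset.sum_congr rfl fun j _ => Finset.sum_congr rfl fun k _ => by ring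

end Coordinates

/-! ### The metric in exponential coordinates -/

/-- The two-jet at zero of a solution of `G + r G' = v - r A G`. -/
lemma jet_of_ode {E : Type*} [NormedAddCommGroup E] [NormedSpace ℝ E] {G : ℝ → E} {v : E}
    (A : E →L[ℝ] E) (hG : ContDiff ℝ ∞ G)
    (h : ∀ r, G r + r • deriv G r = v - r • A (G r)) :
    G 0 = v ∧ deriv G 0 = -((1 / 2 : ℝ) • A v) ∧
      deriv (deriv G) 0 = (1 / 3 : ℝ) • A (A v) := by
  have d0 : ∀ r, HasDerivAt G (deriv G r) r := fun r =>
    (hG.differentiable (by simp) r).hasDerivAt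
  have hG1 : ContDiff ℝ ∞ (deriv G) := hG.iterate_deriv 1
  have d1 : ∀ r, HasDerivAt (deriv G) (deriv (deriv G) r) r := fun r =>
    (hG1.differentiable (by simp) r).hasDerivAt
  have hG2 : ContDiff ℝ ∞ (deriv (deriv G)) := hG1.iterate_deriv 1
  have d2 : ∀ r, HasDerivAt (deriv (deriv G)) (deriv (deriv (deriv G)) r) r := fun r =>
    (hG2.differentiable (by simp) r).hasDerivAt
  have h0 : G 0 = v := by simpa using h 0
  have hA : ∀ {g : ℝ → E} {g' : E} {r : ℝ}, HasDerivAt g g' r →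
      HasDerivAt (fun r => A (g r)) (A g') r := fun hg => A.hasFDerivAt.comp_hasDerivAt _ hg
  -- The equation differentiated once. At `r = 0` it reads `2 G' = -A v`; a second differentiation
  -- gives `3 G'' = -2 A G'`.
  have s1 : ∀ r, (2 : ℝ) • deriv G r + r • deriv (deriv G) r =
      -A (G r) - r • A (deriv G r) := by
    intro r
    have l1 := (d0 r).fun_add ((hasDerivAt_id' r).fun_smul (d1 r))
    have l2 := ((hasDerivAt_id' r).fun_smul (hA (d0 r))).const_sub v
    simp only [h] at l1
    have := l1.unique l2
    calc _ = deriv G r + (r • deriv (deriv G) r + (1 : ℝ) • deriv G r) := by module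
      _ = _ := by rw [this]; module
  have h1 : deriv G 0 = -((1 / 2 : ℝ) • A v) := by
    have := s1 0
    rw [h0] at this
    simp only [zero_smul, add_zero, sub_zero] at this
    calc deriv G 0 = (1 / 2 : ℝ) • ((2 : ℝ) • deriv G 0) := by module
      _ = _ := by rw [this, smul_neg]
  refine ⟨h0, h1, ?_⟩
  have l1 := ((d1 0).fun_const_smul (2 : ℝ)).fun_add ((hasDerivAt_id' (0 : ℝ)).fun_smul (d2 0))
  have l2 := (hA (d0 0)).fun_neg.fun_sub ((hasDerivAt_id' (0 : ℝ)).fun_smul (hA (d1 0)))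
  simp only [s1] at l1
  have := l1.unique l2
  rw [h1] at this
  calc deriv (deriv G) 0 = (1 / 3 : ℝ) • ((2 : ℝ) • deriv (deriv G) 0 +
        ((0 : ℝ) • deriv (deriv (deriv G)) 0 + (1 : ℝ) • deriv (deriv G) 0)) := by module
    _ = _ := by
      rw [this, map_neg, map_smul]
      module

/-! ### The derivative of the exponential map. -/

section Algebra

variable {𝔸 : Type*} [NormedRing 𝔸] [NormedAlgebra ℝ 𝔸]

/-- The commutator with a fixed element. -/
def adL (X : 𝔸) : 𝔸 →L[ℝ] 𝔸 :=
  ContinuousLinearMap.mul ℝ 𝔸 X - (ContinuousLinearMap.mul ℝ 𝔸).flip X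

lemma adL_apply (X Y : 𝔸) : adL X Y = X * Y - Y * X := rfl

variable [CompleteSpace 𝔸]

/-- The derivative of the exponential map. -/
def dexp (X v : 𝔸) : 𝔸 := fderiv ℝ (NormedSpace.exp : 𝔸 → 𝔸) X v

lemma hasDerivAt_exp_line (X v : 𝔸) :
    HasDerivAt (fun t : ℝ => NormedSpace.exp (X + t • v)) (dexp X v) 0 := by
  have h1 : HasDerivAt (fun t : ℝ => X + t • v) v 0 := by
    simpa using ((hasDerivAt_id' (0 : ℝ)).smul_const v).const_add X
  have h2 : HasFDerivAt (NormedSpace.exp : 𝔸 → 𝔸)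
      (fderiv ℝ NormedSpace.exp X) (X + (0 : ℝ) • v) := by
    rw [zero_smul, add_zero]
    exact ((contDiff_exp (n := 1)).differentiable (by norm_num) X).hasFDerivAt
  exact h2.comp_hasDerivAt (0 : ℝ) h1

lemma exp_add_of_commute' {X Y : 𝔸} (h : Commute X Y) :
    NormedSpace.exp (X + Y) = NormedSpace.exp X * NormedSpace.exp Y := by
  have : NormedAlgebra ℚ 𝔸 := NormedAlgebra.restrictScalars ℚ ℝ 𝔸
  exact NormedSpace.exp_add_of_commute h

lemma exp_neg_mul_exp (X : 𝔸) : NormedSpace.exp (-X) * NormedSpace.exp X = 1 := by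
  rw [← exp_add_of_commute' (Commute.refl X).neg_left, neg_add_cancel, NormedSpace.exp_zero]

lemma contDiff_dexp {E : Type*} [NormedAddCommGroup E] [NormedSpace ℝ E] {n : ℕ∞ω}
    {f : E → 𝔸} (hf : ContDiff ℝ n f) (v : 𝔸) : ContDiff ℝ n fun y => dexp (f y) v := by
  have h1 : ContDiff ℝ n (fderiv ℝ (NormedSpace.exp : 𝔸 → 𝔸)) :=
    (contDiff_exp (n := n + 1)).fderiv_right le_rfl
  exact (h1.comp hf).clm_apply contDiff_const

lemma dexp_zero (v : 𝔸) : dexp 0 v = v := by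
  rw [dexp, (hasFDerivAt_exp_zero (𝕂 := ℝ) (𝔸 := 𝔸)).fderiv]
  rfl

lemma hasDerivAt_exp_smul_line (X v : 𝔸) (r : ℝ) :
    HasDerivAt (fun t : ℝ => NormedSpace.exp (r • (X + t • v))) (r • dexp (r • X) v) 0 := by
  have := hasDerivAt_exp_line (r • X) (r • v)
  rw [dexp, map_smul] at this
  change HasDerivAt _ (r • dexp (r • X) v) 0 at this
  convert this using 3 with t
  rw [smul_add, smul_comm]

/-- This differentiates `exp ((r + s) Y) = exp (r Y) exp (s Y)` with respect to `Y`. The factors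
`r`, `s` and `r + s` remain, so that no division is needed at zero. -/
lemma dexp_add (X v : 𝔸) (r s : ℝ) :
    (r + s) • dexp ((r + s) • X) v = r • dexp (r • X) v * NormedSpace.exp (s • X) +
      NormedSpace.exp (r • X) * s • dexp (s • X) v := by
  have h1 := (hasDerivAt_exp_smul_line X v r).fun_mul (hasDerivAt_exp_smul_line X v s)
  have h2 := hasDerivAt_exp_smul_line X v (r + s)
  have h3 : (fun t : ℝ => NormedSpace.exp ((r + s) • (X + t • v))) =
      fun t : ℝ => NormedSpace.exp (r • (X + t • v)) * NormedSpace.exp (s • (X + t • v)) := by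
    funext t
    rw [add_smul, exp_add_of_commute' (((Commute.refl _).smul_left r).smul_right s)]
  rw [h3] at h2
  have := h2.unique h1
  simpa using this

/-- The addition formula `dexp_add` reduces the derivative at any `r` to the derivative at `s = 0`,
where `dexp 0` is the identity. -/
lemma hasDerivAt_smul_dexp (X v : 𝔸) (r : ℝ) :
    HasDerivAt (fun r : ℝ => r • dexp (r • X) v)
      (r • dexp (r • X) v * X + NormedSpace.exp (r • X) * v) r := by
  have hs : ContDiff ℝ 1 fun r : ℝ => dexp (r • X) v :=
    contDiff_dexp (contDiff_id.smul contDiff_const) v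
  have h0 : HasDerivAt (fun s : ℝ => s • dexp (s • X) v) v 0 := by
    have := (hasDerivAt_id' (0 : ℝ)).fun_smul (hs.differentiable (by norm_num) 0).hasDerivAt
    simpa [dexp_zero] using this
  have h1 := hasDerivAt_exp_smul_const (𝕂 := ℝ) X 0
  rw [zero_smul, NormedSpace.exp_zero, one_mul] at h1
  have h2 := (h1.const_mul (r • dexp (r • X) v)).fun_add
    (h0.const_mul (NormedSpace.exp (r • X)))
  simp only [← dexp_add] at h2
  have h4 := HasDerivAt.comp_sub_const (f := fun s : ℝ => (r + s) • dexp ((r + s) • X) v) r r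
    (by rwa [sub_self])
  simpa using h4

/-- For `G r = exp (-r X) dexp (r X) v` this is the equation `(r G)' = v - r [X, G]` required by
`jet_of_ode`, which yields the two-jet without the power series of `exp`. -/
lemma hasDerivAt_leftLog (X v : 𝔸) (r : ℝ) :
    HasDerivAt (fun r : ℝ => r • (NormedSpace.exp (-(r • X)) * dexp (r • X) v))
      (v - r • adL X (NormedSpace.exp (-(r • X)) * dexp (r • X) v)) r := by
  have h1 : HasDerivAt (fun r : ℝ => NormedSpace.exp (-(r • X)))
      (-X * NormedSpace.exp (-(r • X))) r := by
    have := hasDerivAt_exp_smul_const' (𝕂 := ℝ) (-X) r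
    simpa only [smul_neg] using this
  have h2 := h1.fun_mul (hasDerivAt_smul_dexp X v r)
  have h3 : NormedSpace.exp (-(r • X)) * NormedSpace.exp (r • X) = 1 := exp_neg_mul_exp _
  simp only [mul_smul_comm] at h2
  convert h2 using 1
  rw [mul_add, ← mul_assoc _ _ v, h3, adL_apply]
  simp only [smul_sub, mul_smul_comm, smul_mul_assoc, neg_mul, mul_assoc, one_mul]
  simp only [smul_neg]
  abel

/-- The two-jet along lines of the left logarithmic derivative of the exponential map. -/
lemma jet_leftLog (X v : 𝔸) :
    ∃ G : ℝ → 𝔸, (∀ r, G r = NormedSpace.exp (-(r • X)) * dexp (r • X) v) ∧ ContDiff ℝ ∞ G ∧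
      G 0 = v ∧ deriv G 0 = -((1 / 2 : ℝ) • (X * v - v * X)) ∧
      deriv (deriv G) 0 = (1 / 3 : ℝ) • (X * (X * v - v * X) - (X * v - v * X) * X) := by
  set G : ℝ → 𝔸 := fun r => NormedSpace.exp (-(r • X)) * dexp (r • X) v with hG
  have hX : ContDiff ℝ ∞ fun r : ℝ => r • X := contDiff_id.smul contDiff_const
  have hs : ContDiff ℝ ∞ G := (contDiff_exp.comp hX.neg).mul (contDiff_dexp hX v)
  refine ⟨G, fun r => rfl, hs, jet_of_ode (adL X) hs fun r => ?_⟩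
  have h1 := (hasDerivAt_id' r).fun_smul (hs.differentiable (by simp) r).hasDerivAt
  rw [hG, (hasDerivAt_leftLog X v r).unique h1, add_comm, one_smul]

end Algebra

lemma deriv_bilin_comp {E : Type*} [NormedAddCommGroup E] [NormedSpace ℝ E]
    (B : E →L[ℝ] E →L[ℝ] ℝ) {G K : ℝ → E} (sG : ContDiff ℝ ∞ G) (sK : ContDiff ℝ ∞ K) :
    HasDerivAt (fun r => B (G r) (K r)) (B (deriv G 0) (K 0) + B (G 0) (deriv K 0)) 0 ∧
    deriv (deriv fun r => B (G r) (K r)) 0 =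
      B (deriv (deriv G) 0) (K 0) + B (deriv G 0) (deriv K 0) +
        (B (deriv G 0) (deriv K 0) + B (G 0) (deriv (deriv K) 0)) := by
  have hd : ∀ {g k : ℝ → E} {g' k' : E} {r : ℝ},
      HasDerivAt g g' r → HasDerivAt k k' r →
      HasDerivAt (fun r => B (g r) (k r)) (B g' (k r) + B (g r) k') r := by
    intro g k g' k' r hg hk
    exact (B.hasFDerivAt.comp_hasDerivAt r hg).clm_apply hk
  have d0 : ∀ r, HasDerivAt G (deriv G r) r := fun r =>
    (sG.differentiable (by simp) r).hasDerivAt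
  have sG1 : ContDiff ℝ ∞ (deriv G) := sG.iterate_deriv 1
  have d1 : ∀ r, HasDerivAt (deriv G) (deriv (deriv G) r) r := fun r =>
    (sG1.differentiable (by simp) r).hasDerivAt
  have c0 : ∀ r, HasDerivAt K (deriv K r) r := fun r =>
    (sK.differentiable (by simp) r).hasDerivAt
  have sK1 : ContDiff ℝ ∞ (deriv K) := sK.iterate_deriv 1
  have c1 : ∀ r, HasDerivAt (deriv K) (deriv (deriv K) r) r := fun r =>
    (sK1.differentiable (by simp) r).hasDerivAt
  refine ⟨hd (d0 0) (c0 0), ?_⟩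
  have h1 : (deriv fun r => B (G r) (K r)) =
      fun r => B (deriv G r) (K r) + B (G r) (deriv K r) :=
    funext fun r => (hd (d0 r) (c0 r)).deriv
  rw [h1, ((hd (d1 0) (c0 0)).fun_add (hd (d0 0) (c1 0))).deriv]

section
attribute [local instance] Matrix.linftyOpNormedRing Matrix.linftyOpNormedAlgebra

lemma logDerivExp_val (X v : su5) :
    (logDerivExp X v).1 = dexp X.1 v.1 * NormedSpace.exp (-X.1) := by
  ext i j
  have h := (hasDerivAt_exp_line X.1 v.1).mul_const (NormedSpace.exp (-X.1))
  exact (hasDerivAt_pi.1 (hasDerivAt_pi.1 h i) j).deriv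

/-- The left logarithmic derivative of the exponential map. -/
def leftLog (X v : su5) : su5 := Ad (expSU X)⁻¹ (logDerivExp X v)

lemma leftLog_val (X v : su5) :
    (leftLog X v).1 = NormedSpace.exp (-X.1) * dexp X.1 v.1 := by
  have e2 : star (expSU X).1 = NormedSpace.exp (-X.1) := by
    rw [← X.2.1, Matrix.exp_conjTranspose]
    rfl
  rw [leftLog, Ad_val, logDerivExp_val]
  change star (expSU X).1 * _ * star (star (expSU X).1) = _
  rw [star_star, e2]
  change _ * _ * NormedSpace.exp X.1 = _
  have h3 : NormedSpace.exp (-X.1) * NormedSpace.exp X.1 = 1 := exp_neg_mul_exp X.1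
  rw [Matrix.mul_assoc, Matrix.mul_assoc, h3, Matrix.mul_one]

lemma contDiff_leftLog {E : Type*} [NormedAddCommGroup E] [NormedSpace ℝ E]
    [FiniteDimensional ℝ E] {n : ℕ∞ω} (L : E →ₗ[ℝ] su5) (v : su5) :
    ContDiff ℝ n fun y => (leftLog (L y) v).1 := by
  simp only [leftLog_val]
  exact (contDiff_exp.comp (contDiff_val_comp L).neg).mul (contDiff_dexp (contDiff_val_comp L) _)

/-- The first two derivatives along lines of a bilinear form in exponential coordinates. -/
lemma deriv_bilin_leftLog (B : LinearMap.BilinForm ℝ su5) (X v w : su5) :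
    HasDerivAt (fun r : ℝ => B (leftLog (r • X) v) (leftLog (r • X) w))
      (-(1 / 2) * (B (br X v) w + B v (br X w))) 0 ∧
    deriv (deriv fun r : ℝ => B (leftLog (r • X) v) (leftLog (r • X) w)) 0 =
      1 / 3 * (B (br X (br X v)) w + B v (br X (br X w))) + 1 / 2 * B (br X v) (br X w) := by
  obtain ⟨π, hπ⟩ := exists_retraction
  let B' : Matrix Five Five ℂ →L[ℝ] Matrix Five Five ℂ →L[ℝ] ℝ :=
    (B.compl₁₂ π π : Matrix Five Five ℂ →ₗ[ℝ] _).toContinuousBilinearMap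
  have hB' : ∀ M N, B' M N = B (π M) (π N) := fun _ _ => rfl
  obtain ⟨G, hG, sG, g0, g1, g2⟩ := jet_leftLog X.1 v.1
  obtain ⟨K, hK, sK, k0, k1, k2⟩ := jet_leftLog X.1 w.1
  have e : (fun r : ℝ => B (leftLog (r • X) v) (leftLog (r • X) w)) = fun r => B' (G r) (K r) := by
    funext r
    rw [hB', hG, hK, ← hπ (leftLog (r • X) v), ← hπ (leftLog (r • X) w), leftLog_val, leftLog_val]
    rfl
  obtain ⟨hd1, hd2⟩ := deriv_bilin_comp B' sG sK
  have G0 : π (G 0) = v := by rw [g0, hπ]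
  have K0 : π (K 0) = w := by rw [k0, hπ]
  have G1 : π (deriv G 0) = -((1 / 2 : ℝ) • br X v) := by
    refine (congrArg π g1).trans ?_
    rw [← br_val, map_neg, map_smul, hπ]
  have K1 : π (deriv K 0) = -((1 / 2 : ℝ) • br X w) := by
    refine (congrArg π k1).trans ?_
    rw [← br_val, map_neg, map_smul, hπ]
  have G2 : π (deriv (deriv G) 0) = (1 / 3 : ℝ) • br X (br X v) := by
    refine (congrArg π g2).trans ?_
    rw [← br_val X v, ← br_val X (br X v), map_smul, hπ]
  have K2 : π (deriv (deriv K) 0) = (1 / 3 : ℝ) • br X (br X w) := by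
    refine (congrArg π k2).trans ?_
    rw [← br_val X w, ← br_val X (br X w), map_smul, hπ]
  rw [e]
  refine ⟨?_, ?_⟩
  · refine hd1.congr_deriv ?_
    change B (π (deriv G 0)) (π (K 0)) + B (π (G 0)) (π (deriv K 0)) = _
    rw [G0, K0, G1, K1]
    simp only [map_neg, map_smul, LinearMap.neg_apply, LinearMap.smul_apply, smul_eq_mul]
    ring
  · refine hd2.trans ?_
    change B (π (deriv (deriv G) 0)) (π (K 0)) + B (π (deriv G 0)) (π (deriv K 0)) +
      (B (π (deriv G 0)) (π (deriv K 0)) + B (π (G 0)) (π (deriv (deriv K) 0))) = _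
    rw [G0, K0, G1, K1, G2, K2]
    simp only [map_neg, map_smul, LinearMap.neg_apply, LinearMap.smul_apply, smul_eq_mul]
    ring

end

/-! ### The curvature tensor of the invariant metrics -/

lemma Uo_add_left (x₁ x₂ : ℝ) (X X' Y : su5) :
    Uo x₁ x₂ (X + X') Y = Uo x₁ x₂ X Y + Uo x₁ x₂ X' Y := by
  simp only [Uo, map_add, LinearMap.add_apply]
  module

lemma Uo_smul_left (x₁ x₂ c : ℝ) (X Y : su5) : Uo x₁ x₂ (c • X) Y = c • Uo x₁ x₂ X Y := by
  simp only [Uo, map_smul, LinearMap.smul_apply]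
  module

lemma Uo_comm (x₁ x₂ : ℝ) (X Y : su5) : Uo x₁ x₂ X Y = Uo x₁ x₂ Y X := by
  rw [Uo, Uo, add_comm]

lemma Uo_add_right (x₁ x₂ : ℝ) (X Y Y' : su5) :
    Uo x₁ x₂ X (Y + Y') = Uo x₁ x₂ X Y + Uo x₁ x₂ X Y' := by
  rw [Uo_comm, Uo_add_left, Uo_comm, Uo_comm _ _ X Y']

lemma Uo_smul_right (x₁ x₂ c : ℝ) (X Y : su5) : Uo x₁ x₂ X (c • Y) = c • Uo x₁ x₂ X Y := by
  rw [Uo_comm, Uo_smul_left, Uo_comm]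

lemma Uo_horizontal (x₁ x₂ : ℝ) (X Y : su5) :
    P1 (Uo x₁ x₂ X Y) + P2 (Uo x₁ x₂ X Y) = Uo x₁ x₂ X Y := by
  have h : P2 (Uo x₁ x₂ X Y) = Uo x₁ x₂ X Y := by
    rw [Uo, map_smul, map_add, P2_br_12 (P1_P1 X) (P2_P2 Y), P2_br_12 (P1_P1 Y) (P2_P2 X)]
  rw [P1_of_P2 h, zero_add, h]

/-- The polarized second derivative of a bilinear form in exponential coordinates. -/
def hess (B : LinearMap.BilinForm ℝ su5) (X Y v w : su5) : ℝ :=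
  1 / 6 * (B (br X (br Y v)) w + B (br Y (br X v)) w + B v (br X (br Y w)) +
    B v (br Y (br X w))) + 1 / 4 * (B (br X v) (br Y w) + B (br Y v) (br X w))

/-- The curvature tensor of the invariant metric at the base point, on horizontal vectors. -/
def Rm (x₁ x₂ : ℝ) (X Y Z W : su5) : ℝ :=
  (hess (Bf x₁ x₂) X Y Z W + hess (Bf x₁ x₂) X Z Y W - hess (Bf x₁ x₂) X W Y Z) / 2
    - (hess (Bf x₁ x₂) Y X Z W + hess (Bf x₁ x₂) Y Z X W - hess (Bf x₁ x₂) Y W X Z) / 2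
    - Bf x₁ x₂ (Uo x₁ x₂ Y Z) (Uo x₁ x₂ X W) + Bf x₁ x₂ (Uo x₁ x₂ X Z) (Uo x₁ x₂ Y W)

/-- In the polarized second derivatives every bracket of a vector with itself vanishes; what remains
is the left side of `besse_eq_Kf`. -/
lemma Rm_self {x₁ x₂ : ℝ} (h₂ : 0 < x₂) {X Y : su5} (hX : P1 X + P2 X = X)
    (hY : P1 Y + P2 Y = Y) : Rm x₁ x₂ X Y Y X = Kf x₁ x₂ X Y := by
  rw [← besse_eq_Kf h₂ hX hY, Rm, Uo_comm _ _ Y X]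
  simp only [hess, br_self, map_zero, LinearMap.zero_apply, br_anti X Y, map_neg,
    LinearMap.neg_apply, Bf_comm _ _ Y, Bf_comm _ _ X]
  rw [Bf_comm _ _ (Uo x₁ x₂ Y Y)]
  ring

/-- This symmetry in the inner entries lets the Ricci form be recovered from its quadratic form. -/
lemma Rm_comm (x₁ x₂ : ℝ) (X Y Z : su5) : Rm x₁ x₂ X Y Z X = Rm x₁ x₂ X Z Y X := by
  rw [Rm, Rm, Uo_comm _ _ Z Y, Uo_comm _ _ Z X, Uo_comm _ _ Y X,
    Bf_comm _ _ (Uo x₁ x₂ X Z)]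
  have h : ∀ X Y Z W, hess (Bf x₁ x₂) X Y Z W = hess (Bf x₁ x₂) Y X Z W := fun X Y Z W => by
    rw [hess, hess]; ring
  have h' : ∀ X Y Z W, hess (Bf x₁ x₂) X Y Z W = hess (Bf x₁ x₂) X Y W Z := fun X Y Z W => by
    rw [hess, hess]
    linear_combination 1 / 6 * (Bf_comm x₁ x₂ (br X (br Y Z)) W + Bf_comm x₁ x₂ (br Y (br X Z)) W +
      Bf_comm x₁ x₂ Z (br X (br Y W)) + Bf_comm x₁ x₂ Z (br Y (br X W))) +
      1 / 4 * (Bf_comm x₁ x₂ (br X Z) (br Y W) + Bf_comm x₁ x₂ (br Y Z) (br X W))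
  linear_combination -1 / 2 * h' X X Y Z - 1 / 2 * h' Y X Z X - 1 / 2 * h Y Z X X +
    1 / 2 * h' Z X Y X

/-- The bilinear form given by the outer entries of the curvature tensor. -/
def RmOuter (x₁ x₂ : ℝ) (Y Z : su5) : LinearMap.BilinForm ℝ su5 :=
  LinearMap.mk₂ ℝ (fun X W => Rm x₁ x₂ X Y Z W)
    (fun _ _ _ => by
      simp only [Rm, hess, Uo_add_left, map_add, LinearMap.add_apply]; ring)
    (fun _ _ _ => by
      simp only [Rm, hess, Uo_smul_left, map_smul, LinearMap.smul_apply, smul_eq_mul]; ring)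
    (fun _ _ _ => by
      simp only [Rm, hess, Uo_add_right, map_add, LinearMap.add_apply]; ring)
    (fun _ _ _ => by
      simp only [Rm, hess, Uo_smul_right, map_smul, LinearMap.smul_apply, smul_eq_mul]; ring)

/-- The bilinear form given by the inner entries of the curvature tensor. -/
def RmInner (x₁ x₂ : ℝ) (X W : su5) : LinearMap.BilinForm ℝ su5 :=
  LinearMap.mk₂ ℝ (fun Y Z => Rm x₁ x₂ X Y Z W)
    (fun _ _ _ => by
      simp only [Rm, hess, Uo_add_left, map_add, LinearMap.add_apply]; ring)
    (fun _ _ _ => by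
      simp only [Rm, hess, Uo_smul_left, map_smul, LinearMap.smul_apply, smul_eq_mul]; ring)
    (fun _ _ _ => by
      simp only [Rm, hess, Uo_add_right, map_add, LinearMap.add_apply]; ring)
    (fun _ _ _ => by
      simp only [Rm, hess, Uo_smul_right, map_smul, LinearMap.smul_apply,
        smul_eq_mul]; ring)

/-- The Ricci tensor at the base point. -/
lemma sum_Rm {x₁ x₂ : ℝ} (h₁ : 0 < x₁) (h₂ : 0 < x₂) {Y Z : su5} (hY : P1 Y + P2 Y = Y)
    (hZ : P1 Z + P2 Z = Z) :
    ∑ k, 1 / (2 * x₁) * Rm x₁ x₂ (fr1 k) Y Z (fr1 k) +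
      ∑ k, 1 / x₂ * Rm x₁ x₂ (fr2 k) Y Z (fr2 k) =
    (8 + (x₁ / x₂) ^ 2) * Qf (P1 Y) (P1 Z) + (10 - 5 / 4 * (x₁ / x₂)) * Qf (P2 Y) (P2 Z) := by
  have hf1 : ∀ k, P1 (fr1 k) + P2 (fr1 k) = fr1 k := fun k => by
    rw [P1_fr1, P2_of_P1 (P1_fr1 k), add_zero]
  have hf2 : ∀ k, P1 (fr2 k) + P2 (fr2 k) = fr2 k := fun k => by
    rw [P2_fr2, P1_of_P2 (P2_fr2 k), zero_add]
  have hq : ∀ W, P1 W + P2 W = W →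
      ∑ k, 1 / (2 * x₁) * RmInner x₁ x₂ (fr1 k) (fr1 k) W W +
        ∑ k, 1 / x₂ * RmInner x₁ x₂ (fr2 k) (fr2 k) W W =
      (8 + (x₁ / x₂) ^ 2) * Qf (P1 W) (P1 W) + (10 - 5 / 4 * (x₁ / x₂)) * Qf (P2 W) (P2 W) := by
    intro W hW
    rw [← sum_Kf h₁ h₂ W]
    congr 1
    · exact Finset.sum_congr rfl fun k _ => congrArg _ (Rm_self h₂ (hf1 k) hW)
    · exact Finset.sum_congr rfl fun k _ => congrArg _ (Rm_self h₂ (hf2 k) hW)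
  have hs : ∀ X, RmInner x₁ x₂ X X Z Y = RmInner x₁ x₂ X X Y Z := fun X => Rm_comm x₁ x₂ X Z Y
  -- Polarization of `hq`, which comes from `sum_Kf`.
  have h3 := hq (Y + Z) (by rw [map_add, map_add]; nth_rewrite 3 [← hY, ← hZ]; abel)
  have h4 := hq Y hY
  have h5 := hq Z hZ
  simp only [map_add, LinearMap.add_apply, hs, mul_add, Finset.sum_add_distrib,
    Qf_comm (P1 Z) (P1 Y), Qf_comm (P2 Z) (P2 Y)] at h3
  change ∑ k, 1 / (2 * x₁) * RmInner x₁ x₂ (fr1 k) (fr1 k) Y Z +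
        ∑ k, 1 / x₂ * RmInner x₁ x₂ (fr2 k) (fr2 k) Y Z = _
  linarith

/-! ### Curvature of the invariant metrics in exponential coordinates. -/

/-- The component of `Ad a⁻¹ u` outside `𝔭₁ ⊕ 𝔭₂` lies in the isotropy algebra at the base point. It
is orthogonal to `Ad a⁻¹ u` by definition of `Tangent` and to both projections, hence to itself. -/
lemma tangent_horizontal (a : SU5) (u : Tangent (a • basePoint)) :
    P1 (Ad a⁻¹ u) + P2 (Ad a⁻¹ u) = Ad a⁻¹ u := by
  obtain ⟨U, hU⟩ : ∃ U, Ad a⁻¹ u.1 = U := ⟨_, rfl⟩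
  rw [hU]
  set W := U - P1 U - P2 U with hW
  have h1 : P1 W = 0 := by simp [hW, P1_P1, P1_P2]
  have h2 : P2 W = 0 := by simp [hW, P2_P1, P2_P2]
  have h3 : Ad a W ∈ isotropy (a • basePoint) := by
    rw [mem_isotropy_smul, Ad_inv_Ad, mem_isotropy_basePoint]
    exact ⟨h1, h2⟩
  have h4 : Qf U W = 0 := by
    have h5 : Qf u.1 (Ad a W) = 0 := u.2 _ h3
    rwa [← Ad_Ad_inv a u.1, hU, Qf_Ad] at h5
  have h6 : W = 0 := by
    refine Qf_self_eq_zero ?_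
    have h7 : Qf W W = Qf U W - Qf (P1 U) W - Qf (P2 U) W := by
      conv_lhs => enter [1]; rw [hW]
      simp only [map_sub, LinearMap.sub_apply]
    rw [h7, Qf_P1, Qf_P2, h1, h2, h4]
    simp
  rw [hW, sub_sub, sub_eq_zero] at h6
  exact h6.symm

lemma Ad_mem_tangent (a : SU5) {X : su5} (hX : P1 X + P2 X = X) :
    Ad a X ∈ orth (isotropy (a • basePoint)) := by
  intro Y hY
  rw [mem_isotropy_smul, mem_isotropy_basePoint] at hY
  change Qf (Ad a X) Y = 0
  rw [← Ad_Ad_inv a Y, Qf_Ad, ← hX, map_add, LinearMap.add_apply, Qf_P1, Qf_P2, hY.1, hY.2]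
  simp

section
attribute [local instance] Matrix.linftyOpNormedRing Matrix.linftyOpNormedAlgebra

lemma leftLog_zero (v : su5) : leftLog 0 v = v := by
  apply Subtype.ext
  rw [leftLog_val, Submodule.coe_zero, neg_zero, NormedSpace.exp_zero, one_mul]
  exact dexp_zero v.1

end

/-- The form of the invariant metric at `a • basePoint`. -/
def formAt (x₁ x₂ : ℝ) (a : SU5) : LinearMap.BilinForm ℝ su5 :=
  (Bf x₁ x₂).compl₁₂ (AdL a⁻¹) (AdL a⁻¹)

lemma formAt_apply (x₁ x₂ : ℝ) (a : SU5) (X Y : su5) :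
    formAt x₁ x₂ a X Y = Bf x₁ x₂ (Ad a⁻¹ X) (Ad a⁻¹ Y) := rfl

section Metric

variable {x₁ x₂ : ℝ} (h₁ : 0 < x₁) (h₂ : 0 < x₂) (a : SU5)

/-- The point is `(exp X · a) • basePoint`, so moving back to the base point cancels `exp X` and
turns the right logarithmic derivative into the left one. The coordinate then enters only through
`leftLog`, and the form is fixed. -/
lemma coeff_invMetric (X v w : Tangent (a • basePoint)) :
    (invMetric x₁ x₂ h₁ h₂).coeff (a • basePoint) X v w =
      formAt x₁ x₂ a (leftLog X v) (leftLog X w) := by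
  change invForm x₁ x₂ _ _ _ = _
  rw [formAt_apply, ← mul_smul, invForm_smul, leftLog, leftLog, ← Ad_mul, ← Ad_mul, mul_inv_rev]

lemma coeff_invMetric_zero (v w : Tangent (a • basePoint)) :
    (invMetric x₁ x₂ h₁ h₂).coeff (a • basePoint) 0 v w = formAt x₁ x₂ a v w := by
  rw [coeff_invMetric, Submodule.coe_zero, leftLog_zero, leftLog_zero]

lemma lineDeriv_coeff (u v w : Tangent (a • basePoint)) :
    lineDeriv ℝ (fun y => (invMetric x₁ x₂ h₁ h₂).coeff (a • basePoint) y v w) 0 u =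
      -(1 / 2) * (formAt x₁ x₂ a (br u v) w + formAt x₁ x₂ a v (br u w)) := by
  rw [← (deriv_bilin_leftLog (formAt x₁ x₂ a) u v w).1.deriv, lineDeriv]
  simp only [coeff_invMetric, zero_add, Submodule.coe_smul]

lemma hasDerivAt_lineDeriv_coeff (u u' v w : Tangent (a • basePoint)) :
    HasDerivAt (fun s : ℝ => lineDeriv ℝ
      (fun y => (invMetric x₁ x₂ h₁ h₂).coeff (a • basePoint) y v w) (0 + s • u) u')
      (hess (formAt x₁ x₂ a) u u' v w) 0 := by
  have h := hasDerivAt_lineDeriv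
    (f := fun y => (invMetric x₁ x₂ h₁ h₂).coeff (a • basePoint) y v w)
    (c := fun X => 1 / 3 * (formAt x₁ x₂ a (br X (br X v)) w +
      formAt x₁ x₂ a v (br X (br X w))) + 1 / 2 * formAt x₁ x₂ a (br X v) (br X w))
    (fun e e' => ?_) (fun X => ?_) u u'
  · refine h.congr_deriv ?_
    simp only [hess, Submodule.coe_add, map_add, LinearMap.add_apply]
    ring
  · simp only [coeff_invMetric]
    let L : ℝ × ℝ →ₗ[ℝ] su5 := (LinearMap.fst ℝ ℝ ℝ).smulRight e.1 +
      (LinearMap.snd ℝ ℝ ℝ).smulRight e'.1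
    exact contDiff_bilin _ (contDiff_leftLog L v) (contDiff_leftLog L w)
  · simp only [coeff_invMetric]
    exact (deriv_bilin_leftLog (formAt x₁ x₂ a) X v w).2

lemma lineDeriv_christoffelFst (u v w z : Tangent (a • basePoint)) :
    lineDeriv ℝ (fun y => christoffelFst ((invMetric x₁ x₂ h₁ h₂).coeff (a • basePoint)) y v w z)
      0 u = (hess (formAt x₁ x₂ a) u v w z + hess (formAt x₁ x₂ a) u w v z -
        hess (formAt x₁ x₂ a) u z v w) / 2 :=
  ((((hasDerivAt_lineDeriv_coeff h₁ h₂ a u v w z).add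
    (hasDerivAt_lineDeriv_coeff h₁ h₂ a u w v z)).sub
    (hasDerivAt_lineDeriv_coeff h₁ h₂ a u z v w)).div_const 2).deriv

/-- The inner product of the invariant metric on the tangent space. -/
def tangentForm (x₁ x₂ : ℝ) (a : SU5) : LinearMap.BilinForm ℝ (Tangent (a • basePoint)) :=
  (formAt x₁ x₂ a).compl₁₂ (Submodule.subtype _) (Submodule.subtype _)

lemma tangentForm_apply (v w : Tangent (a • basePoint)) :
    tangentForm x₁ x₂ a v w = Bf x₁ x₂ (Ad a⁻¹ v) (Ad a⁻¹ w) := rfl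

lemma tangentForm_comm (v w : Tangent (a • basePoint)) :
    tangentForm x₁ x₂ a v w = tangentForm x₁ x₂ a w v := by
  rw [tangentForm_apply, tangentForm_apply, Bf_comm]

/-- `Bf` is degenerate on `su5`, but its kernel is the isotropy algebra, which meets the tangent
space only in zero. -/
lemma tangentForm_pos {x₁ x₂ : ℝ} (h₁ : 0 < x₁) (h₂ : 0 < x₂) (a : SU5) (v : Tangent (a • basePoint)) (hv : v ≠ 0) :
    0 < tangentForm x₁ x₂ a v v := by
  rw [tangentForm_apply]
  refine lt_of_le_of_ne (Bf_self_nonneg h₁ h₂ _) fun h => hv ?_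
  have h3 := (Bf_self_eq_zero h₁ h₂).1 h.symm
  have h4 := tangent_horizontal a v
  rw [h3.1, h3.2, add_zero] at h4
  apply Subtype.ext
  rw [← Ad_Ad_inv a v.1, ← h4]
  exact map_zero (AdL a)

/-- In the Koszul combination of the first derivatives the terms containing `[u, v]` cancel, leaving
the right side of `Uo_spec`. Hence `∇` on constant fields is at the origin just the symmetric tensor
`Uo`. -/
lemma christoffel_coeff (u v : Tangent (a • basePoint)) :
    christoffel ((invMetric x₁ x₂ h₁ h₂).coeff (a • basePoint)) 0 u v =
      ⟨Ad a (Uo x₁ x₂ (Ad a⁻¹ u) (Ad a⁻¹ v)), Ad_mem_tangent a (Uo_horizontal _ _ _ _)⟩ := by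
  refine christoffel_eq (tangentForm x₁ x₂ a) (coeff_invMetric_zero h₁ h₂ a) (tangentForm_comm a)
    (tangentForm_pos h₁ h₂ a) fun z => ?_
  rw [tangentForm_apply, Ad_inv_Ad, Uo_spec h₂ (tangent_horizontal a u) (tangent_horizontal a v)
    (tangent_horizontal a z), christoffelFst, lineDeriv_coeff, lineDeriv_coeff, lineDeriv_coeff]
  simp only [formAt_apply, Ad_br]
  rw [br_anti (Ad a⁻¹ u) (Ad a⁻¹ v), br_anti (Ad a⁻¹ u) (Ad a⁻¹ z), br_anti (Ad a⁻¹ z) (Ad a⁻¹ v),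
    Bf_comm _ _ (Ad a⁻¹ v) (br (Ad a⁻¹ u) _)]
  simp only [map_neg, LinearMap.neg_apply]
  ring

lemma riemann_coeff (u v w z : Tangent (a • basePoint)) :
    riemann ((invMetric x₁ x₂ h₁ h₂).coeff (a • basePoint)) 0 u v w z =
      Rm x₁ x₂ (Ad a⁻¹ u) (Ad a⁻¹ v) (Ad a⁻¹ w) (Ad a⁻¹ z) := by
  rw [riemann, lineDeriv_christoffelFst, lineDeriv_christoffelFst, christoffel_coeff,
    christoffel_coeff, christoffel_coeff, christoffel_coeff, coeff_invMetric_zero,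
    coeff_invMetric_zero, Rm]
  simp only [formAt_apply, hess, Ad_br, Ad_inv_Ad]

end Metric

/-! ### Sectional curvature and Ricci tensor of the invariant metrics. -/

section Generic

variable {V : Type*} [AddCommGroup V] [Module ℝ V]

lemma cauchySchwarz_strict (B : LinearMap.BilinForm ℝ V) (hs : ∀ v w, B v w = B w v)
    (hp : ∀ v, v ≠ 0 → 0 < B v v) {u v : V}
    (h : ∀ r s : ℝ, r • u + s • v = 0 → r = 0 ∧ s = 0) : 0 < B u u * B v v - B u v ^ 2 := by
  have hv : v ≠ 0 := fun hv => one_ne_zero (h 0 1 (by rw [hv, zero_smul, smul_zero, add_zero])).2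
  have hvv := hp v hv
  -- A multiple of the component of `u` orthogonal to `v`; its square is `B v v` times the Gram
  -- determinant.
  have hw : B v v • u + (-B u v) • v ≠ 0 := fun h0 => hvv.ne' (h _ _ h0).1
  have h3 := hp _ hw
  simp only [map_add, map_smul, LinearMap.add_apply, LinearMap.smul_apply, smul_eq_mul,
    hs v u] at h3
  refine pos_of_mul_pos_right (a := B v v) ?_ hvv.le
  linarith

lemma linearIndependent_pair_coe {S : Submodule ℝ V} (u v : S) :
    LinearIndependent ℝ ![u, v] ↔
      ∀ r s : ℝ, r • (u : V) + s • (v : V) = 0 → r = 0 ∧ s = 0 := by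
  rw [LinearIndependent.pair_iff]
  refine forall_congr' fun r => forall_congr' fun s => ?_
  rw [← Submodule.coe_smul, ← Submodule.coe_smul, ← Submodule.coe_add, Submodule.coe_eq_zero]

end Generic

section Metric

variable {x₁ x₂ : ℝ} (h₁ : 0 < x₁) (h₂ : 0 < x₂) (a : SU5)

lemma sec_invMetric (u v : Tangent (a • basePoint)) :
    (invMetric x₁ x₂ h₁ h₂).sec (a • basePoint) u v =
      Kf x₁ x₂ (Ad a⁻¹ u) (Ad a⁻¹ v) / (tangentForm x₁ x₂ a u u * tangentForm x₁ x₂ a v v -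
        tangentForm x₁ x₂ a u v ^ 2) := by
  rw [RiemMetric.sec, sectional, riemann_coeff,
    Rm_self h₂ (tangent_horizontal a u) (tangent_horizontal a v), coeff_invMetric_zero,
    coeff_invMetric_zero, coeff_invMetric_zero]
  rfl

/-- The translation of tangent vectors to the base point. -/
def toBase (a : SU5) : Tangent (a • basePoint) →ₗ[ℝ] su5 := AdL a⁻¹ ∘ₗ Submodule.subtype _

lemma toBase_apply (u : Tangent (a • basePoint)) : toBase a u = Ad a⁻¹ u := rfl

lemma toBase_injective : Function.Injective (toBase a) := by
  intro u v h
  rw [toBase_apply, toBase_apply] at h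
  apply Subtype.ext
  rw [← Ad_Ad_inv a u.1, h, Ad_Ad_inv]

lemma independent_Ad_inv {X Y : su5} (h : ∀ r s : ℝ, r • X + s • Y = 0 → r = 0 ∧ s = 0) :
    ∀ r s : ℝ, r • Ad a⁻¹ X + s • Ad a⁻¹ Y = 0 → r = 0 ∧ s = 0 := by
  intro r s hrs
  apply h r s
  have h3 := congrArg (Ad a) hrs
  rwa [← Ad_smul, ← Ad_smul, ← AdL_apply a⁻¹, ← AdL_apply a⁻¹, ← map_add, AdL_apply, Ad_Ad_inv,
    ← AdL_apply a 0, map_zero] at h3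

lemma tangentForm_cauchySchwarz {x₁ x₂ : ℝ} (h₁ : 0 < x₁) (h₂ : 0 < x₂) (a : SU5)
    {u v : Tangent (a • basePoint)}
    (h : ∀ r s : ℝ, r • (u : su5) + s • (v : su5) = 0 → r = 0 ∧ s = 0) :
    0 < tangentForm x₁ x₂ a u u * tangentForm x₁ x₂ a v v - tangentForm x₁ x₂ a u v ^ 2 := by
  have h' : ∀ r s : ℝ, r • u + s • v = 0 → r = 0 ∧ s = 0 :=
    fun r s hrs => h r s (congrArg Subtype.val hrs)
  exact cauchySchwarz_strict (V := Tangent (a • basePoint)) (u := u) (v := v)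
    (tangentForm x₁ x₂ a) (tangentForm_comm a)
    (tangentForm_pos h₁ h₂ a) h'

lemma invMetric_posSec (h : 4 / 3 * x₂ ≤ x₁) (h' : x₁ < 2 * x₂) :
    (invMetric x₁ x₂ h₁ h₂).PosSec := by
  intro p u v huv
  obtain ⟨a, rfl⟩ := exists_smul_basePoint p
  have huv' := (linearIndependent_pair_coe u v).1 huv
  rw [sec_invMetric]
  exact div_pos (Kf_pos h₂ h h' (tangent_horizontal a u) (tangent_horizontal a v)
    (independent_Ad_inv a huv')) (tangentForm_cauchySchwarz h₁ h₂ a huv')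

lemma invMetric_hasNonposPlane (h : 2 * x₂ ≤ x₁) (h' : x₁ ≤ 3 * x₂) :
    (invMetric x₁ x₂ h₁ h₂).HasNonposPlane := by
  obtain ⟨X, Y, hX, hY, hXY, hK⟩ := exists_Kf_nonpos h₂ h h'
  have hXY' := independent_Ad_inv 1 hXY
  rw [inv_one] at hXY'
  refine ⟨(1 : SU5) • basePoint, ⟨Ad 1 X, Ad_mem_tangent 1 hX⟩, ⟨Ad 1 Y, Ad_mem_tangent 1 hY⟩,
    (linearIndependent_pair_coe _ _).2 hXY', ?_⟩
  rw [sec_invMetric, Ad_inv_Ad, Ad_inv_Ad]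
  exact div_nonpos_of_nonpos_of_nonneg hK (tangentForm_cauchySchwarz h₁ h₂ 1 hXY').le

/-- The bilinear form on the tangent space given by the outer entries of the curvature tensor. -/
def tangentRm (x₁ x₂ : ℝ) (a : SU5) (v w : Tangent (a • basePoint)) :
    LinearMap.BilinForm ℝ (Tangent (a • basePoint)) :=
  (RmOuter x₁ x₂ (Ad a⁻¹ v) (Ad a⁻¹ w)).compl₁₂ (toBase a) (toBase a)

lemma tangentRm_apply (v w X Y : Tangent (a • basePoint)) : tangentRm x₁ x₂ a v w X Y =
    Rm x₁ x₂ (Ad a⁻¹ X) (Ad a⁻¹ v) (Ad a⁻¹ w) (Ad a⁻¹ Y) := rfl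

lemma fr1_horizontal (k : Fin 5) : P1 (fr1 k) + P2 (fr1 k) = fr1 k := by
  rw [P1_fr1, P2_of_P1 (P1_fr1 k), add_zero]

lemma fr2_horizontal (k : Four × Fin 2) : P1 (fr2 k) + P2 (fr2 k) = fr2 k := by
  rw [P2_fr2, P1_of_P2 (P2_fr2 k), zero_add]

/-- A frame of the tangent space. -/
def frame (a : SU5) : Fin 5 ⊕ Four × Fin 2 → Tangent (a • basePoint) :=
  Sum.elim (fun k => ⟨Ad a (fr1 k), Ad_mem_tangent a (fr1_horizontal k)⟩)
    (fun k => ⟨Ad a (fr2 k), Ad_mem_tangent a (fr2_horizontal k)⟩)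

lemma Ad_inv_frame_inl (k : Fin 5) : Ad a⁻¹ (frame a (Sum.inl k)) = fr1 k := Ad_inv_Ad a _

lemma Ad_inv_frame_inr (k : Four × Fin 2) : Ad a⁻¹ (frame a (Sum.inr k)) = fr2 k := Ad_inv_Ad a _

/-- The normalization of the frame. -/
def frameCoeff (x₁ x₂ : ℝ) : Fin 5 ⊕ Four × Fin 2 → ℝ :=
  Sum.elim (fun _ => 1 / (2 * x₁)) fun _ => 1 / x₂

/-- The weights are the inverse squared lengths, `2 x₁` for the vectors from `fr1` and `x₂` for
those from `fr2`. -/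
lemma frame_expand {x₁ x₂ : ℝ} (h₁ : 0 < x₁) (h₂ : 0 < x₂) (a : SU5)
    (y : Tangent (a • basePoint)) :
    y = ∑ k, (frameCoeff x₁ x₂ k * tangentForm x₁ x₂ a (frame a k) y) • frame a k := by
  apply toBase_injective a
  rw [map_sum, Fintype.sum_sum_type]
  simp only [map_smul, toBase_apply, tangentForm_apply, Ad_inv_frame_inl, Ad_inv_frame_inr]
  have e1 : ∀ k, frameCoeff x₁ x₂ (Sum.inl k) * Bf x₁ x₂ (fr1 k) (Ad a⁻¹ y) =
      Qf (P1 (Ad a⁻¹ y)) (fr1 k) / 2 := fun k => by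
    rw [Bf_apply, P1_fr1, P2_of_P1 (P1_fr1 k), Qf_comm (fr1 k), map_zero, LinearMap.zero_apply]
    change 1 / (2 * x₁) * _ = _
    field_simp
    ring
  have e2 : ∀ k, frameCoeff x₁ x₂ (Sum.inr k) * Bf x₁ x₂ (fr2 k) (Ad a⁻¹ y) =
      Qf (P2 (Ad a⁻¹ y)) (fr2 k) := fun k => by
    rw [Bf_apply, P2_fr2, P1_of_P2 (P2_fr2 k), Qf_comm (fr2 k), map_zero, LinearMap.zero_apply]
    change 1 / x₂ * _ = _
    field_simp
    ring
  simp only [e1, e2]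
  rw [← fr1_expand (P1_P1 _), ← fr2_expand (P2_P2 _), tangent_horizontal]

/-- The Ricci tensor is again diagonal, so the flow stays in the two-parameter family. It depends
only on `x₁ / x₂`, as it must under scaling of the metric. -/
lemma ric_invMetric (v w : Tangent (a • basePoint)) :
    (invMetric x₁ x₂ h₁ h₂).ric (a • basePoint) v w =
      (8 + (x₁ / x₂) ^ 2) * Qf (P1 (Ad a⁻¹ v)) (P1 (Ad a⁻¹ w)) +
        (10 - 5 / 4 * (x₁ / x₂)) * Qf (P2 (Ad a⁻¹ v)) (P2 (Ad a⁻¹ w)) := by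
  have h := ricci_eq_sum (tangentForm x₁ x₂ a) (coeff_invMetric_zero h₁ h₂ a)
    (tangentForm_comm a) (tangentForm_pos h₁ h₂ a) (frame a) (frameCoeff x₁ x₂)
    (frame_expand h₁ h₂ a) v w (tangentRm x₁ x₂ a v w)
    (fun y z => riemann_coeff h₁ h₂ a y v w z)
  rw [RiemMetric.ric, h, ← sum_Rm h₁ h₂ (tangent_horizontal a v) (tangent_horizontal a w),
    Fintype.sum_sum_type]
  simp only [tangentRm_apply, Ad_inv_frame_inl, Ad_inv_frame_inr]
  rfl

end Metric

/-! ### The Ricci flow equation as a system of ordinary differential equations -/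

/-- The local solution of the reduced Ricci flow through the parameters `(2, 1)`. -/
lemma exists_reducedFlow : ∃ (δ : ℝ) (y₁ y₂ : ℝ → ℝ), 0 < δ ∧ y₁ 0 = 2 ∧ y₂ 0 = 1 ∧
    ∀ t ∈ Set.Ioo (-δ) δ, HasDerivAt y₁ (-2 * (8 + (y₁ t / y₂ t) ^ 2)) t ∧
      HasDerivAt y₂ (-2 * (10 - 5 / 4 * (y₁ t / y₂ t))) t ∧
      0 < y₂ t ∧ 3 / 2 * y₂ t < y₁ t ∧ y₁ t < 5 / 2 * y₂ t := by
  let f : ℝ × ℝ → ℝ × ℝ := fun y =>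
    (-2 * (8 + (y.1 / y.2) ^ 2), -2 * (10 - 5 / 4 * (y.1 / y.2)))
  have hf : ContDiffAt ℝ 1 f (2, 1) := by
    have h : ContDiffAt ℝ 1 (fun y : ℝ × ℝ => y.1 / y.2) (2, 1) :=
      contDiffAt_fst.div contDiffAt_snd (by norm_num)
    exact (contDiffAt_const.mul (contDiffAt_const.add (h.pow 2))).prodMk
      (contDiffAt_const.mul (contDiffAt_const.sub (contDiffAt_const.mul h)))
  obtain ⟨α, hα0, ε, hε, hα⟩ :=
    hf.exists_forall_mem_closedBall_exists_eq_forall_mem_Ioo_hasDerivAt₀ 0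
  have hα1 : ∀ t ∈ Set.Ioo (0 - ε) (0 + ε), HasDerivAt (fun t => (α t).1) (f (α t)).1 t :=
    fun t ht => (hasFDerivAt_fst (𝕜 := ℝ) (p := α t)).comp_hasDerivAt t (hα t ht)
  have hα2 : ∀ t ∈ Set.Ioo (0 - ε) (0 + ε), HasDerivAt (fun t => (α t).2) (f (α t)).2 t :=
    fun t ht => (hasFDerivAt_snd (𝕜 := ℝ) (p := α t)).comp_hasDerivAt t (hα t ht)
  have h0 : (0 : ℝ) ∈ Set.Ioo (0 - ε) (0 + ε) := by simp [hε]
  have c1 := (hα1 0 h0).continuousAt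
  have c2 := (hα2 0 h0).continuousAt
  have v1 : (α 0).1 = 2 := by rw [hα0]
  have v2 : (α 0).2 = 1 := by rw [hα0]
  -- The band `3/2 < φ < 5/2` around `φ = 2` lies inside `[4/3, 3]`, where both curvature results
  -- apply, and inside the region where `φ` increases.
  have ev : ∀ᶠ t in nhds (0 : ℝ), 0 < (α t).2 ∧ 3 / 2 * (α t).2 < (α t).1 ∧
      (α t).1 < 5 / 2 * (α t).2 :=
    (continuousAt_const.eventually_lt c2 (by norm_num [v2])).and
      (((continuousAt_const.mul c2).eventually_lt c1 (by norm_num [v1, v2])).and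
        (c1.eventually_lt (continuousAt_const.mul c2) (by norm_num [v1, v2])))
  obtain ⟨η, hη, hev⟩ := Metric.eventually_nhds_iff.1 ev
  refine ⟨min ε η, fun t => (α t).1, fun t => (α t).2, lt_min hε hη, v1, v2, fun t ht => ?_⟩
  have ht1 : t ∈ Set.Ioo (0 - ε) (0 + ε) :=
    ⟨by linarith [ht.1, min_le_left ε η], by linarith [ht.2, min_le_left ε η]⟩
  refine ⟨hα1 t ht1, hα2 t ht1, hev ?_⟩
  rw [Real.dist_eq, sub_zero]
  exact (abs_lt.2 ht).trans_le (min_le_right _ _)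

/-- The solution through `φ = 2` at time zero extends to both sides and `φ` is strictly increasing
along it. Starting from the earlier time `t₀` with `φ = 2 - ε`, shifting time and rescaling to `x₂ =
1` gives the desired solution, so one trajectory serves all small `ε`. -/
lemma exists_flow : ∃ ε₀ : ℝ, 0 < ε₀ ∧ ∀ ε : ℝ, 0 < ε → ε < ε₀ →
    ∃ (T τ : ℝ) (x₁ x₂ : ℝ → ℝ), 0 < τ ∧ τ < T ∧ x₁ 0 = 2 - ε ∧ x₂ 0 = 1 ∧
      (∀ ℓ ∈ Set.Ico 0 T, 0 < x₂ ℓ ∧ 4 / 3 * x₂ ℓ ≤ x₁ ℓ ∧ x₁ ℓ ≤ 3 * x₂ ℓ ∧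
        HasDerivAt x₁ (-2 * (8 + (x₁ ℓ / x₂ ℓ) ^ 2)) ℓ ∧
        HasDerivAt x₂ (-2 * (10 - 5 / 4 * (x₁ ℓ / x₂ ℓ))) ℓ) ∧
      (∀ ℓ ∈ Set.Ico 0 τ, x₁ ℓ < 2 * x₂ ℓ) ∧ x₁ τ = 2 * x₂ τ ∧
      ∀ ℓ ∈ Set.Ioo τ T, 2 * x₂ ℓ < x₁ ℓ := by
  obtain ⟨δ, y₁, y₂, hδ, hy1, hy2, hy⟩ := exists_reducedFlow
  set φ : ℝ → ℝ := fun t => y₁ t / y₂ t with hφ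
  have hφ0 : φ 0 = 2 := by rw [hφ]; simp [hy1, hy2]
  have hφd : ∀ t ∈ Set.Ioo (-δ) δ,
      HasDerivAt φ ((-16 + 20 * φ t - 9 / 2 * φ t ^ 2) / y₂ t) t := by
    intro t ht
    obtain ⟨d1, d2, p, -, -⟩ := hy t ht
    refine (d1.fun_div d2 p.ne').congr_deriv ?_
    simp only [hφ]
    field_simp
    ring
  have hφc : ContinuousOn φ (Set.Ioo (-δ) δ) := fun t ht =>
    (hφd t ht).continuousAt.continuousWithinAt
  have hmono : StrictMonoOn φ (Set.Ioo (-δ) δ) := by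
    refine strictMonoOn_of_deriv_pos (convex_Ioo _ _) hφc fun t ht => ?_
    rw [interior_Ioo] at ht
    rw [(hφd t ht).deriv]
    obtain ⟨-, -, p, q1, q2⟩ := hy t ht
    have r1 : 3 / 2 < φ t := (lt_div_iff₀ p).2 q1
    have r2 : φ t < 5 / 2 := (div_lt_iff₀ p).2 q2
    refine div_pos ?_ p
    -- The numerator `-16 + 20 φ - 9/2 φ²` is concave in `φ` and positive at both `3/2` and `5/2`.
    nlinarith
  have m0 : (0 : ℝ) ∈ Set.Ioo (-δ) δ := ⟨by linarith, hδ⟩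
  have m1 : -(δ / 2) ∈ Set.Ioo (-δ) δ := ⟨by linarith, by linarith⟩
  -- Every value between `φ (-δ/2)` and `2` is attained at a negative time, so this is an admissible
  -- bound for `ε`.
  refine ⟨2 - φ (-(δ / 2)), ?_, fun ε hε hε' => ?_⟩
  · have := hmono m1 m0 (by linarith)
    linarith
  obtain ⟨t₀, ht₀, hφt₀⟩ := intermediate_value_Ioo (by linarith : -(δ / 2) ≤ 0)
    (hφc.mono fun t ht => ⟨by linarith [ht.1], by linarith [ht.2]⟩)
    (⟨by linarith, by linarith⟩ : 2 - ε ∈ Set.Ioo (φ (-(δ / 2))) (φ 0))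
  have m2 : t₀ ∈ Set.Ioo (-δ) δ := ⟨by linarith [ht₀.1], by linarith [ht₀.2]⟩
  -- `c` is the scale that normalizes `x₂` at the start. The crossing time is then `τ = -t₀ / c` and
  -- the end time `(δ - t₀) / c`.
  obtain ⟨c, hc⟩ : ∃ c, y₂ t₀ = c := ⟨_, rfl⟩
  have hc0 : 0 < c := hc ▸ (hy t₀ m2).2.2.1
  have hm : ∀ ℓ ∈ Set.Ico 0 (c⁻¹ * (δ - t₀)), c * ℓ + t₀ ∈ Set.Ioo (-δ) δ := by
    intro ℓ hℓ
    have h1 : 0 ≤ c * ℓ := mul_nonneg hc0.le hℓ.1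
    have h2 : c * ℓ < δ - t₀ := by
      have := mul_lt_mul_of_pos_left hℓ.2 hc0
      rwa [mul_inv_cancel_left₀ hc0.ne'] at this
    exact ⟨by linarith [m2.1], by linarith⟩
  have hτ : c * (c⁻¹ * -t₀) + t₀ = 0 := by rw [mul_inv_cancel_left₀ hc0.ne']; ring
  have hτ0 : 0 < c⁻¹ * -t₀ := mul_pos (inv_pos.2 hc0) (by linarith [ht₀.2])
  have hτT : c⁻¹ * -t₀ < c⁻¹ * (δ - t₀) := mul_lt_mul_of_pos_left (by linarith) (inv_pos.2 hc0)
  -- Parabolic scaling: dividing the metric by `c` while speeding up time by `c` leaves the velocity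
  -- unchanged, and the right sides depend only on the ratio.
  have hd : ∀ {y : ℝ → ℝ} {y' ℓ : ℝ}, HasDerivAt y y' (c * ℓ + t₀) →
      HasDerivAt (fun ℓ => c⁻¹ * y (c * ℓ + t₀)) y' ℓ := by
    intro y y' ℓ h
    have h1 : HasDerivAt (fun ℓ => c * ℓ + t₀) c ℓ := by
      simpa using ((hasDerivAt_id ℓ).const_mul c).add_const t₀
    refine ((h.comp ℓ h1).const_mul c⁻¹).congr_deriv ?_
    field_simp
  have hr : ∀ t, c⁻¹ * y₁ t / (c⁻¹ * y₂ t) = y₁ t / y₂ t := fun t =>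
    mul_div_mul_left _ _ (inv_ne_zero hc0.ne')
  refine ⟨c⁻¹ * (δ - t₀), c⁻¹ * -t₀, fun ℓ => c⁻¹ * y₁ (c * ℓ + t₀),
    fun ℓ => c⁻¹ * y₂ (c * ℓ + t₀), hτ0, hτT, ?_, ?_, fun ℓ hℓ => ?_, fun ℓ hℓ => ?_, ?_,
    fun ℓ hℓ => ?_⟩
  · simp only [mul_zero, zero_add]
    rw [← hφt₀, hφ, ← hc, inv_mul_eq_div]
  · simp only [mul_zero, zero_add]
    rw [hc, inv_mul_cancel₀ hc0.ne']
  · obtain ⟨d1, d2, p, q1, q2⟩ := hy _ (hm ℓ hℓ)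
    have hc' := inv_pos.2 hc0
    refine ⟨mul_pos hc' p, ?_, ?_, ?_, ?_⟩
    · rw [mul_left_comm]
      exact mul_le_mul_of_nonneg_left (by linarith) hc'.le
    · rw [mul_left_comm]
      exact mul_le_mul_of_nonneg_left (by linarith) hc'.le
    · simp only [hr]
      exact hd d1
    · simp only [hr]
      exact hd d2
  · have h1 := hm ℓ ⟨hℓ.1, hℓ.2.trans hτT⟩
    have h2 : c * ℓ + t₀ < 0 := by
      have := mul_lt_mul_of_pos_left hℓ.2 hc0
      linarith
    have h3 := hmono h1 m0 h2
    rw [hφ0] at h3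
    have h4 := (div_lt_iff₀ (hy _ h1).2.2.1).1 h3
    simp only
    rw [mul_left_comm]
    exact mul_lt_mul_of_pos_left h4 (inv_pos.2 hc0)
  · simp only [hτ, hy1, hy2]
    ring
  · have h1 := hm ℓ ⟨hτ0.le.trans hℓ.1.le, hℓ.2⟩
    have h2 : 0 < c * ℓ + t₀ := by
      have := mul_lt_mul_of_pos_left hℓ.1 hc0
      linarith
    have h3 := hmono m0 h1 h2
    rw [hφ0] at h3
    have h4 := (lt_div_iff₀ (hy _ h1).2.2.1).1 h3
    simp only
    rw [mul_left_comm]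
    exact mul_lt_mul_of_pos_left h4 (inv_pos.2 hc0)

/-- There are invariant metrics of positive sectional curvature which lose this property under the
Ricci flow. -/
theorem exists_ricciFlow_losing_positivity :
    ∃ ε₀ : ℝ, 0 < ε₀ ∧ ∀ ε : ℝ, 0 < ε → ε < ε₀ →
      ∃ (T : ℝ) (x₁ x₂ : ℝ → ℝ) (g : ℝ → RiemMetric),
        0 < T ∧ x₁ 0 = 2 - ε ∧ x₂ 0 = 1 ∧
        (∀ ℓ ∈ Set.Ico 0 T, 0 < x₁ ℓ ∧ 0 < x₂ ℓ ∧
          (g ℓ).IsInvariant ∧ (g ℓ).IsDiagonal (x₁ ℓ) (x₂ ℓ)) ∧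
        IsRicciFlow g T ∧
        (g 0).PosSec ∧
        ∃ τ ∈ Set.Ioo 0 T,
          (∀ ℓ ∈ Set.Ico 0 τ, x₁ ℓ < 2 * x₂ ℓ) ∧
          x₁ τ = 2 * x₂ τ ∧
          (∀ ℓ ∈ Set.Ioo τ T, 2 * x₂ ℓ < x₁ ℓ) ∧
          ∀ ℓ ∈ Set.Ico τ T, (g ℓ).HasNonposPlane := by
  obtain ⟨ε₀, hε₀, H⟩ := exists_flow
  refine ⟨ε₀, hε₀, fun ε hε hε' => ?_⟩
  obtain ⟨T, τ, x₁, x₂, hτ, hτT, i1, i2, hx, hlt, heq, hgt⟩ := H ε hε hε'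
  have hT : 0 < T := hτ.trans hτT
  have hpos : ∀ ℓ ∈ Set.Ico 0 T, 0 < x₁ ℓ ∧ 0 < x₂ ℓ := fun ℓ hℓ =>
    ⟨by linarith [(hx ℓ hℓ).1, (hx ℓ hℓ).2.1], (hx ℓ hℓ).1⟩
  classical
  -- Where the parameters are not both positive an arbitrary metric is used; this never happens on
  -- `[0, T)`.
  let g : ℝ → RiemMetric := fun ℓ => if h : 0 < x₁ ℓ ∧ 0 < x₂ ℓ
    then invMetric (x₁ ℓ) (x₂ ℓ) h.1 h.2 else invMetric 1 1 one_pos one_pos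
  have hg : ∀ ℓ (hℓ : ℓ ∈ Set.Ico 0 T),
      g ℓ = invMetric (x₁ ℓ) (x₂ ℓ) (hpos ℓ hℓ).1 (hpos ℓ hℓ).2 := fun ℓ hℓ => dif_pos (hpos ℓ hℓ)
  have m0 : (0 : ℝ) ∈ Set.Ico 0 T := ⟨le_rfl, hT⟩
  refine ⟨T, x₁, x₂, g, hT, i1, i2, fun ℓ hℓ => ?_, fun ℓ hℓ p u v => ?_, ?_, τ, ⟨hτ, hτT⟩, hlt,
    heq, hgt, fun ℓ hℓ => ?_⟩
  · rw [hg ℓ hℓ]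
    exact ⟨(hpos ℓ hℓ).1, (hpos ℓ hℓ).2, invMetric_isInvariant _ _ _ _,
      invMetric_isDiagonal _ _ _ _⟩
  · obtain ⟨a, rfl⟩ := exists_smul_basePoint p
    obtain ⟨-, -, -, d1, d2⟩ := hx ℓ hℓ
    have h1 : ∀ s ∈ Set.Ico 0 T, (g s).form (a • basePoint) u v =
        x₁ s * Qf (P1 (Ad a⁻¹ u)) (P1 (Ad a⁻¹ v)) +
          x₂ s * Qf (P2 (Ad a⁻¹ u)) (P2 (Ad a⁻¹ v)) := by
      intro s hs
      rw [hg s hs]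
      exact invForm_smul _ _ _ _ _
    have h2 := ((d1.mul_const (Qf (P1 (Ad a⁻¹ u)) (P1 (Ad a⁻¹ v)))).fun_add
      (d2.mul_const (Qf (P2 (Ad a⁻¹ u)) (P2 (Ad a⁻¹ v))))).hasDerivWithinAt (s := Set.Ico 0 T)
    refine (h2.congr h1 (h1 ℓ hℓ)).congr_deriv ?_
    rw [hg ℓ hℓ, ric_invMetric]
    ring
  · rw [hg 0 m0]
    exact invMetric_posSec _ _ (hx 0 m0).2.1 (hlt 0 ⟨le_rfl, hτ⟩)
  · have hℓ' : ℓ ∈ Set.Ico 0 T := ⟨hτ.le.trans hℓ.1, hℓ.2⟩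
    rw [hg ℓ hℓ']
    refine invMetric_hasNonposPlane _ _ ?_ (hx ℓ hℓ').2.2.1
    rcases hℓ.1.eq_or_lt with rfl | h
    · exact heq.ge
    · exact (hgt ℓ ⟨h, hℓ.2⟩).le

end

end Berger

theorem theorem2 :
    ∃ ε₀ : ℝ, 0 < ε₀ ∧ ∀ ε : ℝ, 0 < ε → ε < ε₀ →
      ∃ (T : ℝ) (x₁ x₂ : ℝ → ℝ) (g : ℝ → Berger.RiemMetric),
        0 < T ∧ x₁ 0 = 2 - ε ∧ x₂ 0 = 1 ∧
        (∀ ℓ ∈ Set.Ico 0 T, 0 < x₁ ℓ ∧ 0 < x₂ ℓ ∧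
          (g ℓ).IsInvariant ∧ (g ℓ).IsDiagonal (x₁ ℓ) (x₂ ℓ)) ∧
        Berger.IsRicciFlow g T ∧
        (g 0).PosSec ∧
        ∃ τ ∈ Set.Ioo 0 T,
          (∀ ℓ ∈ Set.Ico 0 τ, x₁ ℓ < 2 * x₂ ℓ) ∧
          x₁ τ = 2 * x₂ τ ∧
          (∀ ℓ ∈ Set.Ioo τ T, 2 * x₂ ℓ < x₁ ℓ) ∧
          ∀ ℓ ∈ Set.Ico τ T, (g ℓ).HasNonposPlane :=
  Berger.exists_ricciFlow_losing_positivity
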